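/- Let $P_{Y_1Y_2|X}$ be a discrete memoryless broadcast channel with finite alphabets. All information quantities and rates are in bits. Two independent uniform messages of nonnegative rates $R_1',R_2'$ are to be decoded, the first by receiver 1 and the second by receiver 2. The pair $(R_1',R_2')$ is \emph{achievable} if for every $\varepsilon>0$ and all large $n$ there is a code of length $n$ with at least $2^{n(R_1'-\varepsilon)}$ and $2^{n(R_2'-\varepsilon)}$ messages and average probability of error (at either receiver) at most $\varepsilon$. Let $U_0,U_1,U_2$ take values in finite sets. Index $0$ stands for the common codeword, and $1,2$ for the private codewords of receivers 1, 2. Take a \emph{codebook distribution} $P^c=P^c_{U_0}P^c_{U_1|U_0}P^c_{U_2|U_0}$, an arbitrary \emph{encoding distribution} $P^e=P^e_{U_0U_1U_2}$ and a channel input $X=f(U_0,U_1,U_2)$. Mutual informations are computed under $P^e$ and the channel. For message rates $R_0,R_1,R_2\ge0$ and binning rates $\bar R_0,\bar R_1,\bar R_2\ge0$ put $L_i=R_i+\bar R_i$ and consider the bounds $$\begin{aligned} \bar R_0+\bar R_1+\bar R_2&\ge D(P^e_{U_0U_1U_2}\|P^c_{U_0U_1U_2}),\\ \bar R_0+\bar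 R_1&\ge D(P^e_{U_0U_1}\|P^c_{U_0U_1}),\qquad \bar R_0+\bar R_2\ge D(P^e_{U_0U_2}\|P^c_{U_0U_2}),\qquad \bar R_0\ge D(P^e_{U_0}\|P^c_{U_0}),\\ L_0+L_1&\le I(Y_1;U_0U_1)+D(P^e_{U_0U_1}\|P^c_{U_0U_1}),\qquad L_1\le I(Y_1;U_1|U_0)+D(P^e_{U_1|U_0}\|P^c_{U_1|U_0}|P^e_{U_0}),\\ L_0+L_2&\le I(Y_2;U_0U_2)+D(P^e_{U_0U_2}\|P^c_{U_0U_2}),\qquad L_2\le I(Y_2;U_2|U_0)+D(P^e_{U_2|U_0}\|P^c_{U_2|U_0}|P^e_{U_0}), \end{aligned}\qquad(*)$$ where a divergence is $+\infty$ if absolute continuity fails. Then the following hold. (1) \emph{The scheme works.} If $(*)$ holds, then for every $\varepsilon>0$ and all large $n$ there are numbers $M_i\ge2^{n(R_i-\varepsilon)}$ of messages and $B_i\le2^{n(\bar R_i+\varepsilon)}$ of bin indices ($i=0,1,2$) such that the following holds for the random codebook that consists of codewords $u_0(w_0,b_0)$ drawn i.i.d. from $P^c_{U_0}$ and, superposed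 on each of them, codewords $u_1(w_0,b_0,w_1,b_1)$ and $u_2(w_0,b_0,w_2,b_2)$ drawn from $P^c_{U_1|U_0}$ and $P^c_{U_2|U_0}$. There are rules, depending on the codebook, to choose $(b_0,b_1,b_2)$ jointly from $(w_0,w_1,w_2)$ and to decode $(w_0,w_1)$ from $Y_1^n$ and $(w_0,w_2)$ from $Y_2^n$, such that, averaged over uniform messages and the random codebook, the chosen triple of codewords fails to be $\varepsilon$-typical for $P^e$ (all letter frequencies within $\varepsilon$) with probability at most $\varepsilon$, and, when $X=f(U_0,U_1,U_2)$ is sent letter by letter, some receiver errs with probability at most $\varepsilon$. (2) \emph{Achievable region.} Every pair with $R_1'=R_1+\alpha R_0$, $R_2'=R_2+(1-\alpha)R_0$, where $\alpha\in[0,1]$ and $(*)$ holds for some finite auxiliary alphabets, $P^c$, $P^e$, $f$ and $\bar R_0,\bar R_1,\bar R_2$, is achievable. (3) \emph{Fourier--Motzkin elimination.} Fix a joint law of $(U_0,U_1,U_2,X)$ (with $X$ not necessarily a function of the $U_i$) whose $(U_0,U_1,U_2)$-marginal $P^e$ is absolutely continuous with respect to $P^c$. Binning rates satisfying $(*)$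 exist for $R_0,R_1,R_2\ge 0$ if and only if $$\begin{aligned} R_i&\le I(Y_i;U_i|U_0)+D(P^e_{U_i|U_0}\|P^c_{U_i|U_0}|P^e_{U_0}),\qquad R_0+R_i\le I(Y_i;U_0U_i)\qquad(i=1,2),\\ R_0+R_1+R_2&\le I(Y_1;U_0U_1)+I(Y_2;U_2|U_0)-I(U_1;U_2|U_0),\\ R_0+R_1+R_2&\le I(Y_2;U_0U_2)+I(Y_1;U_1|U_0)-I(U_1;U_2|U_0),\\ 2R_0+R_1+R_2&\le I(Y_1;U_0U_1)+I(Y_2;U_0U_2)-I(U_1;U_2|U_0). \end{aligned}$$ The resulting set of pairs $(R_1',R_2')$ is, for every such $P^c$, the set of pairs $R_1',R_2'\ge0$ with $$\begin{aligned} &R_1'\le I(Y_1;U_0U_1),\qquad R_2'\le I(Y_2;U_0U_2),\\ &R_1'+R_2'\le\min\{I(Y_1;U_0),I(Y_2;U_0)\}+I(Y_1;U_1|U_0)+I(Y_2;U_2|U_0)-I(U_1;U_2|U_0). \end{aligned}\qquad(**)$$ (4) \emph{Marton's region.} The region in (2) equals Marton's region, i.e. the union of the sets $(**)$ over all finite auxiliary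 alphabets and all joint laws of $(U_0,U_1,U_2,X)$. -/

import Mathlib

open scoped BigOperators

noncomputable section

/-! ### Finite information measures, in bits -/

open Classical in
/-- The law (probability mass function) of the random variable `A` on the finite probability
space `(Ω, P)`. -/
def pmfLaw {Ω α : Type*} [Fintype Ω] (P : Ω → ℝ) (A : Ω → α) (a : α) : ℝ :=
  ∑ ω, if A ω = a then P ω else 0

/-- The mutual information `I(A; B)` in bits. -/
def mutualInfo {Ω α β : Type*} [Fintype Ω] [Fintype α] [Fintype β]
    (P : Ω → ℝ) (A : Ω → α) (B : Ω → β) : ℝ :=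
  ∑ a, ∑ b, pmfLaw P (fun ω => (A ω, B ω)) (a, b) *
    Real.logb 2 (pmfLaw P (fun ω => (A ω, B ω)) (a, b) / (pmfLaw P A a * pmfLaw P B b))

/-- The conditional mutual information `I(A; B | C)` in bits. -/
def condMutualInfo {Ω α β γ : Type*} [Fintype Ω] [Fintype α] [Fintype β] [Fintype γ]
    (P : Ω → ℝ) (A : Ω → α) (B : Ω → β) (C : Ω → γ) : ℝ :=
  ∑ a, ∑ b, ∑ c, pmfLaw P (fun ω => (A ω, B ω, C ω)) (a, b, c) *
    Real.logb 2 (pmfLaw P (fun ω => (A ω, B ω, C ω)) (a, b, c) * pmfLaw P C c /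
      (pmfLaw P (fun ω => (A ω, C ω)) (a, c) * pmfLaw P (fun ω => (B ω, C ω)) (b, c)))

open Classical in
/-- The divergence `D(p ‖ q)` in bits; it is `⊤` when `p` is not absolutely continuous with
respect to `q`. -/
def relEntropy {α : Type*} [Fintype α] (p q : α → ℝ) : EReal :=
  if ∀ a, q a = 0 → p a = 0 then ((∑ a, p a * Real.logb 2 (p a / q a) : ℝ) : EReal) else ⊤

/-- The conditional divergence `D(V ‖ W | p) = ∑ a, p(a) D(V(·|a) ‖ W(·|a))` in bits
(with the convention `0 * ⊤ = 0`, which is that of `EReal`). -/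
def condRelEntropy {α β : Type*} [Fintype α] [Fintype β] (p : α → ℝ) (V W : α → β → ℝ) : EReal :=
  ∑ a, (p a : EReal) * relEntropy (V a) (W a)

/-- The conditional law of `B` given `A`, as a stochastic kernel (`0` off the support of `A`). -/
def condLaw {Ω α β : Type*} [Fintype Ω] (P : Ω → ℝ) (B : Ω → β) (A : Ω → α) (a : α) (b : β) : ℝ :=
  pmfLaw P (fun ω => (A ω, B ω)) (a, b) / pmfLaw P A a

/-! ### The discrete memoryless broadcast channel and its capacity region -/

/-- A broadcast channel `P_{Y₁ Y₂ | X}` with finite output alphabets. -/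
structure BroadcastChannel (X Y₁ Y₂ : Type*) [Fintype Y₁] [Fintype Y₂] where
  prob : X → Y₁ × Y₂ → ℝ
  prob_mem : ∀ x, prob x ∈ stdSimplex ℝ (Y₁ × Y₂)

/-- A block code of length `n` with `M₁` messages for receiver 1 and `M₂` for receiver 2. -/
structure BroadcastCode (X Y₁ Y₂ : Type*) (n M₁ M₂ : ℕ) where
  enc : Fin M₁ → Fin M₂ → Fin n → X
  dec₁ : (Fin n → Y₁) → Fin M₁
  dec₂ : (Fin n → Y₂) → Fin M₂

open Classical in
/-- The probability that some receiver decodes its message wrongly, when the two messages are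
independent and uniform and the channel is used `n` times without memory. -/
def BroadcastCode.errorProb {X Y₁ Y₂ : Type*} [Fintype Y₁] [Fintype Y₂] {n M₁ M₂ : ℕ}
    (C : BroadcastCode X Y₁ Y₂ n M₁ M₂) (W : BroadcastChannel X Y₁ Y₂) : ℝ :=
  (∑ m₁ : Fin M₁, ∑ m₂ : Fin M₂, ∑ y : Fin n → Y₁ × Y₂,
    if C.dec₁ (fun i => (y i).1) = m₁ ∧ C.dec₂ (fun i => (y i).2) = m₂ then 0
    else ∏ i, W.prob (C.enc m₁ m₂ i) (y i)) / ((M₁ : ℝ) * (M₂ : ℝ))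

/-- The capacity region: the pairs of nonnegative rates (bits per channel use) that are
achievable, i.e. for each `ε > 0` and all large `n` there is a code of length `n` with at
least `2^{n(R₁ - ε)}` and `2^{n(R₂ - ε)}` messages and error probability at most `ε`. -/
def capacityRegion {X Y₁ Y₂ : Type*} [Fintype Y₁] [Fintype Y₂]
    (W : BroadcastChannel X Y₁ Y₂) : Set (ℝ × ℝ) :=
  {R | 0 ≤ R.1 ∧ 0 ≤ R.2 ∧ ∀ ε : ℝ, 0 < ε → ∃ n₀ : ℕ, ∀ n : ℕ, n₀ ≤ n →
    ∃ (M₁ M₂ : ℕ) (C : BroadcastCode X Y₁ Y₂ n M₁ M₂),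
      (2 : ℝ) ^ ((n : ℝ) * (R.1 - ε)) ≤ M₁ ∧ (2 : ℝ) ^ ((n : ℝ) * (R.2 - ε)) ≤ M₂ ∧
      C.errorProb W ≤ ε}

/-! ### Codebook distribution, encoding distribution and channel input -/

/-- A codebook distribution `P_{U₀} P_{U₁|U₀} P_{U₂|U₀}`: index `0` is the common codeword, on
which the private codewords for receivers 1 and 2 are superposed. -/
structure CodebookLaw (U₀ U₁ U₂ : Type*) [Fintype U₀] [Fintype U₁] [Fintype U₂] where
  p₀ : U₀ → ℝ
  p₁ : U₀ → U₁ → ℝ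
  p₂ : U₀ → U₂ → ℝ
  p₀_mem : p₀ ∈ stdSimplex ℝ U₀
  p₁_mem : ∀ u, p₁ u ∈ stdSimplex ℝ U₁
  p₂_mem : ∀ u, p₂ u ∈ stdSimplex ℝ U₂

namespace CodebookLaw

variable {U₀ U₁ U₂ : Type*} [Fintype U₀] [Fintype U₁] [Fintype U₂]

/-- The joint law of `(U₀, U₁, U₂)` in the codebook. -/
def joint (c : CodebookLaw U₀ U₁ U₂) (u : U₀ × U₁ × U₂) : ℝ :=
  c.p₀ u.1 * c.p₁ u.1 u.2.1 * c.p₂ u.1 u.2.2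

/-- The law of `(U₀, U₁)` in the codebook. -/
def joint₁ (c : CodebookLaw U₀ U₁ U₂) (u : U₀ × U₁) : ℝ := c.p₀ u.1 * c.p₁ u.1 u.2

/-- The law of `(U₀, U₂)` in the codebook. -/
def joint₂ (c : CodebookLaw U₀ U₁ U₂) (u : U₀ × U₂) : ℝ := c.p₀ u.1 * c.p₂ u.1 u.2

end CodebookLaw

open Classical in
/-- The law of `(U, X)` when `U` has law `p` and the channel input is `X = f(U)`. -/
def functionalInput {U X : Type*} (p : U → ℝ) (f : U → X) (z : U × X) : ℝ :=
  if z.2 = f z.1 then p z.1 else 0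

/-- The law of `((U₀, U₁, U₂), X, (Y₁, Y₂))` when `((U₀, U₁, U₂), X)` has law `q` and
`(Y₁, Y₂)` is the output of the channel `W` for the input `X`. -/
def transmitLaw {U X Y₁ Y₂ : Type*} [Fintype Y₁] [Fintype Y₂]
    (W : BroadcastChannel X Y₁ Y₂) (q : U × X → ℝ) (ω : (U × X) × (Y₁ × Y₂)) : ℝ :=
  q ω.1 * W.prob ω.1.2 ω.2

section Quantities

variable {X Y₁ Y₂ U₀ U₁ U₂ : Type*} [Fintype X] [Fintype Y₁] [Fintype Y₂]
  [Fintype U₀] [Fintype U₁] [Fintype U₂]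

/-- `I(Y₁; U₀ U₁)` -/
def infoFull₁ (W : BroadcastChannel X Y₁ Y₂) (q : (U₀ × U₁ × U₂) × X → ℝ) : ℝ :=
  mutualInfo (transmitLaw W q) (fun ω => ω.2.1) (fun ω => (ω.1.1.1, ω.1.1.2.1))

/-- `I(Y₂; U₀ U₂)` -/
def infoFull₂ (W : BroadcastChannel X Y₁ Y₂) (q : (U₀ × U₁ × U₂) × X → ℝ) : ℝ :=
  mutualInfo (transmitLaw W q) (fun ω => ω.2.2) (fun ω => (ω.1.1.1, ω.1.1.2.2))

/-- `I(Y₁; U₁ | U₀)` -/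
def infoPriv₁ (W : BroadcastChannel X Y₁ Y₂) (q : (U₀ × U₁ × U₂) × X → ℝ) : ℝ :=
  condMutualInfo (transmitLaw W q) (fun ω => ω.2.1) (fun ω => ω.1.1.2.1) (fun ω => ω.1.1.1)

/-- `I(Y₂; U₂ | U₀)` -/
def infoPriv₂ (W : BroadcastChannel X Y₁ Y₂) (q : (U₀ × U₁ × U₂) × X → ℝ) : ℝ :=
  condMutualInfo (transmitLaw W q) (fun ω => ω.2.2) (fun ω => ω.1.1.2.2) (fun ω => ω.1.1.1)

/-- `I(Y₁; U₀)` -/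
def infoCommon₁ (W : BroadcastChannel X Y₁ Y₂) (q : (U₀ × U₁ × U₂) × X → ℝ) : ℝ :=
  mutualInfo (transmitLaw W q) (fun ω => ω.2.1) (fun ω => ω.1.1.1)

/-- `I(Y₂; U₀)` -/
def infoCommon₂ (W : BroadcastChannel X Y₁ Y₂) (q : (U₀ × U₁ × U₂) × X → ℝ) : ℝ :=
  mutualInfo (transmitLaw W q) (fun ω => ω.2.2) (fun ω => ω.1.1.1)

/-- `I(U₁; U₂ | U₀)` -/
def infoCross (q : (U₀ × U₁ × U₂) × X → ℝ) : ℝ :=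
  condMutualInfo q (fun z => z.1.2.1) (fun z => z.1.2.2) (fun z => z.1.1)

/-- `D(P^e_{U₀ U₁ U₂} ‖ P^c_{U₀ U₁ U₂})` -/
def divAll (c : CodebookLaw U₀ U₁ U₂) (q : (U₀ × U₁ × U₂) × X → ℝ) : EReal :=
  relEntropy (pmfLaw q (fun z => z.1)) c.joint

/-- `D(P^e_{U₀ U₁} ‖ P^c_{U₀ U₁})` -/
def divPair₁ (c : CodebookLaw U₀ U₁ U₂) (q : (U₀ × U₁ × U₂) × X → ℝ) : EReal :=
  relEntropy (pmfLaw q (fun z => (z.1.1, z.1.2.1))) c.joint₁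

/-- `D(P^e_{U₀ U₂} ‖ P^c_{U₀ U₂})` -/
def divPair₂ (c : CodebookLaw U₀ U₁ U₂) (q : (U₀ × U₁ × U₂) × X → ℝ) : EReal :=
  relEntropy (pmfLaw q (fun z => (z.1.1, z.1.2.2))) c.joint₂

/-- `D(P^e_{U₀} ‖ P^c_{U₀})` -/
def divCommon (c : CodebookLaw U₀ U₁ U₂) (q : (U₀ × U₁ × U₂) × X → ℝ) : EReal :=
  relEntropy (pmfLaw q (fun z => z.1.1)) c.p₀

/-- `D(P^e_{U₁|U₀} ‖ P^c_{U₁|U₀} | P^e_{U₀})` -/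
def divPriv₁ (c : CodebookLaw U₀ U₁ U₂) (q : (U₀ × U₁ × U₂) × X → ℝ) : EReal :=
  condRelEntropy (pmfLaw q (fun z => z.1.1)) (condLaw q (fun z => z.1.2.1) (fun z => z.1.1)) c.p₁

/-- `D(P^e_{U₂|U₀} ‖ P^c_{U₂|U₀} | P^e_{U₀})` -/
def divPriv₂ (c : CodebookLaw U₀ U₁ U₂) (q : (U₀ × U₁ × U₂) × X → ℝ) : EReal :=
  condRelEntropy (pmfLaw q (fun z => z.1.1)) (condLaw q (fun z => z.1.2.2) (fun z => z.1.1)) c.p₂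

end Quantities

/-! ### The regions -/

/-- A triple of rates: of the common codeword and of the private codewords for receivers 1, 2. -/
structure RateTriple where
  common : ℝ
  priv₁ : ℝ
  priv₂ : ℝ

/-- All three rates are nonnegative. -/
def RateTriple.Nonneg (R : RateTriple) : Prop := 0 ≤ R.common ∧ 0 ≤ R.priv₁ ∧ 0 ≤ R.priv₂

/-! ### The random coding scheme: superposition followed by joint binning -/

/-- Sizes of the three index sets: common, private for receiver 1, private for receiver 2. -/
structure SizeTriple where
  common : ℕ
  priv₁ : ℕ
  priv₂ : ℕ

/-- A superposition codebook of block length `n`, with `M` messages and `B` bin indices.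
Common codewords are indexed by `(w₀, b₀)`; for each of these there is a codebook of private
codewords for receiver 1 indexed by `(w₁, b₁)` and one for receiver 2 indexed by `(w₂, b₂)`. -/
abbrev Codebook (U₀ U₁ U₂ : Type*) (n : ℕ) (M B : SizeTriple) :=
  (Fin M.common × Fin B.common → Fin n → U₀) ×
  ((Fin M.common × Fin B.common) × (Fin M.priv₁ × Fin B.priv₁) → Fin n → U₁) ×
  ((Fin M.common × Fin B.common) × (Fin M.priv₂ × Fin B.priv₂) → Fin n → U₂)

/-- The probability of a codebook when common codewords are drawn i.i.d. from `P^c_{U₀}` and the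
private ones, superposed on a common codeword, from `P^c_{U₁|U₀}` and `P^c_{U₂|U₀}`, all
letters and all codewords being (conditionally) independent. -/
def CodebookLaw.bookProb {U₀ U₁ U₂ : Type*} [Fintype U₀] [Fintype U₁] [Fintype U₂]
    (c : CodebookLaw U₀ U₁ U₂) {n : ℕ} {M B : SizeTriple} (K : Codebook U₀ U₁ U₂ n M B) : ℝ :=
  (∏ k, ∏ i, c.p₀ (K.1 k i)) * (∏ k, ∏ i, c.p₁ (K.1 k.1 i) (K.2.1 k i)) *
    (∏ k, ∏ i, c.p₂ (K.1 k.1 i) (K.2.2 k i))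

/-- Rules, depending on the codebook, by which the encoder jointly chooses the three bin indices
for a message triple, and by which each receiver decodes the common message and its own private
message. -/
structure BinningRules (U₀ U₁ U₂ Y₁ Y₂ : Type*) (n : ℕ) (M B : SizeTriple) where
  bins : Codebook U₀ U₁ U₂ n M B → Fin M.common × Fin M.priv₁ × Fin M.priv₂ →
    Fin B.common × Fin B.priv₁ × Fin B.priv₂
  dec₁ : Codebook U₀ U₁ U₂ n M B → (Fin n → Y₁) → Fin M.common × Fin M.priv₁
  dec₂ : Codebook U₀ U₁ U₂ n M B → (Fin n → Y₂) → Fin M.common × Fin M.priv₂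

namespace BinningRules

variable {X Y₁ Y₂ U₀ U₁ U₂ : Type*} {n : ℕ} {M B : SizeTriple}

/-- The triple of codewords chosen for the message triple `w`. -/
def words (S : BinningRules U₀ U₁ U₂ Y₁ Y₂ n M B) (K : Codebook U₀ U₁ U₂ n M B)
    (w : Fin M.common × Fin M.priv₁ × Fin M.priv₂) (i : Fin n) : U₀ × U₁ × U₂ :=
  (K.1 (w.1, (S.bins K w).1) i,
    K.2.1 ((w.1, (S.bins K w).1), (w.2.1, (S.bins K w).2.1)) i,
    K.2.2 ((w.1, (S.bins K w).1), (w.2.2, (S.bins K w).2.2)) i)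

open Classical in
/-- The probability of a decoding error at some receiver when `X = f(U₀, U₁, U₂)` is sent letter
by letter, averaged over uniform messages and over the random codebook. -/
def meanError [Fintype Y₁] [Fintype Y₂] [Fintype U₀] [Fintype U₁] [Fintype U₂]
    (S : BinningRules U₀ U₁ U₂ Y₁ Y₂ n M B) (W : BroadcastChannel X Y₁ Y₂)
    (c : CodebookLaw U₀ U₁ U₂) (f : U₀ × U₁ × U₂ → X) : ℝ :=
  ∑ K : Codebook U₀ U₁ U₂ n M B, c.bookProb K *
    ((∑ w : Fin M.common × Fin M.priv₁ × Fin M.priv₂, ∑ y : Fin n → Y₁ × Y₂,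
      if S.dec₁ K (fun i => (y i).1) = (w.1, w.2.1) ∧ S.dec₂ K (fun i => (y i).2) = (w.1, w.2.2)
      then 0 else ∏ i, W.prob (f (S.words K w i)) (y i)) /
      ((M.common : ℝ) * M.priv₁ * M.priv₂))

open Classical in
/-- The probability, over uniform messages and the random codebook, that the chosen codewords are
not `ε`-typical for `p`, i.e. that some letter frequency differs from `p` by more than `ε`. -/
def atypicalProb [Fintype U₀] [Fintype U₁] [Fintype U₂]
    (S : BinningRules U₀ U₁ U₂ Y₁ Y₂ n M B) (c : CodebookLaw U₀ U₁ U₂)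
    (p : U₀ × U₁ × U₂ → ℝ) (ε : ℝ) : ℝ :=
  ∑ K : Codebook U₀ U₁ U₂ n M B, c.bookProb K *
    ((∑ w : Fin M.common × Fin M.priv₁ × Fin M.priv₂,
      if ∀ u, |((Finset.univ.filter fun i => S.words K w i = u).card : ℝ) / n - p u| ≤ ε
      then (0 : ℝ) else 1) / ((M.common : ℝ) * M.priv₁ * M.priv₂))

end BinningRules

/-- The scheme with codebook law `c`, encoding law `p` and input map `f` works at message rates
`R` and binning rates `r`: for each `ε > 0` and all large `n`, with at least `2^{n(Rᵢ - ε)}`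
messages and at most `2^{n(rᵢ + ε)}` bin indices, bins can be chosen so that over the random
codebook the chosen codewords are `ε`-typical for `p` and both receivers decode correctly, except
with probability at most `ε`. -/
def SchemeAchieves {X Y₁ Y₂ U₀ U₁ U₂ : Type*} [Fintype Y₁] [Fintype Y₂]
    [Fintype U₀] [Fintype U₁] [Fintype U₂] (W : BroadcastChannel X Y₁ Y₂)
    (c : CodebookLaw U₀ U₁ U₂) (p : U₀ × U₁ × U₂ → ℝ) (f : U₀ × U₁ × U₂ → X)
    (R r : RateTriple) : Prop :=
  ∀ ε : ℝ, 0 < ε → ∃ n₀ : ℕ, ∀ n : ℕ, n₀ ≤ n →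
    ∃ (M B : SizeTriple) (S : BinningRules U₀ U₁ U₂ Y₁ Y₂ n M B),
      (2 : ℝ) ^ ((n : ℝ) * (R.common - ε)) ≤ M.common ∧
      (2 : ℝ) ^ ((n : ℝ) * (R.priv₁ - ε)) ≤ M.priv₁ ∧
      (2 : ℝ) ^ ((n : ℝ) * (R.priv₂ - ε)) ≤ M.priv₂ ∧
      (B.common : ℝ) ≤ (2 : ℝ) ^ ((n : ℝ) * (r.common + ε)) ∧
      (B.priv₁ : ℝ) ≤ (2 : ℝ) ^ ((n : ℝ) * (r.priv₁ + ε)) ∧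
      (B.priv₂ : ℝ) ≤ (2 : ℝ) ^ ((n : ℝ) * (r.priv₂ + ε)) ∧
      S.atypicalProb c p ε ≤ ε ∧ S.meanError W c f ≤ ε

section Regions

variable {X Y₁ Y₂ U₀ U₁ U₂ : Type*} [Fintype X] [Fintype Y₁] [Fintype Y₂]
  [Fintype U₀] [Fintype U₁] [Fintype U₂]

/-- The binning (lower) and decoding (upper) bounds on the message rates `R` and the binning
rates `r`; the total rates are `L = R + r`. -/
structure SchemeBounds (W : BroadcastChannel X Y₁ Y₂) (c : CodebookLaw U₀ U₁ U₂)
    (q : (U₀ × U₁ × U₂) × X → ℝ) (R r : RateTriple) : Prop where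
  rates_nonneg : R.Nonneg
  binning_nonneg : r.Nonneg
  bin_all : divAll c q ≤ ((r.common + r.priv₁ + r.priv₂ : ℝ) : EReal)
  bin_pair₁ : divPair₁ c q ≤ ((r.common + r.priv₁ : ℝ) : EReal)
  bin_pair₂ : divPair₂ c q ≤ ((r.common + r.priv₂ : ℝ) : EReal)
  bin_common : divCommon c q ≤ (r.common : EReal)
  dec_full₁ : (((R.common + r.common) + (R.priv₁ + r.priv₁) : ℝ) : EReal) ≤
    (infoFull₁ W q : EReal) + divPair₁ c q
  dec_priv₁ : ((R.priv₁ + r.priv₁ : ℝ) : EReal) ≤ (infoPriv₁ W q : EReal) + divPriv₁ c q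
  dec_full₂ : (((R.common + r.common) + (R.priv₂ + r.priv₂) : ℝ) : EReal) ≤
    (infoFull₂ W q : EReal) + divPair₂ c q
  dec_priv₂ : ((R.priv₂ + r.priv₂ : ℝ) : EReal) ≤ (infoPriv₂ W q : EReal) + divPriv₂ c q

/-- The bounds on the message rates that remain when the binning rates are eliminated. -/
structure EliminatedBounds (W : BroadcastChannel X Y₁ Y₂) (c : CodebookLaw U₀ U₁ U₂)
    (q : (U₀ × U₁ × U₂) × X → ℝ) (R : RateTriple) : Prop where
  rates_nonneg : R.Nonneg
  priv₁ : (R.priv₁ : EReal) ≤ (infoPriv₁ W q : EReal) + divPriv₁ c q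
  priv₂ : (R.priv₂ : EReal) ≤ (infoPriv₂ W q : EReal) + divPriv₂ c q
  full₁ : R.common + R.priv₁ ≤ infoFull₁ W q
  full₂ : R.common + R.priv₂ ≤ infoFull₂ W q
  sum₁ : R.common + R.priv₁ + R.priv₂ ≤ infoFull₁ W q + infoPriv₂ W q - infoCross q
  sum₂ : R.common + R.priv₁ + R.priv₂ ≤ infoFull₂ W q + infoPriv₁ W q - infoCross q
  sum_double : 2 * R.common + R.priv₁ + R.priv₂ ≤ infoFull₁ W q + infoFull₂ W q - infoCross q

/-- The rate pairs obtained, for fixed distributions, from the scheme with rate splitting: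
a fraction `α` of the common rate carries the message of receiver 1, the rest that of
receiver 2. -/
def schemePairs (W : BroadcastChannel X Y₁ Y₂) (c : CodebookLaw U₀ U₁ U₂)
    (q : (U₀ × U₁ × U₂) × X → ℝ) : Set (ℝ × ℝ) :=
  {R' | ∃ (R r : RateTriple) (α : ℝ), α ∈ Set.Icc (0 : ℝ) 1 ∧ SchemeBounds W c q R r ∧
    R'.1 = R.priv₁ + α * R.common ∧ R'.2 = R.priv₂ + (1 - α) * R.common}

/-- The rate pairs in Marton's bounds for a fixed law `q` of `((U₀, U₁, U₂), X)`. -/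
def martonPairs (W : BroadcastChannel X Y₁ Y₂) (q : (U₀ × U₁ × U₂) × X → ℝ) : Set (ℝ × ℝ) :=
  {R' | 0 ≤ R'.1 ∧ 0 ≤ R'.2 ∧ R'.1 ≤ infoFull₁ W q ∧ R'.2 ≤ infoFull₂ W q ∧
    R'.1 + R'.2 ≤ min (infoCommon₁ W q) (infoCommon₂ W q)
      + infoPriv₁ W q + infoPriv₂ W q - infoCross q}

/-- The region of the scheme: the union over all finite auxiliary alphabets, all codebook
distributions, all encoding distributions and all deterministic input maps. -/
def schemeRegion (W : BroadcastChannel X Y₁ Y₂) : Set (ℝ × ℝ) :=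
  {R' | ∃ (k₀ k₁ k₂ : ℕ) (c : CodebookLaw (Fin k₀) (Fin k₁) (Fin k₂))
    (p : Fin k₀ × Fin k₁ × Fin k₂ → ℝ) (f : Fin k₀ × Fin k₁ × Fin k₂ → X),
    p ∈ stdSimplex ℝ (Fin k₀ × Fin k₁ × Fin k₂) ∧ R' ∈ schemePairs W c (functionalInput p f)}

/-- Marton's region: the union over all finite auxiliary alphabets and all joint laws of
`((U₀, U₁, U₂), X)`. -/
def martonRegion (W : BroadcastChannel X Y₁ Y₂) : Set (ℝ × ℝ) :=
  {R' | ∃ (k₀ k₁ k₂ : ℕ) (q : (Fin k₀ × Fin k₁ × Fin k₂) × X → ℝ),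
    q ∈ stdSimplex ℝ ((Fin k₀ × Fin k₁ × Fin k₂) × X) ∧ R' ∈ martonPairs W q}

end Regions

end

/-!
The coding scheme rests on two facts about the exponents of jointly typical triples of codewords.

*Binning at the boundary.* By the chain rule, `D(P^e ‖ P^c)` for the triple is the sum of its three
factor divergences and of `I(U₁; U₂ | U₀)` (`divAll_eq`). Hence the binning bounds form a
contrapolymatroid, and binning rates that satisfy them can be lowered until their *sum* equals
`D(P^e ‖ P^c)` (`exists_tight_binning`); the decoding bounds only become slacker. The expected
number of bin triples whose codewords look jointly typical then has vanishing exponent. This permits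
a crude packing argument: the event that some wrong codeword pair looks like the output is bounded
by summing over *all* bin triples that the encoder might have chosen, so that the dependence
between the choice of the encoder and the rest of the codebook never has to be analysed.

*Covering.* That some bin triple is good follows from the second moment method
(`CoveringBounds.prob_no_hit_le`). Two triples of codewords are correlated only through what they
share, namely the common codeword, the common and one private codeword, or everything, and the four
binning bounds control exactly these correlations.

Both arguments are carried out for arbitrary codeword sets and an arbitrary channel (`exists_scheme`).
For `n` uses of a memoryless channel their inputs are changes of measure on robustly typical
sequences: the conditional law of `A` given `B` and a codebook kernel differ by the exponent
`H(B) - H(A, B) - E log V(A | B)`, which is evaluated for each of the sets in question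
(`exists_prod_condLaw_le`, `exists_exponents`). The target set of the encoder consists of the
triples that, sent over the channel, are typical together with the output except with small
probability; the law of large numbers makes it likely under `P^e` (`exists_binningRules`). Margins
in the rates then beat the losses (`exists_binningRules_of_schemeBounds`). For
the capacity region, a codebook no worse than the average is fixed, and the common index is split
into a part for each receiver (`BinningRules.exists_code_errorProb_le`).

The single-letter statements reduce to linear inequalities: all information quantities are
combinations of entropies, and under absolute continuity the divergences are real numbers
(`schemeBounds_iff_real`). The elimination of the binning rates exhibits explicit rates
(`exists_excess_rates`), and the resulting pairs of rates do not depend on the codebook law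
(`schemePairs_eq_martonPairs`), by `I(Y; U₀ Uᵢ) = I(Y; U₀) + I(Y; Uᵢ | U₀)`. For Marton's region
with a random channel input, the input is written as `V(U₀, U₁, U₂)` with a random function `V`
independent of the auxiliary variables; joining `V` to `U₁` makes the input a function of the
auxiliary variables, leaves `I(U₁; U₂ | U₀)` unchanged and can only increase the informations at
receiver 1 (`exists_martonPairs_functionalInput`).
-/

noncomputable section

/-! ### Laws, entropies and Gibbs' inequality -/

section Entropy

variable {Ω α β γ : Type*} [Fintype Ω]

lemma pmfLaw_nonneg {P : Ω → ℝ} (hP : ∀ ω, 0 ≤ P ω) (A : Ω → α) (a : α) : 0 ≤ pmfLaw P A a := by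
  unfold pmfLaw
  exact Finset.sum_nonneg fun ω _ => by split_ifs <;> simp [hP]

lemma sum_pmfLaw_mul [Fintype α] (P : Ω → ℝ) (A : Ω → α) (g : α → ℝ) :
    ∑ a, pmfLaw P A a * g a = ∑ ω, P ω * g (A ω) := by
  classical
  simp only [pmfLaw, Finset.sum_mul]
  rw [Finset.sum_comm]
  refine Finset.sum_congr rfl fun ω _ => ?_
  simp [ite_mul]

lemma sum_pmfLaw [Fintype α] (P : Ω → ℝ) (A : Ω → α) : ∑ a, pmfLaw P A a = ∑ ω, P ω := by
  simpa using sum_pmfLaw_mul P A (fun _ => 1)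

lemma pmfLaw_mem_stdSimplex [Fintype α] {P : Ω → ℝ} (hP : P ∈ stdSimplex ℝ Ω) (A : Ω → α) :
    pmfLaw P A ∈ stdSimplex ℝ α :=
  ⟨pmfLaw_nonneg hP.1 A, by rw [sum_pmfLaw, hP.2]⟩

/-- The law of a function of `A` is the image of the law of `A`. -/
lemma pmfLaw_comp [Fintype α] (P : Ω → ℝ) (A : Ω → α) (g : α → β) :
    pmfLaw (pmfLaw P A) g = pmfLaw P (fun ω => g (A ω)) := by
  classical
  funext b
  have h := sum_pmfLaw_mul P A (fun a => if g a = b then (1 : ℝ) else 0)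
  simp only [mul_ite, mul_one, mul_zero] at h
  unfold pmfLaw at h ⊢
  convert h

lemma pmfLaw_pos {P : Ω → ℝ} (hP : ∀ ω, 0 ≤ P ω) (A : Ω → α) {ω : Ω} (h : P ω ≠ 0) :
    0 < pmfLaw P A (A ω) := by
  unfold pmfLaw
  refine Finset.sum_pos' (fun ω _ => by split_ifs <;> simp [hP]) ⟨ω, Finset.mem_univ _, ?_⟩
  simpa using lt_of_le_of_ne (hP ω) (Ne.symm h)

lemma exists_of_pmfLaw_ne_zero {P : Ω → ℝ} {A : Ω → α} {a : α} (h : pmfLaw P A a ≠ 0) :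
    ∃ ω, A ω = a ∧ P ω ≠ 0 := by
  unfold pmfLaw at h
  obtain ⟨ω, -, hω⟩ := Finset.exists_ne_zero_of_sum_ne_zero h
  by_cases hA : A ω = a
  · exact ⟨ω, hA, by simpa [hA] using hω⟩
  · simp [hA] at hω

/-- The probability of the fibre of `A` through `ω` depends only on the partition that `A`
induces. -/
lemma pmfLaw_congr {P : Ω → ℝ} {A : Ω → α} {B : Ω → β}
    (h : ∀ ω ω', A ω = A ω' ↔ B ω = B ω') (ω : Ω) : pmfLaw P A (A ω) = pmfLaw P B (B ω) := by
  unfold pmfLaw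
  exact Finset.sum_congr rfl fun ω' _ => by
    by_cases hB : B ω' = B ω
    · simp [hB, (h ω' ω).2 hB]
    · simp [hB, mt (h ω' ω).1 hB]

lemma pmfLaw_sum_fst [Fintype α] (P : Ω → ℝ) (A : Ω → α) (B : Ω → β) (b : β) :
    ∑ a, pmfLaw P (fun ω => (A ω, B ω)) (a, b) = pmfLaw P B b := by
  classical
  unfold pmfLaw
  rw [Finset.sum_comm]
  refine Finset.sum_congr rfl fun ω _ => ?_
  by_cases h : B ω = b <;> simp [h]

lemma pmfLaw_sum_snd [Fintype β] (P : Ω → ℝ) (A : Ω → α) (B : Ω → β) (a : α) :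
    ∑ b, pmfLaw P (fun ω => (A ω, B ω)) (a, b) = pmfLaw P A a := by
  classical
  unfold pmfLaw
  rw [Finset.sum_comm]
  refine Finset.sum_congr rfl fun ω _ => ?_
  by_cases h : A ω = a <;> simp [h]

/-- The Shannon entropy, in bits, of the random variable `A` on `(Ω, P)`, written as the mean of
`-log₂` of the probability of the fibre. It depends on `A` only through the partition that `A`
induces, so that regrouping a tuple of random variables does not change it. -/
def entropy (P : Ω → ℝ) (A : Ω → α) : ℝ := -∑ ω, P ω * Real.logb 2 (pmfLaw P A (A ω))

lemma entropy_congr {P : Ω → ℝ} {A : Ω → α} {B : Ω → β}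
    (h : ∀ ω ω', A ω = A ω' ↔ B ω = B ω') : entropy P A = entropy P B := by
  unfold entropy
  simp only [pmfLaw_congr h]

lemma entropy_pmfLaw [Fintype α] (P : Ω → ℝ) (A : Ω → α) (g : α → β) :
    entropy (pmfLaw P A) g = entropy P (fun ω => g (A ω)) := by
  unfold entropy
  rw [sum_pmfLaw_mul P A (fun a => Real.logb 2 (pmfLaw (pmfLaw P A) g (g a))), pmfLaw_comp]

lemma entropy_const {P : Ω → ℝ} (hP : ∑ ω, P ω = 1) (a : α) : entropy P (fun _ => a) = 0 := by
  unfold entropy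
  have : pmfLaw P (fun _ : Ω => a) a = 1 := by simp [pmfLaw, hP]
  simp [this]

lemma mutualInfo_eq_entropy [Fintype α] [Fintype β] {P : Ω → ℝ} (hP : ∀ ω, 0 ≤ P ω)
    (A : Ω → α) (B : Ω → β) :
    mutualInfo P A B = entropy P A + entropy P B - entropy P (fun ω => (A ω, B ω)) := by
  have h := sum_pmfLaw_mul P (fun ω => (A ω, B ω)) (fun z => Real.logb 2
    (pmfLaw P (fun ω => (A ω, B ω)) z / (pmfLaw P A z.1 * pmfLaw P B z.2)))
  rw [Fintype.sum_prod_type] at h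
  unfold mutualInfo entropy
  rw [h, sub_neg_eq_add, ← neg_add, ← Finset.sum_add_distrib, neg_add_eq_sub,
    ← Finset.sum_sub_distrib]
  refine Finset.sum_congr rfl fun ω _ => ?_
  by_cases hω : P ω = 0
  · simp [hω]
  · have h1 := pmfLaw_pos hP A hω
    have h2 := pmfLaw_pos hP B hω
    have h3 := pmfLaw_pos hP (fun ω => (A ω, B ω)) hω
    simp only at h3 ⊢
    rw [Real.logb_div h3.ne' (mul_pos h1 h2).ne', Real.logb_mul h1.ne' h2.ne']
    ring

lemma condMutualInfo_eq_entropy [Fintype α] [Fintype β] [Fintype γ] {P : Ω → ℝ}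
    (hP : ∀ ω, 0 ≤ P ω) (A : Ω → α) (B : Ω → β) (C : Ω → γ) :
    condMutualInfo P A B C = entropy P (fun ω => (A ω, C ω)) + entropy P (fun ω => (B ω, C ω))
      - entropy P (fun ω => (A ω, B ω, C ω)) - entropy P C := by
  have h := sum_pmfLaw_mul P (fun ω => (A ω, B ω, C ω)) (fun z => Real.logb 2
    (pmfLaw P (fun ω => (A ω, B ω, C ω)) z * pmfLaw P C z.2.2 /
      (pmfLaw P (fun ω => (A ω, C ω)) (z.1, z.2.2) * pmfLaw P (fun ω => (B ω, C ω)) z.2)))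
  simp only [Fintype.sum_prod_type] at h
  unfold condMutualInfo entropy
  rw [h, sub_neg_eq_add, sub_neg_eq_add, ← neg_add, ← Finset.sum_add_distrib, neg_add_eq_sub,
    ← Finset.sum_sub_distrib, ← Finset.sum_add_distrib]
  refine Finset.sum_congr rfl fun ω _ => ?_
  by_cases hω : P ω = 0
  · simp [hω]
  · have h1 := pmfLaw_pos hP (fun ω => (A ω, C ω)) hω
    have h2 := pmfLaw_pos hP (fun ω => (B ω, C ω)) hω
    have h3 := pmfLaw_pos hP (fun ω => (A ω, B ω, C ω)) hω
    have h4 := pmfLaw_pos hP C hω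
    simp only at h1 h2 h3 ⊢
    rw [Real.logb_div (mul_pos h3 h4).ne' (mul_pos h1 h2).ne', Real.logb_mul h1.ne' h2.ne',
      Real.logb_mul h3.ne' h4.ne']
    ring

/-- Gibbs' inequality: the divergence from a measure of no larger total mass is nonnegative. -/
lemma sum_mul_logb_div_nonneg [Fintype α] {p q : α → ℝ} (hp : ∀ a, 0 ≤ p a) (hq : ∀ a, 0 ≤ q a)
    (hac : ∀ a, q a = 0 → p a = 0) (hs : ∑ a, q a ≤ ∑ a, p a) :
    0 ≤ ∑ a, p a * Real.logb 2 (p a / q a) := by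
  have key : ∀ a, (p a - q a) / Real.log 2 ≤ p a * Real.logb 2 (p a / q a) := by
    intro a
    have hl : 0 < Real.log 2 := Real.log_pos one_lt_two
    rcases (hp a).eq_or_lt with h | h
    · rw [← h]
      have := div_nonneg (hq a) hl.le
      rw [zero_sub, neg_div]; simp only [zero_mul]; linarith
    · have hqa : 0 < q a := lt_of_le_of_ne (hq a) fun h0 => h.ne' (hac a h0.symm)
      rw [Real.logb, mul_div_assoc', div_le_div_iff_of_pos_right hl]
      have := Real.one_sub_inv_le_log_of_pos (div_pos h hqa)
      calc p a - q a = p a * (1 - (p a / q a)⁻¹) := by field_simp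
        _ ≤ _ := mul_le_mul_of_nonneg_left this h.le
  calc 0 ≤ ∑ a, (p a - q a) / Real.log 2 := by
        rw [← Finset.sum_div, Finset.sum_sub_distrib]
        exact div_nonneg (by linarith) (Real.log_pos one_lt_two).le
    _ ≤ _ := Finset.sum_le_sum fun a _ => key a

lemma pmfLaw_eq_zero_of_comp {P : Ω → ℝ} (hP : ∀ ω, 0 ≤ P ω) {A : Ω → α} {B : Ω → β}
    (g : α → β) (hg : ∀ ω, B ω = g (A ω)) {a : α} (h : pmfLaw P B (g a) = 0) :
    pmfLaw P A a = 0 := by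
  by_contra h0
  obtain ⟨ω, rfl, hω⟩ := exists_of_pmfLaw_ne_zero h0
  have := pmfLaw_pos hP B hω
  rw [hg] at this
  exact this.ne' h

lemma condMutualInfo_nonneg [Fintype α] [Fintype β] [Fintype γ] {P : Ω → ℝ}
    (hP : ∀ ω, 0 ≤ P ω) (A : Ω → α) (B : Ω → β) (C : Ω → γ) : 0 ≤ condMutualInfo P A B C := by
  have h := sum_mul_logb_div_nonneg (p := pmfLaw P (fun ω => (A ω, B ω, C ω)))
    (q := fun z => pmfLaw P (fun ω => (A ω, C ω)) (z.1, z.2.2) *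
      pmfLaw P (fun ω => (B ω, C ω)) z.2 / pmfLaw P C z.2.2) (pmfLaw_nonneg hP _)
    (fun z => div_nonneg (mul_nonneg (pmfLaw_nonneg hP _ _) (pmfLaw_nonneg hP _ _))
      (pmfLaw_nonneg hP _ _)) ?_ ?_
  · simp only [div_div_eq_mul_div, Fintype.sum_prod_type] at h
    exact h
  · intro z hz
    simp only [div_eq_zero_iff, mul_eq_zero] at hz
    rcases hz with (h | h) | h
    · exact pmfLaw_eq_zero_of_comp hP (fun z => (z.1, z.2.2)) (fun _ => rfl) h
    · exact pmfLaw_eq_zero_of_comp hP (fun z => z.2) (fun _ => rfl) h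
    · exact pmfLaw_eq_zero_of_comp hP (fun z => z.2.2) (fun _ => rfl) h
  · rw [sum_pmfLaw, ← sum_pmfLaw P C]
    refine le_of_eq ?_
    simp only [Fintype.sum_prod_type]
    rw [Finset.sum_comm_cycle]
    refine Finset.sum_congr rfl fun c _ => ?_
    rw [Finset.sum_comm]
    simp only [← Finset.sum_div, ← Finset.mul_sum, ← Finset.sum_mul, pmfLaw_sum_fst]
    by_cases hc : pmfLaw P C c = 0
    · simp [hc]
    · field_simp

lemma mutualInfo_nonneg [Fintype α] [Fintype β] {P : Ω → ℝ} (hP : P ∈ stdSimplex ℝ Ω)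
    (A : Ω → α) (B : Ω → β) : 0 ≤ mutualInfo P A B := by
  have h := condMutualInfo_nonneg hP.1 A B (fun _ => ())
  rw [condMutualInfo_eq_entropy hP.1, entropy_const hP.2] at h
  rw [mutualInfo_eq_entropy hP.1]
  have h1 : entropy P (fun ω => (A ω, ())) = entropy P A := entropy_congr (by simp)
  have h2 : entropy P (fun ω => (B ω, ())) = entropy P B := entropy_congr (by simp)
  have h3 : entropy P (fun ω => (A ω, B ω, ())) = entropy P (fun ω => (A ω, B ω)) :=
    entropy_congr (by simp)
  rw [h1, h2, h3] at h
  linarith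

/-- The mean `∑ ω, P ω * log₂ (g ω)`, which enters divergences. -/
def meanLog (P : Ω → ℝ) (g : Ω → ℝ) : ℝ := ∑ ω, P ω * Real.logb 2 (g ω)

lemma meanLog_pmfLaw [Fintype α] (P : Ω → ℝ) (A : Ω → α) (g : α → ℝ) :
    meanLog (pmfLaw P A) g = meanLog P (fun ω => g (A ω)) :=
  sum_pmfLaw_mul P A _

lemma meanLog_mul {P : Ω → ℝ} {g h : Ω → ℝ} (hg : ∀ ω, P ω ≠ 0 → g ω ≠ 0)
    (hh : ∀ ω, P ω ≠ 0 → h ω ≠ 0) :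
    meanLog P (fun ω => g ω * h ω) = meanLog P g + meanLog P h := by
  unfold meanLog
  rw [← Finset.sum_add_distrib]
  refine Finset.sum_congr rfl fun ω _ => ?_
  by_cases hω : P ω = 0
  · simp [hω]
  · rw [Real.logb_mul (hg ω hω) (hh ω hω)]; ring

lemma relEntropy_pmfLaw [Fintype α] {P : Ω → ℝ} (hP : ∀ ω, 0 ≤ P ω) (A : Ω → α) {q : α → ℝ}
    (hq : ∀ ω, P ω ≠ 0 → q (A ω) ≠ 0) :
    relEntropy (pmfLaw P A) q =
      ((-entropy P A - meanLog P (fun ω => q (A ω)) : ℝ) : EReal) := by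
  have hac : ∀ a, q a = 0 → pmfLaw P A a = 0 := by
    intro a ha
    by_contra h
    obtain ⟨ω, rfl, hω⟩ := exists_of_pmfLaw_ne_zero h
    exact hq ω hω ha
  unfold relEntropy
  rw [if_pos hac, EReal.coe_eq_coe_iff, sum_pmfLaw_mul P A
    (fun a => Real.logb 2 (pmfLaw P A a / q a))]
  unfold entropy meanLog
  rw [neg_neg, ← Finset.sum_sub_distrib]
  refine Finset.sum_congr rfl fun ω _ => ?_
  by_cases hω : P ω = 0
  · simp [hω]
  · rw [Real.logb_div (pmfLaw_pos hP A hω).ne' (hq ω hω)]; ring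

lemma EReal.coe_sum_univ [Fintype α] (f : α → ℝ) : ((∑ a, f a : ℝ) : EReal) = ∑ a, (f a : EReal) :=
  map_sum (⟨⟨fun x : ℝ => (x : EReal), EReal.coe_zero⟩, EReal.coe_add⟩ : ℝ →+ EReal) f _

lemma condRelEntropy_condLaw [Fintype α] [Fintype β] {P : Ω → ℝ} (hP : ∀ ω, 0 ≤ P ω)
    (A : Ω → α) (B : Ω → β) {V : α → β → ℝ} (hV : ∀ ω, P ω ≠ 0 → V (A ω) (B ω) ≠ 0) :
    condRelEntropy (pmfLaw P A) (condLaw P B A) V =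
      ((entropy P A - entropy P (fun ω => (A ω, B ω)) -
        meanLog P (fun ω => V (A ω) (B ω)) : ℝ) : EReal) := by
  have hterm : ∀ a, ((pmfLaw P A a : ℝ) : EReal) * relEntropy (condLaw P B A a) (V a) =
      ((∑ b, pmfLaw P (fun ω => (A ω, B ω)) (a, b) *
        Real.logb 2 (pmfLaw P (fun ω => (A ω, B ω)) (a, b) / pmfLaw P A a / V a b) : ℝ) :
          EReal) := by
    intro a
    by_cases ha : pmfLaw P A a = 0
    · have : ∀ b, pmfLaw P (fun ω => (A ω, B ω)) (a, b) = 0 := fun b =>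
        pmfLaw_eq_zero_of_comp hP Prod.fst (fun _ => rfl) ha
      simp [ha, this]
    · have hac : ∀ b, V a b = 0 → condLaw P B A a b = 0 := by
        intro b hb
        by_contra h
        have h' : pmfLaw P (fun ω => (A ω, B ω)) (a, b) ≠ 0 := fun h0 => h (by simp [condLaw, h0])
        obtain ⟨ω, hab, hω⟩ := exists_of_pmfLaw_ne_zero h'
        obtain ⟨rfl, rfl⟩ := Prod.ext_iff.1 hab
        exact hV ω hω hb
      unfold relEntropy
      rw [if_pos hac, ← EReal.coe_mul, EReal.coe_eq_coe_iff, Finset.mul_sum]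
      refine Finset.sum_congr rfl fun b _ => ?_
      unfold condLaw
      field_simp
  unfold condRelEntropy
  simp only [hterm]
  rw [← EReal.coe_sum_univ, EReal.coe_eq_coe_iff]
  have h := sum_pmfLaw_mul P (fun ω => (A ω, B ω)) (fun z => Real.logb 2
    (pmfLaw P (fun ω => (A ω, B ω)) z / pmfLaw P A z.1 / V z.1 z.2))
  rw [Fintype.sum_prod_type] at h
  rw [h]
  unfold entropy meanLog
  rw [sub_neg_eq_add, neg_add_eq_sub, ← Finset.sum_sub_distrib, ← Finset.sum_sub_distrib]
  refine Finset.sum_congr rfl fun ω _ => ?_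
  by_cases hω : P ω = 0
  · simp [hω]
  · have h1 := pmfLaw_pos hP A hω
    have h3 := pmfLaw_pos hP (fun ω => (A ω, B ω)) hω
    simp only at h3 ⊢
    rw [Real.logb_div (div_pos h3 h1).ne' (hV ω hω), Real.logb_div h3.ne' h1.ne']
    ring

end Entropy

/-! ### Divergences from a conditional law -/

lemma entropy_sub_meanLog_nonneg {Ω α β : Type*} [Fintype Ω] [Fintype α] [Fintype β] {P : Ω → ℝ}
    (hP : ∀ ω, 0 ≤ P ω) (A : Ω → α) (B : Ω → β) {V : α → β → ℝ} (hV0 : ∀ a b, 0 ≤ V a b)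
    (hV1 : ∀ a, ∑ b, V a b ≤ 1) (hV : ∀ ω, P ω ≠ 0 → V (A ω) (B ω) ≠ 0) :
    0 ≤ entropy P A - entropy P (fun ω => (A ω, B ω)) - meanLog P (fun ω => V (A ω) (B ω)) := by
  have h := sum_mul_logb_div_nonneg (p := pmfLaw P (fun ω => (A ω, B ω)))
    (q := fun z => pmfLaw P A z.1 * V z.1 z.2) (pmfLaw_nonneg hP _)
    (fun z => mul_nonneg (pmfLaw_nonneg hP _ _) (hV0 _ _)) ?_ ?_
  · rw [sum_pmfLaw_mul P (fun ω => (A ω, B ω)) (fun z => Real.logb 2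
      (pmfLaw P (fun ω => (A ω, B ω)) z / (pmfLaw P A z.1 * V z.1 z.2)))] at h
    refine h.trans_eq ?_
    unfold entropy meanLog
    rw [sub_neg_eq_add, neg_add_eq_sub, ← Finset.sum_sub_distrib, ← Finset.sum_sub_distrib]
    refine Finset.sum_congr rfl fun ω _ => ?_
    by_cases hω : P ω = 0
    · simp [hω]
    · have h1 := pmfLaw_pos hP A hω
      have h3 := pmfLaw_pos hP (fun ω => (A ω, B ω)) hω
      simp only at h3 ⊢
      rw [Real.logb_div h3.ne' (mul_ne_zero h1.ne' (hV ω hω)),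
        Real.logb_mul h1.ne' (hV ω hω)]
      ring
  · intro z hz
    by_contra hne
    obtain ⟨ω, rfl, hω⟩ := exists_of_pmfLaw_ne_zero hne
    exact mul_ne_zero (pmfLaw_pos hP A hω).ne' (hV ω hω) hz
  · rw [Fintype.sum_prod_type, sum_pmfLaw, ← sum_pmfLaw P A]
    refine Finset.sum_le_sum fun a _ => ?_
    simp only [← Finset.mul_sum]
    exact mul_le_of_le_one_right (pmfLaw_nonneg hP _ _) (hV1 a)

section Quantities

variable {X Y₁ Y₂ U₀ U₁ U₂ : Type*} [Fintype X] [Fintype Y₁] [Fintype Y₂]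
  [Fintype U₀] [Fintype U₁] [Fintype U₂]

/-! ### Information quantities of the channel as combinations of entropies -/

lemma transmitLaw_mem {U : Type*} [Fintype U] (W : BroadcastChannel X Y₁ Y₂) {q : U × X → ℝ}
    (hq : q ∈ stdSimplex ℝ (U × X)) :
    transmitLaw W q ∈ stdSimplex ℝ ((U × X) × (Y₁ × Y₂)) := by
  refine ⟨fun ω => mul_nonneg (hq.1 _) ((W.prob_mem _).1 _), ?_⟩
  rw [Fintype.sum_prod_type]
  simp only [transmitLaw, ← Finset.mul_sum, (W.prob_mem _).2, mul_one, hq.2]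

lemma pmfLaw_transmitLaw_fst {U : Type*} [Fintype U] (W : BroadcastChannel X Y₁ Y₂)
    (q : U × X → ℝ) : pmfLaw (transmitLaw W q) (fun ω => ω.1) = q := by
  classical
  funext z
  unfold pmfLaw
  rw [Fintype.sum_prod_type, Finset.sum_eq_single z]
  · simp only [transmitLaw, if_true, ← Finset.mul_sum, (W.prob_mem _).2, mul_one]
  · intro b _ hb; simp [hb]
  · simp

lemma entropy_transmitLaw_fst {U γ : Type*} [Fintype U] (W : BroadcastChannel X Y₁ Y₂)
    (q : U × X → ℝ) (g : U × X → γ) :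
    entropy (transmitLaw W q) (fun ω => g ω.1) = entropy q g := by
  rw [← entropy_pmfLaw (transmitLaw W q) (fun ω => ω.1) g, pmfLaw_transmitLaw_fst]

variable (W : BroadcastChannel X Y₁ Y₂) {c : CodebookLaw U₀ U₁ U₂}
  {q : (U₀ × U₁ × U₂) × X → ℝ}

lemma infoFull₁_eq_entropy (hq : q ∈ stdSimplex ℝ ((U₀ × U₁ × U₂) × X)) :
    infoFull₁ W q = entropy (transmitLaw W q) (fun ω => ω.2.1) +
      entropy q (fun z => (z.1.1, z.1.2.1)) -
      entropy (transmitLaw W q) (fun ω => (ω.2.1, (ω.1.1.1, ω.1.1.2.1))) := by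
  rw [infoFull₁, mutualInfo_eq_entropy (transmitLaw_mem W hq).1,
    entropy_transmitLaw_fst W q (fun z => (z.1.1, z.1.2.1))]

lemma infoFull₂_eq_entropy (hq : q ∈ stdSimplex ℝ ((U₀ × U₁ × U₂) × X)) :
    infoFull₂ W q = entropy (transmitLaw W q) (fun ω => ω.2.2) +
      entropy q (fun z => (z.1.1, z.1.2.2)) -
      entropy (transmitLaw W q) (fun ω => (ω.2.2, (ω.1.1.1, ω.1.1.2.2))) := by
  rw [infoFull₂, mutualInfo_eq_entropy (transmitLaw_mem W hq).1,
    entropy_transmitLaw_fst W q (fun z => (z.1.1, z.1.2.2))]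

lemma infoPriv₁_eq_entropy (hq : q ∈ stdSimplex ℝ ((U₀ × U₁ × U₂) × X)) :
    infoPriv₁ W q = entropy (transmitLaw W q) (fun ω => (ω.2.1, ω.1.1.1)) +
      entropy q (fun z => (z.1.1, z.1.2.1)) -
      entropy (transmitLaw W q) (fun ω => (ω.2.1, (ω.1.1.1, ω.1.1.2.1))) -
      entropy q (fun z => z.1.1) := by
  rw [infoPriv₁, condMutualInfo_eq_entropy (transmitLaw_mem W hq).1,
    entropy_transmitLaw_fst W q (fun z => z.1.1),
    ← entropy_transmitLaw_fst W q (fun z => (z.1.1, z.1.2.1)),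
    entropy_congr (A := fun ω : ((U₀ × U₁ × U₂) × X) × (Y₁ × Y₂) => (ω.1.1.2.1, ω.1.1.1))
      (B := fun ω => (ω.1.1.1, ω.1.1.2.1)) (by simp; tauto),
    entropy_congr
      (A := fun ω : ((U₀ × U₁ × U₂) × X) × (Y₁ × Y₂) => (ω.2.1, ω.1.1.2.1, ω.1.1.1))
      (B := fun ω => (ω.2.1, (ω.1.1.1, ω.1.1.2.1))) (by simp; tauto)]

lemma infoPriv₂_eq_entropy (hq : q ∈ stdSimplex ℝ ((U₀ × U₁ × U₂) × X)) :
    infoPriv₂ W q = entropy (transmitLaw W q) (fun ω => (ω.2.2, ω.1.1.1)) +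
      entropy q (fun z => (z.1.1, z.1.2.2)) -
      entropy (transmitLaw W q) (fun ω => (ω.2.2, (ω.1.1.1, ω.1.1.2.2))) -
      entropy q (fun z => z.1.1) := by
  rw [infoPriv₂, condMutualInfo_eq_entropy (transmitLaw_mem W hq).1,
    entropy_transmitLaw_fst W q (fun z => z.1.1),
    ← entropy_transmitLaw_fst W q (fun z => (z.1.1, z.1.2.2)),
    entropy_congr (A := fun ω : ((U₀ × U₁ × U₂) × X) × (Y₁ × Y₂) => (ω.1.1.2.2, ω.1.1.1))
      (B := fun ω => (ω.1.1.1, ω.1.1.2.2)) (by simp; tauto),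
    entropy_congr
      (A := fun ω : ((U₀ × U₁ × U₂) × X) × (Y₁ × Y₂) => (ω.2.2, ω.1.1.2.2, ω.1.1.1))
      (B := fun ω => (ω.2.2, (ω.1.1.1, ω.1.1.2.2))) (by simp; tauto)]

lemma infoCommon₁_eq_entropy (hq : q ∈ stdSimplex ℝ ((U₀ × U₁ × U₂) × X)) :
    infoCommon₁ W q = entropy (transmitLaw W q) (fun ω => ω.2.1) +
      entropy q (fun z => z.1.1) -
      entropy (transmitLaw W q) (fun ω => (ω.2.1, ω.1.1.1)) := by
  rw [infoCommon₁, mutualInfo_eq_entropy (transmitLaw_mem W hq).1,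
    entropy_transmitLaw_fst W q (fun z => z.1.1)]

lemma infoCommon₂_eq_entropy (hq : q ∈ stdSimplex ℝ ((U₀ × U₁ × U₂) × X)) :
    infoCommon₂ W q = entropy (transmitLaw W q) (fun ω => ω.2.2) +
      entropy q (fun z => z.1.1) -
      entropy (transmitLaw W q) (fun ω => (ω.2.2, ω.1.1.1)) := by
  rw [infoCommon₂, mutualInfo_eq_entropy (transmitLaw_mem W hq).1,
    entropy_transmitLaw_fst W q (fun z => z.1.1)]

lemma infoCross_eq_entropy (hq : q ∈ stdSimplex ℝ ((U₀ × U₁ × U₂) × X)) :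
    infoCross q = entropy q (fun z => (z.1.1, z.1.2.1)) + entropy q (fun z => (z.1.1, z.1.2.2)) -
      entropy q (fun z => z.1) - entropy q (fun z => z.1.1) := by
  rw [infoCross, condMutualInfo_eq_entropy hq.1,
    entropy_congr (A := fun z : (U₀ × U₁ × U₂) × X => (z.1.2.1, z.1.1))
      (B := fun z => (z.1.1, z.1.2.1)) (by simp; tauto),
    entropy_congr (A := fun z : (U₀ × U₁ × U₂) × X => (z.1.2.2, z.1.1))
      (B := fun z => (z.1.1, z.1.2.2)) (by simp; tauto),
    entropy_congr (A := fun z : (U₀ × U₁ × U₂) × X => (z.1.2.1, z.1.2.2, z.1.1))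
      (B := fun z => z.1) (by simp [Prod.ext_iff]; tauto)]

lemma infoFull₁_eq_add (hq : q ∈ stdSimplex ℝ ((U₀ × U₁ × U₂) × X)) :
    infoFull₁ W q = infoCommon₁ W q + infoPriv₁ W q := by
  rw [infoFull₁_eq_entropy W hq, infoCommon₁_eq_entropy W hq, infoPriv₁_eq_entropy W hq]
  ring

lemma infoFull₂_eq_add (hq : q ∈ stdSimplex ℝ ((U₀ × U₁ × U₂) × X)) :
    infoFull₂ W q = infoCommon₂ W q + infoPriv₂ W q := by
  rw [infoFull₂_eq_entropy W hq, infoCommon₂_eq_entropy W hq, infoPriv₂_eq_entropy W hq]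
  ring

/-! ### Divergences as real numbers -/

/-- `D(P^e_{U₀} ‖ P^c_{U₀})` as a real number, meaningful under absolute continuity. -/
def realDivCommon (c : CodebookLaw U₀ U₁ U₂) (q : (U₀ × U₁ × U₂) × X → ℝ) : ℝ :=
  -entropy q (fun z => z.1.1) - meanLog q (fun z => c.p₀ z.1.1)

/-- `D(P^e_{U₁|U₀} ‖ P^c_{U₁|U₀} | P^e_{U₀})` as a real number, meaningful under absolute
continuity. -/
def realDivPriv₁ (c : CodebookLaw U₀ U₁ U₂) (q : (U₀ × U₁ × U₂) × X → ℝ) : ℝ :=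
  entropy q (fun z => z.1.1) - entropy q (fun z => (z.1.1, z.1.2.1)) -
    meanLog q (fun z => c.p₁ z.1.1 z.1.2.1)

/-- `D(P^e_{U₂|U₀} ‖ P^c_{U₂|U₀} | P^e_{U₀})` as a real number, meaningful under absolute
continuity. -/
def realDivPriv₂ (c : CodebookLaw U₀ U₁ U₂) (q : (U₀ × U₁ × U₂) × X → ℝ) : ℝ :=
  entropy q (fun z => z.1.1) - entropy q (fun z => (z.1.1, z.1.2.2)) -
    meanLog q (fun z => c.p₂ z.1.1 z.1.2.2)

/-- Absolute continuity of the encoding distribution with respect to the codebook distribution,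
factor by factor and pointwise on the support of the joint law. -/
def FactorsNeZero (c : CodebookLaw U₀ U₁ U₂) (q : (U₀ × U₁ × U₂) × X → ℝ) : Prop :=
  ∀ z, q z ≠ 0 → c.p₀ z.1.1 ≠ 0 ∧ c.p₁ z.1.1 z.1.2.1 ≠ 0 ∧ c.p₂ z.1.1 z.1.2.2 ≠ 0

lemma factorsNeZero_of_ac (hq : ∀ z, 0 ≤ q z)
    (hac : ∀ u, c.joint u = 0 → pmfLaw q (fun z => z.1) u = 0) : FactorsNeZero c q := by
  intro z hz
  have h := mt (hac z.1) (pmfLaw_pos hq (fun z => z.1) hz).ne'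
  unfold CodebookLaw.joint at h
  obtain ⟨h₀₁, h₂⟩ := mul_ne_zero_iff.1 h
  exact ⟨left_ne_zero_of_mul h₀₁, right_ne_zero_of_mul h₀₁, h₂⟩

lemma ac_of_divAll_ne_top (h : divAll c q ≠ ⊤) :
    ∀ u, c.joint u = 0 → pmfLaw q (fun z => z.1) u = 0 := by
  unfold divAll relEntropy at h
  by_contra h'
  exact h (if_neg h')

lemma divCommon_eq (hq : ∀ z, 0 ≤ q z) (hc : FactorsNeZero c q) :
    divCommon c q = (realDivCommon c q : EReal) :=
  relEntropy_pmfLaw hq _ fun z hz => (hc z hz).1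

lemma divPriv₁_eq (hq : ∀ z, 0 ≤ q z) (hc : FactorsNeZero c q) :
    divPriv₁ c q = (realDivPriv₁ c q : EReal) :=
  condRelEntropy_condLaw hq _ _ fun z hz => (hc z hz).2.1

lemma divPriv₂_eq (hq : ∀ z, 0 ≤ q z) (hc : FactorsNeZero c q) :
    divPriv₂ c q = (realDivPriv₂ c q : EReal) :=
  condRelEntropy_condLaw hq _ _ fun z hz => (hc z hz).2.2

lemma divPair₁_eq (hq : ∀ z, 0 ≤ q z) (hc : FactorsNeZero c q) :
    divPair₁ c q = ((realDivCommon c q + realDivPriv₁ c q : ℝ) : EReal) := by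
  rw [divPair₁, relEntropy_pmfLaw hq _ (q := c.joint₁) fun z hz =>
    mul_ne_zero (hc z hz).1 (hc z hz).2.1, EReal.coe_eq_coe_iff]
  unfold CodebookLaw.joint₁
  rw [meanLog_mul (fun z hz => (hc z hz).1) (fun z hz => (hc z hz).2.1)]
  unfold realDivCommon realDivPriv₁
  ring

lemma divPair₂_eq (hq : ∀ z, 0 ≤ q z) (hc : FactorsNeZero c q) :
    divPair₂ c q = ((realDivCommon c q + realDivPriv₂ c q : ℝ) : EReal) := by
  rw [divPair₂, relEntropy_pmfLaw hq _ (q := c.joint₂) fun z hz =>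
    mul_ne_zero (hc z hz).1 (hc z hz).2.2, EReal.coe_eq_coe_iff]
  unfold CodebookLaw.joint₂
  rw [meanLog_mul (fun z hz => (hc z hz).1) (fun z hz => (hc z hz).2.2)]
  unfold realDivCommon realDivPriv₂
  ring

/-- The chain rule that makes the binning bounds a contrapolymatroid: the divergence of the triple
exceeds the sum of the three factor divergences by exactly `I(U₁; U₂ | U₀)`. -/
lemma divAll_eq (hq : q ∈ stdSimplex ℝ ((U₀ × U₁ × U₂) × X)) (hc : FactorsNeZero c q) :
    divAll c q =
      ((realDivCommon c q + realDivPriv₁ c q + realDivPriv₂ c q + infoCross q : ℝ) : EReal) := by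
  rw [divAll, relEntropy_pmfLaw hq.1 _ (q := c.joint) fun z hz =>
    mul_ne_zero (mul_ne_zero (hc z hz).1 (hc z hz).2.1) (hc z hz).2.2, EReal.coe_eq_coe_iff,
    infoCross_eq_entropy hq]
  unfold CodebookLaw.joint
  rw [meanLog_mul (fun z hz => mul_ne_zero (hc z hz).1 (hc z hz).2.1)
    (fun z hz => (hc z hz).2.2),
    meanLog_mul (fun z hz => (hc z hz).1) (fun z hz => (hc z hz).2.1)]
  unfold realDivCommon realDivPriv₁ realDivPriv₂
  ring

lemma realDivCommon_nonneg (hq : q ∈ stdSimplex ℝ ((U₀ × U₁ × U₂) × X))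
    (hc : FactorsNeZero c q) : 0 ≤ realDivCommon c q := by
  have h := entropy_sub_meanLog_nonneg hq.1 (fun _ => ()) (fun z => z.1.1)
    (V := fun _ => c.p₀) (fun _ => c.p₀_mem.1) (fun _ => c.p₀_mem.2.le) (fun z hz => (hc z hz).1)
  rw [entropy_const hq.2, entropy_congr (B := fun z : (U₀ × U₁ × U₂) × X => z.1.1) (by simp)] at h
  unfold realDivCommon
  linarith

lemma realDivPriv₁_nonneg (hq : ∀ z, 0 ≤ q z) (hc : FactorsNeZero c q) :
    0 ≤ realDivPriv₁ c q :=
  entropy_sub_meanLog_nonneg hq _ _ (fun u => (c.p₁_mem u).1) (fun u => (c.p₁_mem u).2.le)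
    fun z hz => (hc z hz).2.1

lemma realDivPriv₂_nonneg (hq : ∀ z, 0 ≤ q z) (hc : FactorsNeZero c q) :
    0 ≤ realDivPriv₂ c q :=
  entropy_sub_meanLog_nonneg hq _ _ (fun u => (c.p₂_mem u).1) (fun u => (c.p₂_mem u).2.le)
    fun z hz => (hc z hz).2.2

lemma infoCross_nonneg (hq : ∀ z, 0 ≤ q z) : 0 ≤ infoCross q := condMutualInfo_nonneg hq _ _ _

lemma infoPriv₁_nonneg (hq : q ∈ stdSimplex ℝ ((U₀ × U₁ × U₂) × X)) : 0 ≤ infoPriv₁ W q :=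
  condMutualInfo_nonneg (transmitLaw_mem W hq).1 _ _ _

lemma infoPriv₂_nonneg (hq : q ∈ stdSimplex ℝ ((U₀ × U₁ × U₂) × X)) : 0 ≤ infoPriv₂ W q :=
  condMutualInfo_nonneg (transmitLaw_mem W hq).1 _ _ _

lemma infoCommon₂_nonneg (hq : q ∈ stdSimplex ℝ ((U₀ × U₁ × U₂) × X)) : 0 ≤ infoCommon₂ W q :=
  mutualInfo_nonneg (transmitLaw_mem W hq) _ _

/-! ### Fourier–Motzkin elimination of the binning rates -/

/-- The scheme bounds as inequalities between real numbers. -/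
lemma schemeBounds_iff_real (hq : q ∈ stdSimplex ℝ ((U₀ × U₁ × U₂) × X))
    (hc : FactorsNeZero c q) (R r : RateTriple) :
    SchemeBounds W c q R r ↔ R.Nonneg ∧ r.Nonneg ∧
      realDivCommon c q + realDivPriv₁ c q + realDivPriv₂ c q + infoCross q ≤
        r.common + r.priv₁ + r.priv₂ ∧
      realDivCommon c q + realDivPriv₁ c q ≤ r.common + r.priv₁ ∧
      realDivCommon c q + realDivPriv₂ c q ≤ r.common + r.priv₂ ∧
      realDivCommon c q ≤ r.common ∧
      (R.common + r.common) + (R.priv₁ + r.priv₁) ≤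
        infoFull₁ W q + (realDivCommon c q + realDivPriv₁ c q) ∧
      R.priv₁ + r.priv₁ ≤ infoPriv₁ W q + realDivPriv₁ c q ∧
      (R.common + r.common) + (R.priv₂ + r.priv₂) ≤
        infoFull₂ W q + (realDivCommon c q + realDivPriv₂ c q) ∧
      R.priv₂ + r.priv₂ ≤ infoPriv₂ W q + realDivPriv₂ c q := by
  constructor
  · rintro ⟨h1, h2, h3, h4, h5, h6, h7, h8, h9, h10⟩
    simp only [divAll_eq hq hc, divPair₁_eq hq.1 hc, divPair₂_eq hq.1 hc, divCommon_eq hq.1 hc,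
      divPriv₁_eq hq.1 hc, divPriv₂_eq hq.1 hc, ← EReal.coe_add, EReal.coe_le_coe_iff]
      at h3 h4 h5 h6 h7 h8 h9 h10
    exact ⟨h1, h2, h3, h4, h5, h6, h7, h8, h9, h10⟩
  · rintro ⟨h1, h2, h3, h4, h5, h6, h7, h8, h9, h10⟩
    constructor <;>
    simpa only [divAll_eq hq hc, divPair₁_eq hq.1 hc, divPair₂_eq hq.1 hc, divCommon_eq hq.1 hc,
      divPriv₁_eq hq.1 hc, divPriv₂_eq hq.1 hc, ← EReal.coe_add, EReal.coe_le_coe_iff]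

/-- The rates `s₀ = r₀ - d₀`, `a₁ = s₀ + s₁`, `a₂ = s₀ + s₂` of binning in excess of the
divergences exist as soon as the eliminated bounds hold: `A₁, A₂, B₁, B₂` are what decoding leaves
for `a₁`, `a₂`, `s₁`, `s₂`. -/
lemma exists_excess_rates {A₁ A₂ B₁ B₂ d₁ d₂ I : ℝ} (hd₁ : 0 ≤ d₁) (hd₂ : 0 ≤ d₂) (hI : 0 ≤ I)
    (hA₁ : 0 ≤ A₁) (hA₂ : 0 ≤ A₂) (hB₁ : -d₁ ≤ B₁) (hB₂ : -d₂ ≤ B₂) (h₁₂ : I ≤ A₁ + B₂)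
    (h₂₁ : I ≤ A₂ + B₁) (hA : I ≤ A₁ + A₂) :
    ∃ s₀ a₁ a₂ : ℝ, 0 ≤ s₀ ∧ 0 ≤ a₁ ∧ 0 ≤ a₂ ∧ a₁ ≤ A₁ ∧ a₂ ≤ A₂ ∧ a₁ - s₀ ≤ B₁ ∧ a₂ - s₀ ≤ B₂ ∧
      -d₁ ≤ a₁ - s₀ ∧ -d₂ ≤ a₂ - s₀ ∧ I ≤ a₁ + a₂ - s₀ := by
  -- Both `aᵢ` are taken as large as the couplings `a₂ ≤ a₁ + d₁ + B₂` and `a₁ ≤ a₂ + d₂ + B₁`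
  -- allow, and `s₀` as small as possible.
  have key : ∃ a₁ a₂ : ℝ, 0 ≤ a₁ ∧ 0 ≤ a₂ ∧ a₁ ≤ A₁ ∧ a₂ ≤ A₂ ∧ I - B₁ ≤ a₂ ∧ I - B₂ ≤ a₁ ∧
      I ≤ a₁ + a₂ ∧ a₁ - a₂ ≤ d₂ + B₁ ∧ a₂ - a₁ ≤ d₁ + B₂ := by
    rcases le_total A₁ A₂ with h | h
    · rcases le_total A₂ (A₁ + d₁ + B₂) with h' | h'
      · by_cases h2 : A₁ - A₂ ≤ d₂ + B₁
        · exact ⟨A₁, A₂, by linarith, by linarith, le_rfl, le_rfl, by linarith, by linarith,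
            by linarith, by linarith, by linarith⟩
        · exact ⟨A₂ + d₂ + B₁, A₂, by linarith, by linarith, by linarith, le_rfl, by linarith,
            by linarith, by linarith, by linarith, by linarith⟩
      · exact ⟨A₁, A₁ + d₁ + B₂, by linarith, by linarith, le_rfl, by linarith, by linarith,
          by linarith, by linarith, by linarith, by linarith⟩
    · rcases le_total A₁ (A₂ + d₂ + B₁) with h' | h'
      · by_cases h2 : A₂ - A₁ ≤ d₁ + B₂
        · exact ⟨A₁, A₂, by linarith, by linarith, le_rfl, le_rfl, by linarith, by linarith,
            by linarith, by linarith, by linarith⟩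
        · exact ⟨A₁, A₁ + d₁ + B₂, by linarith, by linarith, le_rfl, by linarith, by linarith,
            by linarith, by linarith, by linarith, by linarith⟩
      · exact ⟨A₂ + d₂ + B₁, A₂, by linarith, by linarith, by linarith, le_rfl, by linarith,
          by linarith, by linarith, by linarith, by linarith⟩
  obtain ⟨a₁, a₂, h1, h2, h3, h4, h5, h6, h7, h8, h9⟩ := key
  have m1 := le_max_left 0 (max (a₁ - B₁) (a₂ - B₂))
  have m2 := (le_max_left (a₁ - B₁) (a₂ - B₂)).trans (le_max_right 0 _)
  have m3 := (le_max_right (a₁ - B₁) (a₂ - B₂)).trans (le_max_right 0 _)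
  have up : ∀ t : ℝ, 0 ≤ t → a₁ - B₁ ≤ t → a₂ - B₂ ≤ t →
      max 0 (max (a₁ - B₁) (a₂ - B₂)) ≤ t := fun t x y z => max_le x (max_le y z)
  have u1 := up (a₁ + d₁) (by linarith) (by linarith) (by linarith)
  have u2 := up (a₂ + d₂) (by linarith) (by linarith) (by linarith)
  have u3 := up (a₁ + a₂ - I) (by linarith) (by linarith) (by linarith)
  exact ⟨_, a₁, a₂, m1, h1, h2, h3, h4, by linarith, by linarith, by linarith, by linarith,
    by linarith⟩

theorem exists_schemeBounds_iff (hq : q ∈ stdSimplex ℝ ((U₀ × U₁ × U₂) × X))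
    (hc : FactorsNeZero c q) (R : RateTriple) :
    (∃ r : RateTriple, SchemeBounds W c q R r) ↔ EliminatedBounds W c q R := by
  simp only [schemeBounds_iff_real W hq hc]
  have hd₀ := realDivCommon_nonneg hq hc
  have hd₁ := realDivPriv₁_nonneg hq.1 hc
  have hd₂ := realDivPriv₂_nonneg hq.1 hc
  constructor
  · rintro ⟨r, hR, ⟨r0, r1, r2⟩, h3, h4, h5, h6, h7, h8, h9, h10⟩
    refine ⟨hR, ?_, ?_, by linarith, by linarith, by linarith, by linarith, by linarith⟩
    · rw [divPriv₁_eq hq.1 hc, ← EReal.coe_add, EReal.coe_le_coe_iff]; linarith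
    · rw [divPriv₂_eq hq.1 hc, ← EReal.coe_add, EReal.coe_le_coe_iff]; linarith
  · rintro ⟨hR, h1, h2, h3, h4, h5, h6, h7⟩
    rw [divPriv₁_eq hq.1 hc, ← EReal.coe_add, EReal.coe_le_coe_iff] at h1
    rw [divPriv₂_eq hq.1 hc, ← EReal.coe_add, EReal.coe_le_coe_iff] at h2
    obtain ⟨s₀, a₁, a₂, k1, k2, k3, k4, k5, k6, k7, k8, k9, k10⟩ := exists_excess_rates
      (A₁ := infoFull₁ W q - R.common - R.priv₁) (A₂ := infoFull₂ W q - R.common - R.priv₂)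
      (B₁ := infoPriv₁ W q - R.priv₁) (B₂ := infoPriv₂ W q - R.priv₂) hd₁ hd₂
      (infoCross_nonneg hq.1) (by linarith) (by linarith) (by linarith) (by linarith)
      (by linarith) (by linarith) (by linarith)
    exact ⟨⟨realDivCommon c q + s₀, realDivPriv₁ c q + (a₁ - s₀), realDivPriv₂ c q + (a₂ - s₀)⟩,
      hR, ⟨add_nonneg hd₀ k1, by dsimp only; linarith, by dsimp only; linarith⟩,
      by dsimp only; linarith, by dsimp only; linarith, by dsimp only; linarith,
      by dsimp only; linarith, by dsimp only; linarith, by dsimp only; linarith,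
      by dsimp only; linarith, by dsimp only; linarith⟩

/-- The amounts `t₁, t₂` of the two rates that are moved to the common codeword. -/
lemma exists_split {F₁ F₂ C₁ C₂ P₁ P₂ I x y : ℝ} (hF₁ : F₁ = C₁ + P₁) (hF₂ : F₂ = C₂ + P₂)
    (hC₂ : 0 ≤ C₂) (hP₁ : 0 ≤ P₁) (hP₂ : 0 ≤ P₂) (hI : 0 ≤ I)
    (hx : 0 ≤ x) (hy : 0 ≤ y) (hx' : x ≤ F₁) (hy' : y ≤ F₂)
    (h : x + y ≤ min C₁ C₂ + P₁ + P₂ - I) :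
    ∃ t₁ t₂ : ℝ, 0 ≤ t₁ ∧ 0 ≤ t₂ ∧ t₁ ≤ x ∧ t₂ ≤ y ∧ x - t₁ ≤ P₁ ∧ y - t₂ ≤ P₂ ∧
      x + t₂ ≤ F₁ ∧ y + t₁ ≤ F₂ ∧ x + y + t₁ + t₂ ≤ F₁ + F₂ - I := by
  have h1 : x + y ≤ C₁ + P₁ + P₂ - I := by linarith [min_le_left C₁ C₂]
  have h2 : x + y ≤ C₂ + P₁ + P₂ - I := by linarith [min_le_right C₁ C₂]
  rcases le_total x P₁ with a | a <;> rcases le_total y P₂ with b | b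
  · exact ⟨0, 0, le_rfl, le_rfl, hx, hy, by linarith, by linarith, by linarith, by linarith,
      by linarith⟩
  · exact ⟨0, y - P₂, le_rfl, by linarith, hx, by linarith, by linarith, by linarith,
      by linarith, by linarith, by linarith⟩
  · exact ⟨x - P₁, 0, by linarith, le_rfl, by linarith, hy, by linarith, by linarith,
      by linarith, by linarith, by linarith⟩
  · exact ⟨x - P₁, y - P₂, by linarith, by linarith, by linarith, by linarith, by linarith,
      by linarith, by linarith, by linarith, by linarith⟩

theorem schemePairs_eq_martonPairs (hq : q ∈ stdSimplex ℝ ((U₀ × U₁ × U₂) × X))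
    (hc : FactorsNeZero c q) : schemePairs W c q = martonPairs W q := by
  have hd₁ := realDivPriv₁_nonneg hq.1 hc
  have hd₂ := realDivPriv₂_nonneg hq.1 hc
  have e1 := infoFull₁_eq_add W hq
  have e2 := infoFull₂_eq_add W hq
  ext ⟨x, y⟩
  constructor
  · rintro ⟨R, r, α, ⟨hα0, hα1⟩, hb, hx, hy⟩
    obtain ⟨⟨R0, R1, R2⟩, h1, h2, h3, h4, h5, h6, h7⟩ :=
      (exists_schemeBounds_iff W hq hc R).1 ⟨r, hb⟩
    have m1 := mul_nonneg hα0 R0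
    have m2 := mul_nonneg (sub_nonneg.2 hα1) R0
    simp only at hx hy
    refine ⟨?_, ?_, ?_, ?_, ?_⟩
    · simp only; linarith
    · simp only; linarith
    · simp only; linarith
    · simp only; linarith
    · have : x + y - infoPriv₁ W q - infoPriv₂ W q + infoCross q ≤
          min (infoCommon₁ W q) (infoCommon₂ W q) := le_min (by linarith) (by linarith)
      simp only; linarith
  · rintro ⟨hx, hy, hx', hy', h⟩
    obtain ⟨t₁, t₂, k1, k2, k3, k4, k5, k6, k7, k8, k9⟩ := exists_split e1 e2
      (infoCommon₂_nonneg W hq) (infoPriv₁_nonneg W hq)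
      (infoPriv₂_nonneg W hq) (infoCross_nonneg hq.1) hx hy hx' hy' h
    have h1 := h.trans
      (sub_le_sub_right (add_le_add_left (add_le_add_left (min_le_left _ _) _) _) _)
    have h2 := h.trans
      (sub_le_sub_right (add_le_add_left (add_le_add_left (min_le_right _ _) _) _) _)
    simp only at h1 h2 k3 k4 k5 k6 k7 k8 k9
    have hE : EliminatedBounds W c q ⟨t₁ + t₂, x - t₁, y - t₂⟩ := by
      refine ⟨⟨add_nonneg k1 k2, sub_nonneg.2 k3, sub_nonneg.2 k4⟩, ?_, ?_, ?_, ?_, ?_, ?_, ?_⟩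
      · rw [divPriv₁_eq hq.1 hc, ← EReal.coe_add, EReal.coe_le_coe_iff]; linarith
      · rw [divPriv₂_eq hq.1 hc, ← EReal.coe_add, EReal.coe_le_coe_iff]; linarith
      all_goals dsimp only; linarith
    obtain ⟨r, hr⟩ := (exists_schemeBounds_iff W hq hc _).2 hE
    rcases (add_nonneg k1 k2).eq_or_lt with h0 | h0
    · exact ⟨_, r, 0, ⟨le_rfl, zero_le_one⟩, hr, by dsimp only; linarith, by dsimp only; linarith⟩
    · refine ⟨_, r, t₁ / (t₁ + t₂), ⟨by positivity, (div_le_one h0).2 (by linarith)⟩, hr, ?_, ?_⟩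
      · dsimp only; field_simp; ring
      · dsimp only; field_simp; ring

end Quantities

/-! ### Marginals of product laws -/

section Pi

variable {ι α : Type*} [Fintype ι] [DecidableEq ι] [Fintype α]

lemma sum_pi_prod (g : ι → α → ℝ) : ∑ f : ι → α, ∏ i, g i (f i) = ∏ i, ∑ a, g i a :=
  (Fintype.prod_sum g).symm

lemma sum_pi_one {q : ι → α → ℝ} (hq : ∀ i, ∑ a, q i a = 1) : ∑ f : ι → α, ∏ i, q i (f i) = 1 := by
  rw [sum_pi_prod]; simp [hq]

lemma sum_pi_single {q : ι → α → ℝ} (hq : ∀ i, ∑ a, q i a = 1) (i : ι) (F : α → ℝ) :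
    ∑ f : ι → α, (∏ k, q k (f k)) * F (f i) = ∑ a, q i a * F a := by
  classical
  have h := sum_pi_prod (fun k a => q k a * if k = i then F a else 1)
  simp only [Finset.prod_mul_distrib, Finset.prod_ite_eq', Finset.mem_univ, if_true] at h
  rw [h, Finset.prod_eq_single i]
  · simp
  · intro k _ hk; simp [hk, hq]
  · simp

lemma sum_pi_pair {q : ι → α → ℝ} (hq : ∀ i, ∑ a, q i a = 1) {i j : ι} (hij : i ≠ j)
    (F : α → α → ℝ) :
    ∑ f : ι → α, (∏ k, q k (f k)) * F (f i) (f j) = ∑ a, q i a * ∑ b, q j b * F a b := by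
  classical
  have key : ∀ b, ∑ f : ι → α, (∏ k, q k (f k)) * (if f j = b then F (f i) b else 0) =
      ∑ a, q i a * (q j b * F a b) := by
    intro b
    have h := sum_pi_prod (fun k a => q k a *
      ((if k = i then F a b else 1) * if k = j then (if a = b then 1 else 0) else 1))
    simp only [Finset.prod_mul_distrib, Finset.prod_ite_eq', Finset.mem_univ, if_true] at h
    have h' : ∑ f : ι → α, (∏ k, q k (f k)) * (if f j = b then F (f i) b else 0) =
        ∑ f : ι → α, (∏ k, q k (f k)) * (F (f i) b * if f j = b then 1 else 0) := by
      simp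
    rw [h', h, ← Finset.mul_prod_erase _ _ (Finset.mem_univ i),
      ← Finset.mul_prod_erase _ _ (Finset.mem_erase.2 ⟨hij.symm, Finset.mem_univ j⟩),
      Finset.prod_eq_one, mul_one]
    · simp only [if_true, hij, hij.symm, if_false, mul_one, mul_ite, mul_zero,
        Finset.sum_ite_eq', Finset.mem_univ]
      rw [Finset.sum_mul]
      exact Finset.sum_congr rfl fun a _ => by ring
    · intro k hk
      simp only [Finset.mem_erase] at hk
      simp [hk.1, hk.2.1, hq]
  have : ∀ f : ι → α, F (f i) (f j) = ∑ b, if f j = b then F (f i) b else 0 := by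
    intro f; simp
  simp only [this, Finset.mul_sum]
  rw [Finset.sum_comm]
  simp only [← Finset.mul_sum] at key ⊢
  simp only [key]
  rw [Finset.sum_comm]
  simp only [Finset.mul_sum]

end Pi

/-! ### Marton's region and functional channel inputs -/

section Functional

lemma functionalInput_eq_pmfLaw {U X : Type*} [Fintype U] (p : U → ℝ) (f : U → X) :
    functionalInput p f = pmfLaw p (fun u => (u, f u)) := by
  classical
  funext z
  unfold functionalInput pmfLaw
  rw [Finset.sum_eq_single z.1]
  · simp [Prod.ext_iff, eq_comm]
  · intro b _ hb; simp [Prod.ext_iff, hb]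
  · simp

lemma functionalInput_mem {U X : Type*} [Fintype U] [Fintype X] {p : U → ℝ}
    (hp : p ∈ stdSimplex ℝ U) (f : U → X) : functionalInput p f ∈ stdSimplex ℝ (U × X) := by
  rw [functionalInput_eq_pmfLaw]
  exact pmfLaw_mem_stdSimplex hp _

lemma pmfLaw_id {Ω : Type*} [Fintype Ω] (P : Ω → ℝ) : pmfLaw P (fun ω => ω) = P := by
  classical
  funext ω; simp [pmfLaw]

lemma entropy_prod {Ω V α : Type*} [Fintype Ω] [Fintype V] {P : Ω → ℝ} {r : V → ℝ}
    (hP : P ∈ stdSimplex ℝ Ω) (hr : r ∈ stdSimplex ℝ V) (A : Ω → α) :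
    entropy (fun z : Ω × V => P z.1 * r z.2) (fun z => (A z.1, z.2)) =
      entropy P A + entropy r (fun v => v) := by
  have hlaw : ∀ a v, pmfLaw (fun z : Ω × V => P z.1 * r z.2) (fun z => (A z.1, z.2)) (a, v) =
      pmfLaw P A a * r v := by
    intro a v
    unfold pmfLaw
    rw [Fintype.sum_prod_type, Finset.sum_mul]
    refine Finset.sum_congr rfl fun ω _ => ?_
    rw [Finset.sum_eq_single v]
    · by_cases h : A ω = a <;> simp [h]
    · intro b _ hb; simp [hb]
    · simp
  unfold entropy
  simp only [hlaw, pmfLaw_id]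
  rw [← neg_add, Fintype.sum_prod_type, neg_inj]
  have h1 : ∀ ω, ∑ v, P ω * r v * Real.logb 2 (pmfLaw P A (A ω) * r v) =
      P ω * Real.logb 2 (pmfLaw P A (A ω)) + P ω * ∑ v, r v * Real.logb 2 (r v) := by
    intro ω
    by_cases hω : P ω = 0
    · simp [hω]
    · have : ∀ v, P ω * r v * Real.logb 2 (pmfLaw P A (A ω) * r v) =
          r v * (P ω * Real.logb 2 (pmfLaw P A (A ω))) + P ω * (r v * Real.logb 2 (r v)) := by
        intro v
        by_cases hv : r v = 0
        · simp [hv]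
        · rw [Real.logb_mul (pmfLaw_pos hP.1 A hω).ne' hv]; ring
      simp only [this, Finset.sum_add_distrib, ← Finset.sum_mul, ← Finset.mul_sum, hr.2, one_mul]
  simp only [h1, Finset.sum_add_distrib, ← Finset.sum_mul, hP.2, one_mul]

lemma transmitLaw_pmfLaw {Ω U X Y₁ Y₂ : Type*} [Fintype Ω] [Fintype Y₁] [Fintype Y₂]
    (W : BroadcastChannel X Y₁ Y₂) (P : Ω → ℝ) (A : Ω → U × X) :
    transmitLaw W (pmfLaw P A) = pmfLaw (fun ω : Ω × (Y₁ × Y₂) => P ω.1 * W.prob (A ω.1).2 ω.2)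
      (fun ω => (A ω.1, ω.2)) := by
  classical
  funext z
  unfold transmitLaw pmfLaw
  rw [Fintype.sum_prod_type, Finset.sum_mul]
  refine Finset.sum_congr rfl fun ω _ => ?_
  rw [Finset.sum_eq_single z.2]
  · by_cases h : A ω = z.1 <;> simp [h, Prod.ext_iff]
  · intro b _ hb; simp [hb, Prod.ext_iff]
  · simp

/-- Every law of `(U, X)` is that of `(U, V(U))`, where the random function `V : U → X` is
independent of `U` and has independent values. -/
lemma exists_functional_representation {U X : Type*} [Fintype U] [Fintype X] [DecidableEq U]
    {q : U × X → ℝ} (hq : q ∈ stdSimplex ℝ (U × X)) :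
    ∃ r ∈ stdSimplex ℝ (U → X), q = pmfLaw (fun z : U × (U → X) => pmfLaw q Prod.fst z.1 * r z.2)
      (fun z => (z.1, z.2 z.1)) := by
  classical
  obtain ⟨⟨-, x₀⟩, -⟩ : ∃ z, q z ≠ 0 := by
    by_contra! h
    have := hq.2
    simp [h] at this
  have hmarg : ∀ u, pmfLaw q Prod.fst u = ∑ x, q (u, x) := by
    intro u
    unfold pmfLaw
    rw [Fintype.sum_prod_type, Finset.sum_eq_single u]
    · simp
    · intro b _ hb; simp [hb]
    · simp
  have hnn := pmfLaw_nonneg hq.1 Prod.fst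
  let κ : U → X → ℝ := fun u x =>
    if pmfLaw q Prod.fst u = 0 then (if x = x₀ then 1 else 0) else q (u, x) / pmfLaw q Prod.fst u
  have hκ0 : ∀ u x, 0 ≤ κ u x := by
    intro u x
    dsimp only [κ]
    split_ifs
    · exact zero_le_one
    · exact le_rfl
    · exact div_nonneg (hq.1 _) (hnn u)
  have hκ1 : ∀ u, ∑ x, κ u x = 1 := by
    intro u
    dsimp only [κ]
    split_ifs with h
    · simp
    · rw [← Finset.sum_div, ← hmarg, div_self h]
  have hκq : ∀ u x, pmfLaw q Prod.fst u * κ u x = q (u, x) := by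
    intro u x
    dsimp only [κ]
    split_ifs with h h'
    · rw [h, zero_mul]
      exact (pmfLaw_id q ▸ pmfLaw_eq_zero_of_comp hq.1 (A := fun z => z) Prod.fst (fun _ => rfl)
        (a := (u, x)) h).symm
    · rw [h, zero_mul]
      exact (pmfLaw_id q ▸ pmfLaw_eq_zero_of_comp hq.1 (A := fun z => z) Prod.fst (fun _ => rfl)
        (a := (u, x)) h).symm
    · field_simp
  refine ⟨fun v => ∏ u, κ u (v u), ⟨fun v => Finset.prod_nonneg fun u _ => hκ0 u _,
    sum_pi_one hκ1⟩, ?_⟩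
  funext ⟨u, x⟩
  unfold pmfLaw
  rw [Fintype.sum_prod_type, Finset.sum_eq_single u]
  · have h := sum_pi_single hκ1 u (fun a => if a = x then pmfLaw q Prod.fst u else 0)
    simp only [mul_ite, mul_zero, Finset.sum_ite_eq', Finset.mem_univ, if_true] at h
    rw [mul_comm (κ u x), hκq] at h
    rw [← h]
    refine Finset.sum_congr rfl fun v _ => ?_
    by_cases hv : v u = x <;> simp [hv, pmfLaw, mul_comm]
  · intro b _ hb; simp [hb]
  · simp

variable {X Y₁ Y₂ : Type*} {U₀ U₁ U₂ : Type} [Fintype X] [Fintype Y₁] [Fintype Y₂]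
  [Fintype U₀] [Fintype U₁] [Fintype U₂]

/-- Replacing `U₁` by `(U₁, V)`, with `V` as in the functional representation of the channel
input, makes the input a function of the auxiliary variables. As `V` is independent of
`(U₀, U₁, U₂)`, the cross information `I(U₁; U₂ | U₀)` does not change, and the informations at
receiver 1 can only grow. -/
lemma exists_martonPairs_functionalInput (W : BroadcastChannel X Y₁ Y₂)
    {q : (U₀ × U₁ × U₂) × X → ℝ} (hq : q ∈ stdSimplex ℝ ((U₀ × U₁ × U₂) × X)) :
    ∃ (k : ℕ) (p : U₀ × Fin k × U₂ → ℝ) (f : U₀ × Fin k × U₂ → X),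
      p ∈ stdSimplex ℝ (U₀ × Fin k × U₂) ∧
      martonPairs W q ⊆ martonPairs W (functionalInput p f) := by
  classical
  obtain ⟨r, hr, hrep⟩ := exists_functional_representation hq
  let e := Fintype.equivFin (U₁ × (U₀ × U₁ × U₂ → X))
  let P : (U₀ × U₁ × U₂) × (U₀ × U₁ × U₂ → X) → ℝ := fun z => pmfLaw q Prod.fst z.1 * r z.2
  have hpU : pmfLaw q Prod.fst ∈ stdSimplex ℝ (U₀ × U₁ × U₂) := pmfLaw_mem_stdSimplex hq _
  have hP : P ∈ stdSimplex ℝ ((U₀ × U₁ × U₂) × (U₀ × U₁ × U₂ → X)) := by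
    refine ⟨fun z => mul_nonneg (hpU.1 _) (hr.1 _), ?_⟩
    rw [Fintype.sum_prod_type]
    simp only [P, ← Finset.mul_sum, hr.2, mul_one, hpU.2]
  let p := pmfLaw P (fun z => (z.1.1, e (z.1.2.1, z.2), z.1.2.2))
  let f : U₀ × Fin (Fintype.card (U₁ × (U₀ × U₁ × U₂ → X))) × U₂ → X :=
    fun t => (e.symm t.2.1).2 (t.1, (e.symm t.2.1).1, t.2.2)
  have hp : p ∈ stdSimplex ℝ _ := pmfLaw_mem_stdSimplex hP _
  refine ⟨_, p, f, hp, ?_⟩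
  have hq'e : functionalInput p f =
      pmfLaw P (fun z => ((z.1.1, e (z.1.2.1, z.2), z.1.2.2), z.2 z.1)) := by
    rw [functionalInput_eq_pmfLaw, pmfLaw_comp]
    simp [f]
  have hq' := functionalInput_mem hp f
  set q' := functionalInput p f
  let Q : ((U₀ × U₁ × U₂) × (U₀ × U₁ × U₂ → X)) × (Y₁ × Y₂) → ℝ :=
    fun ω => P ω.1 * W.prob (ω.1.2 ω.1.1) ω.2
  have hQ0 : ∀ ω, 0 ≤ Q ω := fun ω => mul_nonneg (hP.1 _) ((W.prob_mem _).1 _)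
  have hT : transmitLaw W q = pmfLaw Q (fun ω => ((ω.1.1, ω.1.2 ω.1.1), ω.2)) := by
    conv_lhs => rw [hrep]
    exact transmitLaw_pmfLaw W P _
  have hT' : transmitLaw W q' =
      pmfLaw Q (fun ω => (((ω.1.1.1, e (ω.1.1.2.1, ω.1.2), ω.1.1.2.2), ω.1.2 ω.1.1), ω.2)) := by
    rw [hq'e]
    exact transmitLaw_pmfLaw W P _
  have hent : ∀ {γ : Type} (g : (U₀ × U₁ × U₂) × X → γ),
      entropy q g = entropy Q (fun ω => g (ω.1.1, ω.1.2 ω.1.1)) := fun g => by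
    rw [← entropy_transmitLaw_fst W q g, hT, entropy_pmfLaw]
  have hent' : ∀ {γ : Type} (g : (U₀ × Fin (Fintype.card (U₁ × (U₀ × U₁ × U₂ → X))) × U₂) × X → γ),
      entropy q' g = entropy Q
        (fun ω => g ((ω.1.1.1, e (ω.1.1.2.1, ω.1.2), ω.1.1.2.2), ω.1.2 ω.1.1)) := fun g => by
    rw [← entropy_transmitLaw_fst W q' g, hT', entropy_pmfLaw]
  -- The two sides of each identity below are entropies, under `Q`, of random variables that
  -- induce the same partition.
  have h0 : entropy q' (fun z => z.1.1) = entropy q (fun z => z.1.1) := by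
    rw [hent, hent']
  have h2 : entropy q' (fun z => (z.1.1, z.1.2.2)) = entropy q (fun z => (z.1.1, z.1.2.2)) := by
    rw [hent, hent']
  have h1 : entropy q' (fun z => (z.1.1, z.1.2.1)) =
      entropy Q (fun ω => (ω.1.2, (ω.1.1.1, ω.1.1.2.1))) := by
    rw [hent']
    exact entropy_congr (by simp; tauto)
  have h1p : entropy q' (fun z => (z.1.1, z.1.2.1)) =
      entropy q (fun z => (z.1.1, z.1.2.1)) + entropy r (fun v => v) := by
    rw [hq'e, entropy_pmfLaw, ← entropy_pmfLaw q Prod.fst (fun u => (u.1, u.2.1)),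
      ← entropy_prod hpU hr]
    exact entropy_congr (by simp; tauto)
  have h12p : entropy q' (fun z => z.1) =
      entropy q (fun z => z.1) + entropy r (fun v => v) := by
    rw [hq'e, entropy_pmfLaw, ← entropy_pmfLaw q Prod.fst (fun u => u), ← entropy_prod hpU hr]
    exact entropy_congr (by simp; tauto)
  have y1 : entropy (transmitLaw W q') (fun ω => ω.2.1) =
      entropy (transmitLaw W q) (fun ω => ω.2.1) := by
    rw [hT, hT', entropy_pmfLaw, entropy_pmfLaw]
  have y2 : entropy (transmitLaw W q') (fun ω => ω.2.2) =
      entropy (transmitLaw W q) (fun ω => ω.2.2) := by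
    rw [hT, hT', entropy_pmfLaw, entropy_pmfLaw]
  have y1u0 : entropy (transmitLaw W q') (fun ω => (ω.2.1, ω.1.1.1)) =
      entropy (transmitLaw W q) (fun ω => (ω.2.1, ω.1.1.1)) := by
    rw [hT, hT', entropy_pmfLaw, entropy_pmfLaw]
  have y2u0 : entropy (transmitLaw W q') (fun ω => (ω.2.2, ω.1.1.1)) =
      entropy (transmitLaw W q) (fun ω => (ω.2.2, ω.1.1.1)) := by
    rw [hT, hT', entropy_pmfLaw, entropy_pmfLaw]
  have y2u2 : entropy (transmitLaw W q') (fun ω => (ω.2.2, (ω.1.1.1, ω.1.1.2.2))) =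
      entropy (transmitLaw W q) (fun ω => (ω.2.2, (ω.1.1.1, ω.1.1.2.2))) := by
    rw [hT, hT', entropy_pmfLaw, entropy_pmfLaw]
  have y1u1 : entropy (transmitLaw W q) (fun ω => (ω.2.1, (ω.1.1.1, ω.1.1.2.1))) =
      entropy Q (fun ω => (ω.2.1, (ω.1.1.1, ω.1.1.2.1))) := by
    rw [hT, entropy_pmfLaw]
  have y1u1' : entropy (transmitLaw W q') (fun ω => (ω.2.1, (ω.1.1.1, ω.1.1.2.1))) =
      entropy Q (fun ω => (ω.2.1, ω.1.2, (ω.1.1.1, ω.1.1.2.1))) := by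
    rw [hT', entropy_pmfLaw]
    exact entropy_congr (by simp; tauto)
  have hV := condMutualInfo_nonneg hQ0 (fun ω => ω.2.1) (fun ω => ω.1.2)
    (fun ω => (ω.1.1.1, ω.1.1.2.1))
  rw [condMutualInfo_eq_entropy hQ0, ← y1u1, ← y1u1', ← h1] at hV
  have h01 : entropy Q (fun ω => (ω.1.1.1, ω.1.1.2.1)) = entropy q (fun z => (z.1.1, z.1.2.1)) := by
    rw [hent]
  rw [h01] at hV
  rintro ⟨x, y⟩ ⟨hx, hy, hx', hy', hxy⟩
  have eF1 := infoFull₁_eq_entropy W hq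
  have eF1' := infoFull₁_eq_entropy W hq'
  have eF2 : infoFull₂ W q' = infoFull₂ W q := by
    rw [infoFull₂_eq_entropy W hq, infoFull₂_eq_entropy W hq', y2, h2, y2u2]
  have eP1 := infoPriv₁_eq_entropy W hq
  have eP1' := infoPriv₁_eq_entropy W hq'
  have eP2 : infoPriv₂ W q' = infoPriv₂ W q := by
    rw [infoPriv₂_eq_entropy W hq, infoPriv₂_eq_entropy W hq', y2u0, h2, y2u2, h0]
  have eC1 : infoCommon₁ W q' = infoCommon₁ W q := by
    rw [infoCommon₁_eq_entropy W hq, infoCommon₁_eq_entropy W hq', y1, h0, y1u0]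
  have eC2 : infoCommon₂ W q' = infoCommon₂ W q := by
    rw [infoCommon₂_eq_entropy W hq, infoCommon₂_eq_entropy W hq', y2, h0, y2u0]
  have eX : infoCross q' = infoCross q := by
    rw [infoCross_eq_entropy hq, infoCross_eq_entropy hq', h2, h1p, h12p, h0]
    ring
  rw [h0, y1u0] at eP1'
  rw [y1] at eF1'
  refine ⟨hx, hy, hx'.trans ?_, eF2 ▸ hy', hxy.trans ?_⟩
  · linarith
  · rw [eC1, eC2, eX, eP2]
    linarith

/-- For the inclusion of Marton's region, uniform codebook laws do: they have full support, and the
pairs of rates do not depend on the codebook law. -/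
theorem schemeRegion_eq_martonRegion (W : BroadcastChannel X Y₁ Y₂) :
    schemeRegion W = martonRegion W := by
  ext R'
  constructor
  · rintro ⟨k₀, k₁, k₂, c, p, f, hp, hR'⟩
    have hq := functionalInput_mem hp f
    obtain ⟨R, r, α, -, hb, -⟩ := id hR'
    have hc := factorsNeZero_of_ac hq.1 (ac_of_divAll_ne_top (c := c)
      (ne_top_of_le_ne_top (EReal.coe_ne_top _) hb.bin_all))
    exact ⟨k₀, k₁, k₂, _, hq, schemePairs_eq_martonPairs W hq hc ▸ hR'⟩
  · rintro ⟨k₀, k₁, k₂, q, hq, hR'⟩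
    obtain ⟨k, p, f, hp, hsub⟩ := exists_martonPairs_functionalInput W hq
    obtain ⟨u, -⟩ : ∃ u, p u ≠ 0 := by
      by_contra! h
      have := hp.2
      simp [h] at this
    have hunif : ∀ m : ℕ, Fin m → (fun _ : Fin m => (m : ℝ)⁻¹) ∈ stdSimplex ℝ (Fin m) := by
      intro m i
      have : (m : ℝ) ≠ 0 := Nat.cast_ne_zero.2 i.pos.ne'
      exact ⟨fun _ => by positivity, by simp [this]⟩
    let c : CodebookLaw (Fin k₀) (Fin k) (Fin k₂) :=
      ⟨fun _ => (k₀ : ℝ)⁻¹, fun _ _ => (k : ℝ)⁻¹, fun _ _ => (k₂ : ℝ)⁻¹, hunif _ u.1,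
        fun _ => hunif _ u.2.1, fun _ => hunif _ u.2.2⟩
    have hc : FactorsNeZero c (functionalInput p f) := fun z _ =>
      ⟨inv_ne_zero (Nat.cast_ne_zero.2 u.1.pos.ne'),
        inv_ne_zero (Nat.cast_ne_zero.2 u.2.1.pos.ne'),
        inv_ne_zero (Nat.cast_ne_zero.2 u.2.2.pos.ne')⟩
    refine ⟨k₀, k, k₂, c, p, f, hp, ?_⟩
    rw [schemePairs_eq_martonPairs W (functionalInput_mem hp f) hc]
    exact hsub hR'

end Functional

/-! ### Random superposition codebooks -/

lemma sum_mul_sum_mul_mul {α β : Type*} [Fintype α] [Fintype β] (x F : α → ℝ) (y G : β → ℝ) :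
    ∑ a, x a * ∑ b, y b * (F a * G b) = (∑ a, x a * F a) * ∑ b, y b * G b := by
  rw [Finset.sum_mul]
  refine Finset.sum_congr rfl fun a _ => ?_
  rw [mul_assoc, Finset.mul_sum _ _ (F a)]
  congr 1
  exact Finset.sum_congr rfl fun b _ => mul_left_comm _ _ _

section OneShot

variable {κ l₁ l₂ A₀ A₁ A₂ : Type*} [Fintype κ] [Fintype l₁] [Fintype l₂]

/-- The probability of a superposition codebook with common codewords drawn from `a₀` and private
codewords drawn from the kernels `a₁`, `a₂`, for arbitrary index sets and codeword sets. -/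
def bookWeight (a₀ : A₀ → ℝ) (a₁ : A₀ → A₁ → ℝ) (a₂ : A₀ → A₂ → ℝ)
    (K : (κ → A₀) × (κ × l₁ → A₁) × (κ × l₂ → A₂)) : ℝ :=
  (∏ k, a₀ (K.1 k)) * (∏ k, a₁ (K.1 k.1) (K.2.1 k)) * ∏ k, a₂ (K.1 k.1) (K.2.2 k)

/-- The pieces of a probability law of superposition codewords. -/
structure IsSuperposition [Fintype A₀] [Fintype A₁] [Fintype A₂]
    (a₀ : A₀ → ℝ) (a₁ : A₀ → A₁ → ℝ) (a₂ : A₀ → A₂ → ℝ) : Prop where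
  common : a₀ ∈ stdSimplex ℝ A₀
  priv₁ : ∀ u, a₁ u ∈ stdSimplex ℝ A₁
  priv₂ : ∀ u, a₂ u ∈ stdSimplex ℝ A₂

variable [Fintype A₀] [Fintype A₁] [Fintype A₂] {a₀ : A₀ → ℝ} {a₁ : A₀ → A₁ → ℝ}
  {a₂ : A₀ → A₂ → ℝ}

lemma IsSuperposition.swap (h : IsSuperposition a₀ a₁ a₂) : IsSuperposition a₀ a₂ a₁ :=
  ⟨h.common, h.priv₂, h.priv₁⟩

lemma IsSuperposition.bookWeight_nonneg (h : IsSuperposition a₀ a₁ a₂)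
    (K : (κ → A₀) × (κ × l₁ → A₁) × (κ × l₂ → A₂)) : 0 ≤ bookWeight a₀ a₁ a₂ K :=
  mul_nonneg (mul_nonneg (Finset.prod_nonneg fun _ _ => h.common.1 _)
    (Finset.prod_nonneg fun _ _ => (h.priv₁ _).1 _)) (Finset.prod_nonneg fun _ _ => (h.priv₂ _).1 _)

variable [DecidableEq κ] [DecidableEq l₁] [DecidableEq l₂]

lemma sum_bookWeight_mul (a₀ : A₀ → ℝ) (a₁ : A₀ → A₁ → ℝ) (a₂ : A₀ → A₂ → ℝ)
    (G : (κ → A₀) × (κ × l₁ → A₁) × (κ × l₂ → A₂) → ℝ) :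
    ∑ K, bookWeight a₀ a₁ a₂ K * G K =
      ∑ f₀, (∏ k, a₀ (f₀ k)) * ∑ f₁, (∏ k, a₁ (f₀ k.1) (f₁ k)) *
        ∑ f₂, (∏ k, a₂ (f₀ k.1) (f₂ k)) * G (f₀, f₁, f₂) := by
  simp only [Fintype.sum_prod_type, bookWeight, Finset.mul_sum, mul_assoc]

lemma sum_bookWeight_swap (a₀ : A₀ → ℝ) (a₁ : A₀ → A₁ → ℝ) (a₂ : A₀ → A₂ → ℝ)
    (G : (κ → A₀) × (κ × l₁ → A₁) × (κ × l₂ → A₂) → ℝ) :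
    ∑ K, bookWeight a₀ a₁ a₂ K * G K =
      ∑ K : (κ → A₀) × (κ × l₂ → A₂) × (κ × l₁ → A₁),
        bookWeight a₀ a₂ a₁ K * G (K.1, K.2.2, K.2.1) := by
  simp only [Fintype.sum_prod_type, bookWeight]
  refine Finset.sum_congr rfl fun f₀ _ => ?_
  rw [Finset.sum_comm]
  exact Finset.sum_congr rfl fun _ _ => Finset.sum_congr rfl fun _ _ => by ring

lemma IsSuperposition.sum_bookWeight (h : IsSuperposition a₀ a₁ a₂) :
    ∑ K : (κ → A₀) × (κ × l₁ → A₁) × (κ × l₂ → A₂), bookWeight a₀ a₁ a₂ K = 1 := by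
  have := sum_bookWeight_mul (κ := κ) (l₁ := l₁) (l₂ := l₂) a₀ a₁ a₂ (fun _ => 1)
  simp only [mul_one] at this
  rw [this]
  have h2 : ∀ f₀ : κ → A₀, ∑ f : κ × l₂ → A₂, ∏ k, a₂ (f₀ k.1) (f k) = 1 := fun f₀ =>
    sum_pi_one (q := fun k : κ × l₂ => a₂ (f₀ k.1)) fun k => (h.priv₂ _).2
  have h1 : ∀ f₀ : κ → A₀, ∑ f : κ × l₁ → A₁, ∏ k, a₁ (f₀ k.1) (f k) = 1 := fun f₀ =>
    sum_pi_one (q := fun k : κ × l₁ => a₁ (f₀ k.1)) fun k => (h.priv₁ _).2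
  simp only [h2, h1, mul_one]
  exact sum_pi_one fun _ => h.common.2

/-! ### The joint law of two triples of codewords -/

/-- The law of one triple of codewords. -/
lemma IsSuperposition.mean_one (h : IsSuperposition a₀ a₁ a₂) (k : κ) (i : l₁) (j : l₂)
    (F : A₀ → A₁ → A₂ → ℝ) :
    ∑ K : (κ → A₀) × (κ × l₁ → A₁) × (κ × l₂ → A₂), bookWeight a₀ a₁ a₂ K *
      F (K.1 k) (K.2.1 (k, i)) (K.2.2 (k, j)) =
    ∑ u₀, a₀ u₀ * ∑ u₁, a₁ u₀ u₁ * ∑ u₂, a₂ u₀ u₂ * F u₀ u₁ u₂ := by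
  have e2 := fun (f₀ : κ → A₀) (u₁ : A₁) =>
    sum_pi_single (q := fun k : κ × l₂ => a₂ (f₀ k.1)) (fun k => (h.priv₂ _).2) (k, j)
      (fun u₂ => F (f₀ k) u₁ u₂)
  have e1 := fun (f₀ : κ → A₀) =>
    sum_pi_single (q := fun k : κ × l₁ => a₁ (f₀ k.1)) (fun k => (h.priv₁ _).2) (k, i)
      (fun u₁ => ∑ u₂, a₂ (f₀ k) u₂ * F (f₀ k) u₁ u₂)
  rw [sum_bookWeight_mul]
  simp only [e2, e1]
  exact sum_pi_single (q := fun _ : κ => a₀) (fun _ => h.common.2) k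
    (fun u₀ => ∑ u₁, a₁ u₀ u₁ * ∑ u₂, a₂ u₀ u₂ * F u₀ u₁ u₂)

lemma IsSuperposition.mean_common_ne (h : IsSuperposition a₀ a₁ a₂) {k k' : κ} (hk : k ≠ k')
    (i i' : l₁) (j j' : l₂) (F : A₀ → A₁ → A₂ → A₀ → A₁ → A₂ → ℝ) :
    ∑ K : (κ → A₀) × (κ × l₁ → A₁) × (κ × l₂ → A₂), bookWeight a₀ a₁ a₂ K *
      F (K.1 k) (K.2.1 (k, i)) (K.2.2 (k, j)) (K.1 k') (K.2.1 (k', i')) (K.2.2 (k', j')) =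
    ∑ u₀, a₀ u₀ * ∑ v₀, a₀ v₀ * ∑ u₁, a₁ u₀ u₁ * ∑ v₁, a₁ v₀ v₁ * ∑ u₂, a₂ u₀ u₂ *
      ∑ v₂, a₂ v₀ v₂ * F u₀ u₁ u₂ v₀ v₁ v₂ := by
  have e2 := fun (f₀ : κ → A₀) (u₁ v₁ : A₁) =>
    sum_pi_pair (q := fun k : κ × l₂ => a₂ (f₀ k.1)) (fun k => (h.priv₂ _).2)
      (i := (k, j)) (j := (k', j')) (by simp [hk])
      (fun u₂ v₂ => F (f₀ k) u₁ u₂ (f₀ k') v₁ v₂)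
  have e1 := fun (f₀ : κ → A₀) =>
    sum_pi_pair (q := fun k : κ × l₁ => a₁ (f₀ k.1)) (fun k => (h.priv₁ _).2)
      (i := (k, i)) (j := (k', i')) (by simp [hk])
      (fun u₁ v₁ => ∑ u₂, a₂ (f₀ k) u₂ * ∑ v₂, a₂ (f₀ k') v₂ * F (f₀ k) u₁ u₂ (f₀ k') v₁ v₂)
  rw [sum_bookWeight_mul]
  simp only [e2, e1]
  exact sum_pi_pair (q := fun _ : κ => a₀) (fun _ => h.common.2) hk
    (fun u₀ v₀ => ∑ u₁, a₁ u₀ u₁ * ∑ v₁, a₁ v₀ v₁ * ∑ u₂, a₂ u₀ u₂ *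
      ∑ v₂, a₂ v₀ v₂ * F u₀ u₁ u₂ v₀ v₁ v₂)

lemma IsSuperposition.mean_priv_ne (h : IsSuperposition a₀ a₁ a₂) (k : κ)
    {i i' : l₁} (hi : i ≠ i') {j j' : l₂} (hj : j ≠ j') (F : A₀ → A₁ → A₂ → A₁ → A₂ → ℝ) :
    ∑ K : (κ → A₀) × (κ × l₁ → A₁) × (κ × l₂ → A₂), bookWeight a₀ a₁ a₂ K *
      F (K.1 k) (K.2.1 (k, i)) (K.2.2 (k, j)) (K.2.1 (k, i')) (K.2.2 (k, j')) =
    ∑ u₀, a₀ u₀ * ∑ u₁, a₁ u₀ u₁ * ∑ v₁, a₁ u₀ v₁ * ∑ u₂, a₂ u₀ u₂ *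
      ∑ v₂, a₂ u₀ v₂ * F u₀ u₁ u₂ v₁ v₂ := by
  have e2 := fun (f₀ : κ → A₀) (u₁ v₁ : A₁) =>
    sum_pi_pair (q := fun k : κ × l₂ => a₂ (f₀ k.1)) (fun k => (h.priv₂ _).2)
      (i := (k, j)) (j := (k, j')) (by simp [hj]) (fun u₂ v₂ => F (f₀ k) u₁ u₂ v₁ v₂)
  have e1 := fun (f₀ : κ → A₀) =>
    sum_pi_pair (q := fun k : κ × l₁ => a₁ (f₀ k.1)) (fun k => (h.priv₁ _).2)
      (i := (k, i)) (j := (k, i')) (by simp [hi])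
      (fun u₁ v₁ => ∑ u₂, a₂ (f₀ k) u₂ * ∑ v₂, a₂ (f₀ k) v₂ * F (f₀ k) u₁ u₂ v₁ v₂)
  rw [sum_bookWeight_mul]
  simp only [e2, e1]
  exact sum_pi_single (q := fun _ : κ => a₀) (fun _ => h.common.2) k
    (fun u₀ => ∑ u₁, a₁ u₀ u₁ * ∑ v₁, a₁ u₀ v₁ * ∑ u₂, a₂ u₀ u₂ *
      ∑ v₂, a₂ u₀ v₂ * F u₀ u₁ u₂ v₁ v₂)

lemma IsSuperposition.mean_priv₂_ne (h : IsSuperposition a₀ a₁ a₂) (k : κ) (i : l₁)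
    {j j' : l₂} (hj : j ≠ j') (F : A₀ → A₁ → A₂ → A₂ → ℝ) :
    ∑ K : (κ → A₀) × (κ × l₁ → A₁) × (κ × l₂ → A₂), bookWeight a₀ a₁ a₂ K *
      F (K.1 k) (K.2.1 (k, i)) (K.2.2 (k, j)) (K.2.2 (k, j')) =
    ∑ u₀, a₀ u₀ * ∑ u₁, a₁ u₀ u₁ * ∑ u₂, a₂ u₀ u₂ * ∑ v₂, a₂ u₀ v₂ * F u₀ u₁ u₂ v₂ := by
  have e2 := fun (f₀ : κ → A₀) (u₁ : A₁) =>
    sum_pi_pair (q := fun k : κ × l₂ => a₂ (f₀ k.1)) (fun k => (h.priv₂ _).2)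
      (i := (k, j)) (j := (k, j')) (by simp [hj]) (fun u₂ v₂ => F (f₀ k) u₁ u₂ v₂)
  have e1 := fun (f₀ : κ → A₀) =>
    sum_pi_single (q := fun k : κ × l₁ => a₁ (f₀ k.1)) (fun k => (h.priv₁ _).2) (k, i)
      (fun u₁ => ∑ u₂, a₂ (f₀ k) u₂ * ∑ v₂, a₂ (f₀ k) v₂ * F (f₀ k) u₁ u₂ v₂)
  rw [sum_bookWeight_mul]
  simp only [e2, e1]
  exact sum_pi_single (q := fun _ : κ => a₀) (fun _ => h.common.2) k
    (fun u₀ => ∑ u₁, a₁ u₀ u₁ * ∑ u₂, a₂ u₀ u₂ * ∑ v₂, a₂ u₀ v₂ * F u₀ u₁ u₂ v₂)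

/-- The probability under the codebook law of the set of triples with indicator `t`. -/
def superProb (a₀ : A₀ → ℝ) (a₁ : A₀ → A₁ → ℝ) (a₂ : A₀ → A₂ → ℝ) (t : A₀ → A₁ → A₂ → ℝ) : ℝ :=
  ∑ u₀, a₀ u₀ * ∑ u₁, a₁ u₀ u₁ * ∑ u₂, a₂ u₀ u₂ * t u₀ u₁ u₂

lemma superProb_swap (a₀ : A₀ → ℝ) (a₁ : A₀ → A₁ → ℝ) (a₂ : A₀ → A₂ → ℝ)
    (t : A₀ → A₁ → A₂ → ℝ) :
    superProb a₀ a₂ a₁ (fun u₀ u₂ u₁ => t u₀ u₁ u₂) = superProb a₀ a₁ a₂ t := by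
  unfold superProb
  refine Finset.sum_congr rfl fun u₀ _ => ?_
  congr 1
  simp only [Finset.mul_sum]
  rw [Finset.sum_comm]
  exact Finset.sum_congr rfl fun _ _ => Finset.sum_congr rfl fun _ _ => by ring

lemma IsSuperposition.superProb_mono (h : IsSuperposition a₀ a₁ a₂) {t t' : A₀ → A₁ → A₂ → ℝ}
    (ht : ∀ u₀ u₁ u₂, t u₀ u₁ u₂ ≤ t' u₀ u₁ u₂) :
    superProb a₀ a₁ a₂ t ≤ superProb a₀ a₁ a₂ t' := by
  unfold superProb
  refine Finset.sum_le_sum fun u₀ _ => mul_le_mul_of_nonneg_left ?_ (h.common.1 _)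
  refine Finset.sum_le_sum fun u₁ _ => mul_le_mul_of_nonneg_left ?_ ((h.priv₁ _).1 _)
  exact Finset.sum_le_sum fun u₂ _ => mul_le_mul_of_nonneg_left (ht _ _ _) ((h.priv₂ _).1 _)

lemma superProb_mul_const (a₀ : A₀ → ℝ) (a₁ : A₀ → A₁ → ℝ) (a₂ : A₀ → A₂ → ℝ)
    (t : A₀ → A₁ → A₂ → ℝ) (m : ℝ) :
    superProb a₀ a₁ a₂ (fun u₀ u₁ u₂ => t u₀ u₁ u₂ * m) = superProb a₀ a₁ a₂ t * m := by
  simp only [superProb, ← mul_assoc, ← Finset.sum_mul]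

/-! ### Covering by the second moment method -/

/-- What the second moment method needs to know about a set of triples of codewords with indicator
`t`: its probability `p` and bounds on its conditional probabilities given the common codeword, or
given the common and one private codeword. -/
structure CoveringBounds (a₀ : A₀ → ℝ) (a₁ : A₀ → A₁ → ℝ) (a₂ : A₀ → A₂ → ℝ)
    (t : A₀ → A₁ → A₂ → ℝ) (p m₀ m₁ m₂ : ℝ) : Prop where
  zero_or_one : ∀ u₀ u₁ u₂, t u₀ u₁ u₂ = 0 ∨ t u₀ u₁ u₂ = 1
  prob_eq : superProb a₀ a₁ a₂ t = p
  prob_pos : 0 < p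
  given_common : ∀ u₀, ∑ u₁, a₁ u₀ u₁ * ∑ u₂, a₂ u₀ u₂ * t u₀ u₁ u₂ ≤ m₀
  given_pair₁ : ∀ u₀ u₁, ∑ u₂, a₂ u₀ u₂ * t u₀ u₁ u₂ ≤ m₁
  given_pair₂ : ∀ u₀ u₂, ∑ u₁, a₁ u₀ u₁ * t u₀ u₁ u₂ ≤ m₂

variable {t : A₀ → A₁ → A₂ → ℝ} {p m₀ m₁ m₂ : ℝ}

lemma CoveringBounds.nonneg (c : CoveringBounds a₀ a₁ a₂ t p m₀ m₁ m₂) (u₀ : A₀) (u₁ : A₁)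
    (u₂ : A₂) : 0 ≤ t u₀ u₁ u₂ := by
  rcases c.zero_or_one u₀ u₁ u₂ with h | h <;> simp [h]

lemma CoveringBounds.swap (c : CoveringBounds a₀ a₁ a₂ t p m₀ m₁ m₂) :
    CoveringBounds a₀ a₂ a₁ (fun u₀ u₂ u₁ => t u₀ u₁ u₂) p m₀ m₂ m₁ := by
  refine ⟨fun _ _ _ => c.zero_or_one _ _ _, by rw [superProb_swap, c.prob_eq], c.prob_pos,
    fun u₀ => ?_, fun _ _ => c.given_pair₂ _ _, fun _ _ => c.given_pair₁ _ _⟩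
  refine le_trans (le_of_eq ?_) (c.given_common u₀)
  simp only [Finset.mul_sum]
  rw [Finset.sum_comm]
  exact Finset.sum_congr rfl fun _ _ => Finset.sum_congr rfl fun _ _ => by ring

lemma CoveringBounds.mean_pair_priv₂_ne (c : CoveringBounds a₀ a₁ a₂ t p m₀ m₁ m₂)
    (h : IsSuperposition a₀ a₁ a₂) (k : κ) (i : l₁) {j j' : l₂} (hj : j ≠ j') :
    ∑ K : (κ → A₀) × (κ × l₁ → A₁) × (κ × l₂ → A₂), bookWeight a₀ a₁ a₂ K *
      (t (K.1 k) (K.2.1 (k, i)) (K.2.2 (k, j)) * t (K.1 k) (K.2.1 (k, i)) (K.2.2 (k, j'))) ≤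
      p * m₁ := by
  rw [h.mean_priv₂_ne k i hj (fun u₀ u₁ u₂ v₂ => t u₀ u₁ u₂ * t u₀ u₁ v₂), ← c.prob_eq,
    ← superProb_mul_const]
  refine h.superProb_mono (t := fun u₀ u₁ u₂ => ∑ v₂, a₂ u₀ v₂ * (t u₀ u₁ u₂ * t u₀ u₁ v₂))
    fun u₀ u₁ u₂ => ?_
  simp only [mul_left_comm _ (t u₀ u₁ u₂), ← Finset.mul_sum]
  exact mul_le_mul_of_nonneg_left (c.given_pair₁ u₀ u₁) (c.nonneg _ _ _)

/-- Two triples of codewords are positively correlated only through the codewords they share. -/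
lemma CoveringBounds.mean_pair_le (c : CoveringBounds a₀ a₁ a₂ t p m₀ m₁ m₂)
    (h : IsSuperposition a₀ a₁ a₂) (hm₀ : 0 ≤ m₀) (hm₁ : 0 ≤ m₁) (hm₂ : 0 ≤ m₂)
    (k k' : κ) (i i' : l₁) (j j' : l₂) :
    ∑ K : (κ → A₀) × (κ × l₁ → A₁) × (κ × l₂ → A₂), bookWeight a₀ a₁ a₂ K *
      (t (K.1 k) (K.2.1 (k, i)) (K.2.2 (k, j)) *
        t (K.1 k') (K.2.1 (k', i')) (K.2.2 (k', j'))) ≤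
      p * p + (if k = k' then p * m₀ else 0) + (if k = k' ∧ i = i' then p * m₁ else 0) +
        (if k = k' ∧ j = j' then p * m₂ else 0) +
        (if k = k' ∧ i = i' ∧ j = j' then p else 0) := by
  have hp := c.prob_pos.le
  by_cases hk : k = k'
  · subst hk
    by_cases hi : i = i'
    · subst hi
      by_cases hj : j = j'
      · subst hj
        have e := h.mean_one k i j (fun u₀ u₁ u₂ => t u₀ u₁ u₂ * t u₀ u₁ u₂)
        have e' : ∀ u₀ u₁ u₂, t u₀ u₁ u₂ * t u₀ u₁ u₂ = t u₀ u₁ u₂ := fun u₀ u₁ u₂ => by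
          rcases c.zero_or_one u₀ u₁ u₂ with h | h <;> simp [h]
        simp only [e'] at e ⊢
        rw [e]
        have := c.prob_eq
        unfold superProb at this
        rw [this]
        simp only [and_self, if_true]
        have := mul_nonneg hp hp
        have := mul_nonneg hp hm₀
        have := mul_nonneg hp hm₁
        have := mul_nonneg hp hm₂
        linarith
      · refine (c.mean_pair_priv₂_ne h k i hj).trans ?_
        simp only [and_self, if_true, hj, and_false, if_false]
        have := mul_nonneg hp hp
        have := mul_nonneg hp hm₀
        linarith
    · by_cases hj : j = j'
      · subst hj
        rw [sum_bookWeight_swap]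
        refine (c.swap.mean_pair_priv₂_ne h.swap k j hi).trans ?_
        simp only [and_self, if_true, hi, and_false, false_and, if_false]
        have := mul_nonneg hp hp
        have := mul_nonneg hp hm₀
        linarith
      · rw [h.mean_priv_ne k hi hj (fun u₀ u₁ u₂ v₁ v₂ => t u₀ u₁ u₂ * t u₀ v₁ v₂)]
        have key : ∑ u₀, a₀ u₀ * ∑ u₁, a₁ u₀ u₁ * ∑ v₁, a₁ u₀ v₁ * ∑ u₂, a₂ u₀ u₂ *
            ∑ v₂, a₂ u₀ v₂ * (t u₀ u₁ u₂ * t u₀ v₁ v₂) =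
            superProb a₀ a₁ a₂ (fun u₀ u₁ u₂ => t u₀ u₁ u₂ *
              ∑ v₁, a₁ u₀ v₁ * ∑ v₂, a₂ u₀ v₂ * t u₀ v₁ v₂) := by
          unfold superProb
          refine Finset.sum_congr rfl fun u₀ _ => ?_
          congr 1
          refine Finset.sum_congr rfl fun u₁ _ => ?_
          congr 1
          simp only [Finset.mul_sum]
          rw [Finset.sum_comm]
          refine Finset.sum_congr rfl fun u₂ _ => Finset.sum_congr rfl fun v₁ _ =>
            Finset.sum_congr rfl fun v₂ _ => by ring
        rw [key]
        simp only [if_true, hi, hj, and_false, if_false, and_self]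
        have h1 : superProb a₀ a₁ a₂ (fun u₀ u₁ u₂ => t u₀ u₁ u₂ *
            ∑ v₁, a₁ u₀ v₁ * ∑ v₂, a₂ u₀ v₂ * t u₀ v₁ v₂) ≤ p * m₀ := by
          rw [← c.prob_eq, ← superProb_mul_const]
          exact h.superProb_mono fun u₀ u₁ u₂ =>
            mul_le_mul_of_nonneg_left (c.given_common u₀) (c.nonneg _ _ _)
        have := mul_nonneg hp hp
        linarith
  · rw [h.mean_common_ne hk i i' j j' (fun u₀ u₁ u₂ v₀ v₁ v₂ => t u₀ u₁ u₂ * t v₀ v₁ v₂)]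
    simp only [hk, false_and, if_false, add_zero]
    rw [← c.prob_eq]
    simp only [sum_mul_sum_mul_mul, superProb, le_refl]

open Classical in
/-- The covering lemma: among the triples with bin indices in `b₀ × b₁ × b₂`, some triple lies in
the set `t`, except with the probability that Chebyshev's inequality gives. -/
lemma CoveringBounds.prob_no_hit_le (c : CoveringBounds a₀ a₁ a₂ t p m₀ m₁ m₂)
    (h : IsSuperposition a₀ a₁ a₂) (hm₀ : 0 ≤ m₀) (hm₁ : 0 ≤ m₁) (hm₂ : 0 ≤ m₂)
    {b₀ b₁ b₂ : Type*} [Fintype b₀] [Fintype b₁] [Fintype b₂] [Nonempty b₀] [Nonempty b₁]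
    [Nonempty b₂] {e₀ : b₀ → κ} {e₁ : b₁ → l₁} {e₂ : b₂ → l₂} (he₀ : Function.Injective e₀)
    (he₁ : Function.Injective e₁) (he₂ : Function.Injective e₂) :
    ∑ K : (κ → A₀) × (κ × l₁ → A₁) × (κ × l₂ → A₂), bookWeight a₀ a₁ a₂ K *
      (if ∃ b : b₀ × b₁ × b₂, t (K.1 (e₀ b.1)) (K.2.1 (e₀ b.1, e₁ b.2.1))
        (K.2.2 (e₀ b.1, e₂ b.2.2)) = 1 then 0 else 1) ≤
      m₀ / (Fintype.card b₀ * p) + m₁ / (Fintype.card b₀ * Fintype.card b₁ * p) +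
        m₂ / (Fintype.card b₀ * Fintype.card b₂ * p) +
        1 / (Fintype.card b₀ * Fintype.card b₁ * Fintype.card b₂ * p) := by
  set τ : (b₀ × b₁ × b₂) → ((κ → A₀) × (κ × l₁ → A₁) × (κ × l₂ → A₂)) → ℝ := fun b K =>
    t (K.1 (e₀ b.1)) (K.2.1 (e₀ b.1, e₁ b.2.1)) (K.2.2 (e₀ b.1, e₂ b.2.2)) with hτ
  have hp := c.prob_pos
  have hB₀ : (0 : ℝ) < Fintype.card b₀ := by exact_mod_cast Fintype.card_pos
  have hB₁ : (0 : ℝ) < Fintype.card b₁ := by exact_mod_cast Fintype.card_pos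
  have hB₂ : (0 : ℝ) < Fintype.card b₂ := by exact_mod_cast Fintype.card_pos
  set B₀ : ℝ := (Fintype.card b₀ : ℝ)
  set B₁ : ℝ := (Fintype.card b₁ : ℝ)
  set B₂ : ℝ := (Fintype.card b₂ : ℝ)
  set μ := B₀ * B₁ * B₂ * p with hμ
  have hμ0 : 0 < μ := by positivity
  have hmean : ∀ b, ∑ K, bookWeight a₀ a₁ a₂ K * τ b K = p := by
    intro b
    rw [← c.prob_eq]
    exact h.mean_one _ _ _ t
  have hN1 : ∑ K, bookWeight a₀ a₁ a₂ K * (∑ b, τ b K) = μ := by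
    simp only [Finset.mul_sum]
    rw [Finset.sum_comm]
    simp only [hmean, Finset.sum_const, Finset.card_univ, Fintype.card_prod, nsmul_eq_mul,
      Nat.cast_mul, hμ, B₀, B₁, B₂]
    ring
  have s0 : ∀ (b : b₀ × b₁ × b₂) (x : ℝ),
      ∑ b' : b₀ × b₁ × b₂, (if b.1 = b'.1 then x else 0) = B₁ * B₂ * x := by
    intro b x
    rw [Fintype.sum_prod_type, Finset.sum_comm]
    simp [B₁, B₂]
  have s1 : ∀ (b : b₀ × b₁ × b₂) (x : ℝ),
      ∑ b' : b₀ × b₁ × b₂, (if b.1 = b'.1 ∧ b.2.1 = b'.2.1 then x else 0) = B₂ * x := by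
    intro b x
    simp only [Fintype.sum_prod_type, ite_and, Finset.sum_ite_irrel, Finset.sum_const_zero,
      Finset.sum_ite_eq, Finset.mem_univ, if_true]
    rw [Finset.sum_comm]
    simp [B₂]
  have s2 : ∀ (b : b₀ × b₁ × b₂) (x : ℝ),
      ∑ b' : b₀ × b₁ × b₂, (if b.1 = b'.1 ∧ b.2.2 = b'.2.2 then x else 0) = B₁ * x := by
    intro b x
    simp only [Fintype.sum_prod_type, ite_and]
    simp [B₁]
  have s3 : ∀ (b : b₀ × b₁ × b₂) (x : ℝ),
      ∑ b' : b₀ × b₁ × b₂, (if b.1 = b'.1 ∧ b.2.1 = b'.2.1 ∧ b.2.2 = b'.2.2 then x else 0) =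
        x := by
    intro b x
    simp only [Fintype.sum_prod_type, ite_and]
    simp
  have hN2 : ∑ K, bookWeight a₀ a₁ a₂ K * ((∑ b, τ b K) * (∑ b, τ b K)) ≤
      μ * μ + (B₀ * B₁ * B₁ * B₂ * B₂ * (p * m₀) + B₀ * B₁ * B₂ * B₂ * (p * m₁) +
        B₀ * B₁ * B₁ * B₂ * (p * m₂) + B₀ * B₁ * B₂ * p) := by
    have : ∀ K, bookWeight a₀ a₁ a₂ K * ((∑ b, τ b K) * (∑ b, τ b K)) =
        ∑ b, ∑ b', bookWeight a₀ a₁ a₂ K * (τ b K * τ b' K) := by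
      intro K
      rw [Finset.sum_mul_sum, Finset.mul_sum]
      simp only [Finset.mul_sum]
    simp only [this]
    rw [Finset.sum_comm]
    calc ∑ b, ∑ K, ∑ b', bookWeight a₀ a₁ a₂ K * (τ b K * τ b' K)
        = ∑ b, ∑ b', ∑ K, bookWeight a₀ a₁ a₂ K * (τ b K * τ b' K) :=
          Finset.sum_congr rfl fun _ _ => Finset.sum_comm
      _ ≤ ∑ b : b₀ × b₁ × b₂, ∑ b' : b₀ × b₁ × b₂, (p * p +
            (if b.1 = b'.1 then p * m₀ else 0) +
            (if b.1 = b'.1 ∧ b.2.1 = b'.2.1 then p * m₁ else 0) +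
            (if b.1 = b'.1 ∧ b.2.2 = b'.2.2 then p * m₂ else 0) +
            (if b.1 = b'.1 ∧ b.2.1 = b'.2.1 ∧ b.2.2 = b'.2.2 then p else 0)) := by
          refine Finset.sum_le_sum fun b _ => Finset.sum_le_sum fun b' _ => ?_
          have := c.mean_pair_le h hm₀ hm₁ hm₂ (e₀ b.1) (e₀ b'.1) (e₁ b.2.1) (e₁ b'.2.1)
            (e₂ b.2.2) (e₂ b'.2.2)
          simpa only [he₀.eq_iff, he₁.eq_iff, he₂.eq_iff] using this
      _ = _ := by
          simp only [Finset.sum_add_distrib, s0, s1, s2, s3, Finset.sum_const, Finset.card_univ,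
            Fintype.card_prod, nsmul_eq_mul, Nat.cast_mul, hμ, B₀, B₁, B₂]
          ring
  have hcheb : ∀ K, (if ∃ b, τ b K = 1 then (0 : ℝ) else 1) ≤
      ((∑ b, τ b K) * (∑ b, τ b K) - 2 * μ * (∑ b, τ b K) + μ * μ) / (μ * μ) := by
    intro K
    have hsq : 0 ≤ (∑ b, τ b K) * (∑ b, τ b K) - 2 * μ * (∑ b, τ b K) + μ * μ := by
      nlinarith [sq_nonneg ((∑ b, τ b K) - μ)]
    split_ifs with hb
    · positivity
    · push Not at hb
      have : ∑ b, τ b K = 0 := Finset.sum_eq_zero fun b _ =>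
        (c.zero_or_one _ _ _).resolve_right (hb b)
      rw [this]
      simp [hμ0.ne']
  have hw := h.bookWeight_nonneg (κ := κ) (l₁ := l₁) (l₂ := l₂)
  calc _ ≤ ∑ K, bookWeight a₀ a₁ a₂ K *
        (((∑ b, τ b K) * (∑ b, τ b K) - 2 * μ * (∑ b, τ b K) + μ * μ) / (μ * μ)) :=
        Finset.sum_le_sum fun K _ => mul_le_mul_of_nonneg_left (hcheb K) (hw K)
    _ = (∑ K, bookWeight a₀ a₁ a₂ K * ((∑ b, τ b K) * (∑ b, τ b K)) - μ * μ) / (μ * μ) := by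
        simp only [mul_div_assoc', ← Finset.sum_div]
        congr 1
        have e : ∀ K, bookWeight a₀ a₁ a₂ K *
            ((∑ b, τ b K) * (∑ b, τ b K) - 2 * μ * (∑ b, τ b K) + μ * μ) =
            bookWeight a₀ a₁ a₂ K * ((∑ b, τ b K) * (∑ b, τ b K)) -
            2 * μ * (bookWeight a₀ a₁ a₂ K * (∑ b, τ b K)) + bookWeight a₀ a₁ a₂ K * (μ * μ) :=
          fun K => by ring
        simp only [e, Finset.sum_add_distrib, Finset.sum_sub_distrib, ← Finset.mul_sum, hN1,
          ← Finset.sum_mul, h.sum_bookWeight]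
        ring
    _ ≤ (B₀ * B₁ * B₁ * B₂ * B₂ * (p * m₀) + B₀ * B₁ * B₂ * B₂ * (p * m₁) +
        B₀ * B₁ * B₁ * B₂ * (p * m₂) + B₀ * B₁ * B₂ * p) / (μ * μ) := by
        gcongr
        linarith
    _ = _ := by
        rw [hμ]
        field_simp

/-! ### Packing by the union bound over all bin indices -/

/-- The probability that a triple in the set `t` is sent and that a wrong pair of codewords of
receiver 1 looks like the output. The bounds `gF`, `gP` are on the probability of such a
coincidence for a fresh pair of codewords, and for a fresh private codeword. -/
lemma IsSuperposition.mean_coincidence_le (h : IsSuperposition a₀ a₁ a₂)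
    (ht : ∀ u₀ u₁ u₂, 0 ≤ t u₀ u₁ u₂) {Y Y' : Type*} [Fintype Y]
    {w : A₀ → A₁ → A₂ → Y → ℝ} (hw : ∀ u₀ u₁ u₂, w u₀ u₁ u₂ ∈ stdSimplex ℝ Y) (π : Y → Y')
    {g : A₀ → A₁ → Y' → ℝ} {gF gP : ℝ} (hgF : ∀ y, ∑ u₀, a₀ u₀ * ∑ u₁, a₁ u₀ u₁ * g u₀ u₁ y ≤ gF)
    (hgP : ∀ u₀ y, ∑ u₁, a₁ u₀ u₁ * g u₀ u₁ y ≤ gP) (k k' : κ) (i i' : l₁) (j : l₂)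
    (hne : k = k' → i ≠ i') :
    ∑ K : (κ → A₀) × (κ × l₁ → A₁) × (κ × l₂ → A₂), bookWeight a₀ a₁ a₂ K *
      (t (K.1 k) (K.2.1 (k, i)) (K.2.2 (k, j)) *
        ∑ y, w (K.1 k) (K.2.1 (k, i)) (K.2.2 (k, j)) y * g (K.1 k') (K.2.1 (k', i')) (π y)) ≤
      superProb a₀ a₁ a₂ t * (if k = k' then gP else gF) := by
  by_cases hk : k = k'
  · subst hk
    rw [if_pos rfl, ← superProb_mul_const, sum_bookWeight_swap]
    refine (h.swap.mean_priv₂_ne k j (hne rfl) (fun u₀ u₂ u₁ v₁ => t u₀ u₁ u₂ *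
      ∑ y, w u₀ u₁ u₂ y * g u₀ v₁ (π y))).le.trans ?_
    rw [← superProb_swap]
    refine h.swap.superProb_mono (t := fun u₀ u₂ u₁ => ∑ v₁, a₁ u₀ v₁ * (t u₀ u₁ u₂ *
      ∑ y, w u₀ u₁ u₂ y * g u₀ v₁ (π y))) fun u₀ u₂ u₁ => ?_
    simp only [mul_left_comm _ (t u₀ u₁ u₂), ← Finset.mul_sum]
    refine mul_le_mul_of_nonneg_left ?_ (ht _ _ _)
    simp only [Finset.mul_sum]
    rw [Finset.sum_comm]
    simp only [mul_left_comm _ (w u₀ u₁ u₂ _), ← Finset.mul_sum]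
    calc ∑ y, w u₀ u₁ u₂ y * ∑ v₁, a₁ u₀ v₁ * g u₀ v₁ (π y) ≤ ∑ y, w u₀ u₁ u₂ y * gP :=
          Finset.sum_le_sum fun y _ => mul_le_mul_of_nonneg_left (hgP _ _) ((hw _ _ _).1 y)
      _ = gP := by rw [← Finset.sum_mul, (hw _ _ _).2, one_mul]
  · rw [if_neg hk, ← superProb_mul_const]
    rw [h.mean_common_ne hk i i' j j (fun u₀ u₁ u₂ v₀ v₁ _ => t u₀ u₁ u₂ *
      ∑ y, w u₀ u₁ u₂ y * g v₀ v₁ (π y))]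
    simp only [← Finset.sum_mul, (h.priv₂ _).2, one_mul]
    have key : ∑ u₀, a₀ u₀ * ∑ v₀, a₀ v₀ * ∑ u₁, a₁ u₀ u₁ * ∑ v₁, a₁ v₀ v₁ * ∑ u₂, a₂ u₀ u₂ *
        (t u₀ u₁ u₂ * ∑ y, w u₀ u₁ u₂ y * g v₀ v₁ (π y)) =
        superProb a₀ a₁ a₂ (fun u₀ u₁ u₂ => t u₀ u₁ u₂ * ∑ y, w u₀ u₁ u₂ y *
          ∑ v₀, a₀ v₀ * ∑ v₁, a₁ v₀ v₁ * g v₀ v₁ (π y)) := by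
      unfold superProb
      refine Finset.sum_congr rfl fun u₀ _ => ?_
      congr 1
      simp only [Finset.mul_sum]
      rw [Finset.sum_comm]
      refine Finset.sum_congr rfl fun u₁ _ => ?_
      have e1 : ∀ v₀, ∑ v₁, ∑ u₂, ∑ y, a₀ v₀ * (a₁ u₀ u₁ * (a₁ v₀ v₁ * (a₂ u₀ u₂ *
          (t u₀ u₁ u₂ * (w u₀ u₁ u₂ y * g v₀ v₁ (π y)))))) = ∑ u₂, ∑ v₁, ∑ y, a₀ v₀ * (a₁ u₀ u₁ *
          (a₁ v₀ v₁ * (a₂ u₀ u₂ * (t u₀ u₁ u₂ * (w u₀ u₁ u₂ y * g v₀ v₁ (π y)))))) :=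
        fun v₀ => Finset.sum_comm
      simp only [e1]
      rw [Finset.sum_comm]
      refine Finset.sum_congr rfl fun u₂ _ => ?_
      have e2 : ∀ v₀, ∑ v₁, ∑ y, a₀ v₀ * (a₁ u₀ u₁ * (a₁ v₀ v₁ * (a₂ u₀ u₂ *
          (t u₀ u₁ u₂ * (w u₀ u₁ u₂ y * g v₀ v₁ (π y)))))) = ∑ y, ∑ v₁, a₀ v₀ * (a₁ u₀ u₁ *
          (a₁ v₀ v₁ * (a₂ u₀ u₂ * (t u₀ u₁ u₂ * (w u₀ u₁ u₂ y * g v₀ v₁ (π y)))))) :=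
        fun v₀ => Finset.sum_comm
      simp only [e2]
      rw [Finset.sum_comm]
      exact Finset.sum_congr rfl fun _ _ => Finset.sum_congr rfl fun _ _ =>
        Finset.sum_congr rfl fun _ _ => by ring
    rw [key]
    refine h.superProb_mono fun u₀ u₁ u₂ => mul_le_mul_of_nonneg_left ?_ (ht _ _ _)
    calc _ ≤ ∑ y, w u₀ u₁ u₂ y * gF :=
          Finset.sum_le_sum fun y _ => mul_le_mul_of_nonneg_left (hgF _) ((hw _ _ _).1 y)
      _ = gF := by rw [← Finset.sum_mul, (hw _ _ _).2, one_mul]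

end OneShot

/-! ### The one-shot scheme -/

section Scheme

open Classical in
/-- Some element of the set `S`, if there is one. -/
def pick {α : Type*} [Nonempty α] (S : α → Prop) : α :=
  if h : ∃ a, S a then h.choose else Classical.arbitrary α

lemma pick_spec {α : Type*} [Nonempty α] {S : α → Prop} (h : ∃ a, S a) : S (pick S) := by
  unfold pick
  rw [dif_pos h]
  exact h.choose_spec

lemma pick_eq_of_unique {α : Type*} [Nonempty α] {S : α → Prop} {a : α} (h : S a)
    (hu : ∀ b, S b → b = a) : pick S = a :=
  hu _ (pick_spec ⟨a, h⟩)

/-- The number of wrong message pairs enters as `M₀ M₁ - 1` and `M₁ - 1`, so that a message set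
with a single element costs nothing. -/
lemma sum_wrong_le {μ₀ μ₁ β₀ β₁ : Type*} [Fintype μ₀] [Fintype μ₁] [Fintype β₀] [Fintype β₁]
    [DecidableEq μ₀] [DecidableEq μ₁] [DecidableEq β₀] (w : μ₀ × μ₁) (b : β₀) (gP : ℝ)
    {gF : ℝ} (hF : 0 ≤ gF) :
    ∑ x : (μ₀ × μ₁) × (β₀ × β₁),
      (if x.1 = w then 0 else if (w.1, b) = (x.1.1, x.2.1) then gP else gF) ≤
    ((Fintype.card μ₀ : ℝ) * Fintype.card μ₁ - 1) * (Fintype.card β₀ * Fintype.card β₁) * gF +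
      ((Fintype.card μ₁ : ℝ) - 1) * Fintype.card β₁ * gP := by
  have h1 : ∀ x : (μ₀ × μ₁) × (β₀ × β₁),
      (if x.1 = w then 0 else if (w.1, b) = (x.1.1, x.2.1) then gP else gF) ≤
      (gF - if x.1 = w then gF else 0) +
      (if x.2.1 = b then if x.1.1 = w.1 then (gP - if x.1.2 = w.2 then gP else 0)
        else 0 else 0) := by
    rintro ⟨⟨x0, x1⟩, y0, y1⟩
    obtain ⟨w0, w1⟩ := w
    by_cases a : x0 = w0 <;> by_cases a' : x1 = w1 <;> by_cases a'' : y0 = b <;>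
      simp [a, a', a'', eq_comm (a := w0), eq_comm (a := b), hF]
  have h2 : ∑ x : (μ₀ × μ₁) × (β₀ × β₁), (if x.1 = w then gF else 0) =
      Fintype.card β₀ * Fintype.card β₁ * gF := by
    rw [Fintype.sum_prod_type_right]
    simp
  have h3 : ∀ z : μ₀ × μ₁, ∑ y : β₀ × β₁, (if y.1 = b then
      if z.1 = w.1 then (gP - if z.2 = w.2 then gP else 0) else 0 else 0) =
      Fintype.card β₁ * if z.1 = w.1 then (gP - if z.2 = w.2 then gP else 0) else 0 := by
    intro z
    generalize (if z.1 = w.1 then (gP - if z.2 = w.2 then gP else 0) else 0) = r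
    rw [Fintype.sum_prod_type_right]
    simp
  refine (Finset.sum_le_sum fun x _ => h1 x).trans (le_of_eq ?_)
  rw [Finset.sum_add_distrib, Finset.sum_sub_distrib, h2]
  congr 1
  · simp
    ring
  · rw [Fintype.sum_prod_type]
    simp only [h3, ← Finset.mul_sum]
    rw [Fintype.sum_prod_type_right]
    simp
    ring

variable {μ₀ μ₁ μ₂ β₀ β₁ β₂ A₀ A₁ A₂ Y Y₁ Y₂ : Type*} [Fintype μ₀] [Fintype μ₁] [Fintype μ₂]
  [Fintype β₀] [Fintype β₁] [Fintype β₂] [Nonempty μ₀] [Nonempty μ₁] [Nonempty μ₂]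
  [Nonempty β₀] [Nonempty β₁] [Nonempty β₂] [DecidableEq μ₀] [DecidableEq μ₁] [DecidableEq μ₂]
  [DecidableEq β₀] [DecidableEq β₁] [DecidableEq β₂]
  [Fintype A₀] [Fintype A₁] [Fintype A₂] [Fintype Y]

open Classical in
/-- Superposition coding with joint binning, for an abstract channel `w` from triples of codewords
to outputs. The encoder picks a triple of bin indices whose codewords lie in `T`, and each
receiver picks a message pair one of whose codeword pairs is consistent with the output. The
packing terms are a union bound over *all* triples of bin indices, which sidesteps the
dependence between the choice of the encoder and the codewords that were not chosen; the price is
the expected number of triples in `T`. -/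
theorem exists_scheme {a₀ : A₀ → ℝ} {a₁ : A₀ → A₁ → ℝ} {a₂ : A₀ → A₂ → ℝ}
    (h : IsSuperposition a₀ a₁ a₂) {T : A₀ → A₁ → A₂ → Prop} {p m₀ m₁ m₂ : ℝ}
    (c : CoveringBounds a₀ a₁ a₂ (fun u₀ u₁ u₂ => if T u₀ u₁ u₂ then 1 else 0) p m₀ m₁ m₂)
    (hm₀ : 0 ≤ m₀) (hm₁ : 0 ≤ m₁) (hm₂ : 0 ≤ m₂)
    {w : A₀ → A₁ → A₂ → Y → ℝ} (hw : ∀ u₀ u₁ u₂, w u₀ u₁ u₂ ∈ stdSimplex ℝ Y)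
    (π₁ : Y → Y₁) (π₂ : Y → Y₂) {G₁ : A₀ → A₁ → Y₁ → Prop} {G₂ : A₀ → A₂ → Y₂ → Prop}
    {η F₁ P₁ F₂ P₂ : ℝ} (hη₀ : 0 ≤ η) (hF₁₀ : 0 ≤ F₁) (hF₂₀ : 0 ≤ F₂)
    (hη : ∀ u₀ u₁ u₂, T u₀ u₁ u₂ → ∑ y, w u₀ u₁ u₂ y *
      (if G₁ u₀ u₁ (π₁ y) ∧ G₂ u₀ u₂ (π₂ y) then 0 else 1) ≤ η)
    (hF₁ : ∀ y, ∑ u₀, a₀ u₀ * ∑ u₁, a₁ u₀ u₁ * (if G₁ u₀ u₁ y then 1 else 0) ≤ F₁)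
    (hP₁ : ∀ u₀ y, ∑ u₁, a₁ u₀ u₁ * (if G₁ u₀ u₁ y then 1 else 0) ≤ P₁)
    (hF₂ : ∀ y, ∑ u₀, a₀ u₀ * ∑ u₂, a₂ u₀ u₂ * (if G₂ u₀ u₂ y then 1 else 0) ≤ F₂)
    (hP₂ : ∀ u₀ y, ∑ u₂, a₂ u₀ u₂ * (if G₂ u₀ u₂ y then 1 else 0) ≤ P₂) :
    ∃ (bins : (μ₀ × β₀ → A₀) × ((μ₀ × β₀) × (μ₁ × β₁) → A₁) × ((μ₀ × β₀) × (μ₂ × β₂) → A₂) →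
        μ₀ × μ₁ × μ₂ → β₀ × β₁ × β₂)
      (dec₁ : (μ₀ × β₀ → A₀) × ((μ₀ × β₀) × (μ₁ × β₁) → A₁) × ((μ₀ × β₀) × (μ₂ × β₂) → A₂) →
        Y₁ → μ₀ × μ₁)
      (dec₂ : (μ₀ × β₀ → A₀) × ((μ₀ × β₀) × (μ₁ × β₁) → A₁) × ((μ₀ × β₀) × (μ₂ × β₂) → A₂) →
        Y₂ → μ₀ × μ₂),
      ∀ v : μ₀ × μ₁ × μ₂,
        ∑ K, bookWeight a₀ a₁ a₂ K *
          (if T (K.1 (v.1, (bins K v).1)) (K.2.1 ((v.1, (bins K v).1), (v.2.1, (bins K v).2.1)))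
            (K.2.2 ((v.1, (bins K v).1), (v.2.2, (bins K v).2.2))) then 0 else 1) ≤
          m₀ / (Fintype.card β₀ * p) + m₁ / (Fintype.card β₀ * Fintype.card β₁ * p) +
            m₂ / (Fintype.card β₀ * Fintype.card β₂ * p) +
            1 / (Fintype.card β₀ * Fintype.card β₁ * Fintype.card β₂ * p) ∧
        ∑ K, bookWeight a₀ a₁ a₂ K * ∑ y,
          w (K.1 (v.1, (bins K v).1)) (K.2.1 ((v.1, (bins K v).1), (v.2.1, (bins K v).2.1)))
            (K.2.2 ((v.1, (bins K v).1), (v.2.2, (bins K v).2.2))) y *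
          (if dec₁ K (π₁ y) = (v.1, v.2.1) ∧ dec₂ K (π₂ y) = (v.1, v.2.2) then 0 else 1) ≤
          m₀ / (Fintype.card β₀ * p) + m₁ / (Fintype.card β₀ * Fintype.card β₁ * p) +
            m₂ / (Fintype.card β₀ * Fintype.card β₂ * p) +
            1 / (Fintype.card β₀ * Fintype.card β₁ * Fintype.card β₂ * p) + η +
          Fintype.card β₀ * Fintype.card β₁ * Fintype.card β₂ * p *
            ((((Fintype.card μ₀ : ℝ) * Fintype.card μ₁ - 1) *
                (Fintype.card β₀ * Fintype.card β₁) * F₁ +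
              ((Fintype.card μ₁ : ℝ) - 1) * Fintype.card β₁ * P₁) +
            (((Fintype.card μ₀ : ℝ) * Fintype.card μ₂ - 1) *
                (Fintype.card β₀ * Fintype.card β₂) * F₂ +
              ((Fintype.card μ₂ : ℝ) - 1) * Fintype.card β₂ * P₂)) := by
  let Book := (μ₀ × β₀ → A₀) × ((μ₀ × β₀) × (μ₁ × β₁) → A₁) × ((μ₀ × β₀) × (μ₂ × β₂) → A₂)
  let hit : Book → μ₀ × μ₁ × μ₂ → β₀ × β₁ × β₂ → Prop := fun K v b =>
    T (K.1 (v.1, b.1)) (K.2.1 ((v.1, b.1), (v.2.1, b.2.1))) (K.2.2 ((v.1, b.1), (v.2.2, b.2.2)))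
  let S₁ : Book → Y₁ → μ₀ × μ₁ → Prop := fun K y m =>
    ∃ b : β₀ × β₁, G₁ (K.1 (m.1, b.1)) (K.2.1 ((m.1, b.1), (m.2, b.2))) y
  let S₂ : Book → Y₂ → μ₀ × μ₂ → Prop := fun K y m =>
    ∃ b : β₀ × β₂, G₂ (K.1 (m.1, b.1)) (K.2.2 ((m.1, b.1), (m.2, b.2))) y
  refine ⟨fun K v => pick (hit K v), fun K y => pick (S₁ K y), fun K y => pick (S₂ K y),
    fun v => ?_⟩
  have hbw : ∀ K : Book, 0 ≤ bookWeight a₀ a₁ a₂ K := h.bookWeight_nonneg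
  have hcov : ∑ K : Book, bookWeight a₀ a₁ a₂ K * (if ∃ b, hit K v b then 0 else 1) ≤
      m₀ / (Fintype.card β₀ * p) + m₁ / (Fintype.card β₀ * Fintype.card β₁ * p) +
        m₂ / (Fintype.card β₀ * Fintype.card β₂ * p) +
        1 / (Fintype.card β₀ * Fintype.card β₁ * Fintype.card β₂ * p) := by
    have := c.prob_no_hit_le h hm₀ hm₁ hm₂ (e₀ := fun b : β₀ => (v.1, b))
      (e₁ := fun b : β₁ => (v.2.1, b)) (e₂ := fun b : β₂ => (v.2.2, b))
      (Prod.mk_right_injective _) (Prod.mk_right_injective _) (Prod.mk_right_injective _)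
    simpa only [ite_eq_left_iff, zero_ne_one, imp_false, not_not] using this
  constructor
  · refine le_trans (Finset.sum_le_sum fun K _ => mul_le_mul_of_nonneg_left ?_ (hbw K)) hcov
    by_cases hb : ∃ b, hit K v b
    · have : hit K v (pick (hit K v)) := pick_spec hb
      dsimp only [hit] at this hb ⊢
      rw [if_pos this, if_pos hb]
    · rw [if_neg hb]
      split_ifs <;> simp
  · -- `E₁ K b y` and `E₂ K b y` count the wrong codeword pairs consistent with the output.
    let E₁ : Book → Y → ℝ := fun K y => ∑ x : (μ₀ × μ₁) × (β₀ × β₁), if x.1 = (v.1, v.2.1) then 0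
      else if G₁ (K.1 (x.1.1, x.2.1)) (K.2.1 ((x.1.1, x.2.1), (x.1.2, x.2.2))) (π₁ y) then 1 else 0
    let E₂ : Book → Y → ℝ := fun K y => ∑ x : (μ₀ × μ₂) × (β₀ × β₂), if x.1 = (v.1, v.2.2) then 0
      else if G₂ (K.1 (x.1.1, x.2.1)) (K.2.2 ((x.1.1, x.2.1), (x.1.2, x.2.2))) (π₂ y) then 1 else 0
    have hE₁ : ∀ K y, 0 ≤ E₁ K y := fun K y => Finset.sum_nonneg fun x _ => by split_ifs <;> simp
    have hE₂ : ∀ K y, 0 ≤ E₂ K y := fun K y => Finset.sum_nonneg fun x _ => by split_ifs <;> simp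
    let ch : Book → β₀ × β₁ × β₂ → Y → ℝ := fun K b => w (K.1 (v.1, b.1))
      (K.2.1 ((v.1, b.1), (v.2.1, b.2.1))) (K.2.2 ((v.1, b.1), (v.2.2, b.2.2)))
    have hch : ∀ K b y, 0 ≤ ch K b y := fun K b y => (hw _ _ _).1 y
    have hpoint : ∀ K : Book, ∑ y, ch K (pick (hit K v)) y *
        (if pick (S₁ K (π₁ y)) = (v.1, v.2.1) ∧ pick (S₂ K (π₂ y)) = (v.1, v.2.2) then 0 else 1) ≤
        (if ∃ b, hit K v b then 0 else 1) + η +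
          ∑ b, (if hit K v b then 1 else 0) * ∑ y, ch K b y * (E₁ K y + E₂ K y) := by
      intro K
      have hpos : ∀ b, 0 ≤ (if hit K v b then (1 : ℝ) else 0) *
          ∑ y, ch K b y * (E₁ K y + E₂ K y) := fun b => mul_nonneg (by split_ifs <;> simp)
        (Finset.sum_nonneg fun y _ => mul_nonneg (hch _ _ _) (add_nonneg (hE₁ _ _) (hE₂ _ _)))
      by_cases hb : ∃ b, hit K v b
      · have hbT : hit K v (pick (hit K v)) := pick_spec hb
        set b := pick (hit K v)
        rw [if_pos hb, zero_add]
        have h1 : ∑ y, ch K b y * (E₁ K y + E₂ K y) ≤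
            ∑ b, (if hit K v b then (1 : ℝ) else 0) * ∑ y, ch K b y * (E₁ K y + E₂ K y) := by
          refine le_trans (le_of_eq ?_) (Finset.single_le_sum (fun b _ => hpos b)
            (Finset.mem_univ b))
          simp [hbT]
        refine le_trans ?_ (add_le_add (hη _ _ _ hbT) h1)
        rw [← Finset.sum_add_distrib]
        refine Finset.sum_le_sum fun y _ => ?_
        change ch K b y * _ ≤ ch K b y * _ + _
        rw [← mul_add]
        refine mul_le_mul_of_nonneg_left ?_ (hch _ _ _)
        by_cases hg : G₁ (K.1 (v.1, b.1)) (K.2.1 ((v.1, b.1), (v.2.1, b.2.1))) (π₁ y) ∧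
            G₂ (K.1 (v.1, b.1)) (K.2.2 ((v.1, b.1), (v.2.2, b.2.2))) (π₂ y)
        · rw [if_pos hg, zero_add]
          have step₁ : pick (S₁ K (π₁ y)) ≠ (v.1, v.2.1) → 1 ≤ E₁ K y := by
            intro hne
            obtain ⟨m, ⟨b', hb'⟩, hm⟩ : ∃ m, S₁ K (π₁ y) m ∧ m ≠ (v.1, v.2.1) := by
              by_contra! hcon
              exact hne (pick_eq_of_unique ⟨(b.1, b.2.1), hg.1⟩ hcon)
            refine le_trans (le_of_eq ?_) (Finset.single_le_sum
              (fun x _ => by split_ifs <;> simp) (Finset.mem_univ (m, b')))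
            rw [if_neg hm, if_pos hb']
          have step₂ : pick (S₂ K (π₂ y)) ≠ (v.1, v.2.2) → 1 ≤ E₂ K y := by
            intro hne
            obtain ⟨m, ⟨b', hb'⟩, hm⟩ : ∃ m, S₂ K (π₂ y) m ∧ m ≠ (v.1, v.2.2) := by
              by_contra! hcon
              exact hne (pick_eq_of_unique ⟨(b.1, b.2.2), hg.2⟩ hcon)
            refine le_trans (le_of_eq ?_) (Finset.single_le_sum
              (fun x _ => by split_ifs <;> simp) (Finset.mem_univ (m, b')))
            rw [if_neg hm, if_pos hb']
          split_ifs with hd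
          · exact add_nonneg (hE₁ _ _) (hE₂ _ _)
          · rcases not_and_or.1 hd with h' | h'
            · linarith [step₁ h', hE₂ K y]
            · linarith [step₂ h', hE₁ K y]
        · rw [if_neg hg]
          have := add_nonneg (hE₁ K y) (hE₂ K y)
          split_ifs <;> linarith
      · rw [if_neg hb]
        have h1 : ∑ y, ch K (pick (hit K v)) y *
            (if pick (S₁ K (π₁ y)) = (v.1, v.2.1) ∧ pick (S₂ K (π₂ y)) = (v.1, v.2.2)
              then (0 : ℝ) else 1) ≤ 1 := by
          refine (Finset.sum_le_sum fun y _ => mul_le_of_le_one_right (hch _ _ _) ?_).trans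
            (hw (K.1 (v.1, (pick (hit K v)).1)) (K.2.1 ((v.1, (pick (hit K v)).1),
            (v.2.1, (pick (hit K v)).2.1))) (K.2.2 ((v.1, (pick (hit K v)).1),
            (v.2.2, (pick (hit K v)).2.2)))).2.le
          split_ifs <;> simp
        have := Finset.sum_nonneg fun b (_ : b ∈ Finset.univ) => hpos b
        linarith
    have hp : superProb a₀ a₁ a₂ (fun u₀ u₁ u₂ => if T u₀ u₁ u₂ then 1 else 0) = p := c.prob_eq
    have ht : ∀ u₀ u₁ u₂, (0 : ℝ) ≤ if T u₀ u₁ u₂ then 1 else 0 := c.nonneg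
    have hp' : superProb a₀ a₂ a₁ (fun u₀ u₂ u₁ => if T u₀ u₁ u₂ then 1 else 0) = p := by
      rw [superProb_swap a₀ a₁ a₂ (fun u₀ u₁ u₂ => if T u₀ u₁ u₂ then 1 else 0), hp]
    have hpack₁ : ∀ b : β₀ × β₁ × β₂, ∑ K : Book, bookWeight a₀ a₁ a₂ K *
        ((if hit K v b then 1 else 0) * ∑ y, ch K b y * E₁ K y) ≤
        p * (((Fintype.card μ₀ : ℝ) * Fintype.card μ₁ - 1) *
          (Fintype.card β₀ * Fintype.card β₁) * F₁ +
          ((Fintype.card μ₁ : ℝ) - 1) * Fintype.card β₁ * P₁) := by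
      intro b
      refine le_trans ?_ (mul_le_mul_of_nonneg_left
        (sum_wrong_le (v.1, v.2.1) b.1 P₁ hF₁₀) c.prob_pos.le)
      have e : ∀ K : Book, bookWeight a₀ a₁ a₂ K *
          ((if hit K v b then 1 else 0) * ∑ y, ch K b y * E₁ K y) =
          ∑ x : (μ₀ × μ₁) × (β₀ × β₁), if x.1 = (v.1, v.2.1) then 0 else bookWeight a₀ a₁ a₂ K *
            ((if hit K v b then 1 else 0) * ∑ y, ch K b y *
              (if G₁ (K.1 (x.1.1, x.2.1)) (K.2.1 ((x.1.1, x.2.1), (x.1.2, x.2.2))) (π₁ y)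
                then 1 else 0)) := by
        intro K
        dsimp only [E₁]
        simp only [Finset.mul_sum]
        rw [Finset.sum_comm]
        refine Finset.sum_congr rfl fun x _ => ?_
        split_ifs <;> simp
      simp only [e]
      rw [Finset.sum_comm, Finset.mul_sum]
      refine Finset.sum_le_sum fun x _ => ?_
      by_cases hx : x.1 = (v.1, v.2.1)
      · simp [hx]
      · simp only [hx, if_false]
        rw [← hp]
        refine h.mean_coincidence_le ht hw π₁
          (g := fun u₀ u₁ y => if G₁ u₀ u₁ y then 1 else 0) hF₁ hP₁ (v.1, b.1) (x.1.1, x.2.1)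
          (v.2.1, b.2.1) (x.1.2, x.2.2) (v.2.2, b.2.2) fun hk hi => hx ?_
        rw [Prod.ext_iff] at hk hi
        exact Prod.ext hk.1.symm hi.1.symm
    have hpack₂ : ∀ b : β₀ × β₁ × β₂, ∑ K : Book, bookWeight a₀ a₁ a₂ K *
        ((if hit K v b then 1 else 0) * ∑ y, ch K b y * E₂ K y) ≤
        p * (((Fintype.card μ₀ : ℝ) * Fintype.card μ₂ - 1) *
          (Fintype.card β₀ * Fintype.card β₂) * F₂ +
          ((Fintype.card μ₂ : ℝ) - 1) * Fintype.card β₂ * P₂) := by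
      intro b
      refine le_trans ?_ (mul_le_mul_of_nonneg_left
        (sum_wrong_le (v.1, v.2.2) b.1 P₂ hF₂₀) c.prob_pos.le)
      have e : ∀ K : Book, bookWeight a₀ a₁ a₂ K *
          ((if hit K v b then 1 else 0) * ∑ y, ch K b y * E₂ K y) =
          ∑ x : (μ₀ × μ₂) × (β₀ × β₂), if x.1 = (v.1, v.2.2) then 0 else bookWeight a₀ a₁ a₂ K *
            ((if hit K v b then 1 else 0) * ∑ y, ch K b y *
              (if G₂ (K.1 (x.1.1, x.2.1)) (K.2.2 ((x.1.1, x.2.1), (x.1.2, x.2.2))) (π₂ y)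
                then 1 else 0)) := by
        intro K
        dsimp only [E₂]
        simp only [Finset.mul_sum]
        rw [Finset.sum_comm]
        refine Finset.sum_congr rfl fun x _ => ?_
        split_ifs <;> simp
      simp only [e]
      rw [Finset.sum_comm, Finset.mul_sum]
      refine Finset.sum_le_sum fun x _ => ?_
      by_cases hx : x.1 = (v.1, v.2.2)
      · simp [hx]
      · simp only [hx, if_false]
        rw [← hp', sum_bookWeight_swap]
        refine h.swap.mean_coincidence_le
          (t := fun u₀ u₂ u₁ => if T u₀ u₁ u₂ then 1 else 0) (fun _ _ _ => ht _ _ _)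
          (w := fun u₀ u₂ u₁ => w u₀ u₁ u₂) (fun _ _ _ => hw _ _ _) π₂
          (g := fun u₀ u₁ y => if G₂ u₀ u₁ y then 1 else 0) hF₂ hP₂ (v.1, b.1) (x.1.1, x.2.1)
          (v.2.2, b.2.2) (x.1.2, x.2.2) (v.2.1, b.2.1) fun hk hi => hx ?_
        rw [Prod.ext_iff] at hk hi
        exact Prod.ext hk.1.symm hi.1.symm
    refine (Finset.sum_le_sum fun K _ => mul_le_mul_of_nonneg_left (hpoint K) (hbw K)).trans ?_
    have e : ∀ K : Book, bookWeight a₀ a₁ a₂ K * ((if ∃ b, hit K v b then 0 else 1) + η +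
          ∑ b, (if hit K v b then 1 else 0) * ∑ y, ch K b y * (E₁ K y + E₂ K y)) =
        bookWeight a₀ a₁ a₂ K * (if ∃ b, hit K v b then 0 else 1) + bookWeight a₀ a₁ a₂ K * η +
        (∑ b, bookWeight a₀ a₁ a₂ K * ((if hit K v b then 1 else 0) * ∑ y, ch K b y * E₁ K y) +
        ∑ b, bookWeight a₀ a₁ a₂ K *
          ((if hit K v b then 1 else 0) * ∑ y, ch K b y * E₂ K y)) := by
      intro K
      simp only [mul_add, Finset.mul_sum, Finset.sum_add_distrib]
    simp only [e, Finset.sum_add_distrib]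
    rw [← Finset.sum_mul, h.sum_bookWeight, one_mul, Finset.sum_comm,
      Finset.sum_comm (s := Finset.univ (α := Book))]
    refine add_le_add (add_le_add hcov le_rfl) ?_
    refine (add_le_add (Finset.sum_le_sum fun b _ => hpack₁ b)
      (Finset.sum_le_sum fun b _ => hpack₂ b)).trans (le_of_eq ?_)
    simp only [Finset.sum_const, Finset.card_univ, Fintype.card_prod, nsmul_eq_mul, Nat.cast_mul]
    ring

end Scheme

/-! ### Typical sequences -/

section Typical

variable {α β Ω : Type*} {n : ℕ}

/-- The number of occurrences of `a` in the sequence `s`. -/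
def occ (s : Fin n → α) (a : α) : ℝ := pmfLaw (fun _ : Fin n => (1 : ℝ)) s a

/-- Robust typicality: every letter frequency is within the factor `1 ± δ` of its probability. In
particular letters of probability `0` do not occur. -/
def Typical (δ : ℝ) (π : α → ℝ) (s : Fin n → α) : Prop := ∀ a, |occ s a - n * π a| ≤ n * δ * π a

lemma sum_comp_eq_sum_occ [Fintype α] (s : Fin n → α) (h : α → ℝ) :
    ∑ i, h (s i) = ∑ a, occ s a * h a := by
  unfold occ
  rw [sum_pmfLaw_mul]
  simp

lemma Typical.abs_sum_sub_le [Fintype α] {δ : ℝ} {π : α → ℝ} {s : Fin n → α}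
    (hs : Typical δ π s) (h : α → ℝ) :
    |∑ i, h (s i) - n * ∑ a, π a * h a| ≤ n * δ * ∑ a, π a * |h a| := by
  rw [sum_comp_eq_sum_occ, Finset.mul_sum, ← Finset.sum_sub_distrib, Finset.mul_sum]
  refine (Finset.abs_sum_le_sum_abs _ _).trans (Finset.sum_le_sum fun a _ => ?_)
  rw [← mul_assoc, ← sub_mul, abs_mul, ← mul_assoc]
  exact mul_le_mul_of_nonneg_right (hs a) (abs_nonneg _)

lemma Typical.ne_zero {δ : ℝ} {π : α → ℝ} {s : Fin n → α} (hs : Typical δ π s) (i : Fin n) :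
    π (s i) ≠ 0 := by
  intro h0
  have h := hs (s i)
  rw [h0] at h
  have h1 : 0 < occ s (s i) := pmfLaw_pos (fun _ => zero_le_one) s one_ne_zero
  simp only [mul_zero, sub_zero] at h
  exact h1.ne' (abs_nonpos_iff.1 h)

lemma Typical.map [Fintype α] {δ : ℝ} {π : α → ℝ} {s : Fin n → α} (hs : Typical δ π s)
    (g : α → β) : Typical δ (pmfLaw π g) (fun i => g (s i)) := by
  intro b
  have : occ (fun i => g (s i)) b = pmfLaw (occ s) g b := by
    unfold occ
    rw [← pmfLaw_comp]
  rw [this]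
  unfold pmfLaw
  rw [Finset.mul_sum, ← Finset.sum_sub_distrib, Finset.mul_sum]
  refine (Finset.abs_sum_le_sum_abs _ _).trans (Finset.sum_le_sum fun a _ => ?_)
  split_ifs
  · exact hs a
  · simp

/-! ### The law of large numbers for typical sequences -/

lemma sum_prod_mul_sq_occ_le [Fintype α] {π : α → ℝ} (hπ : π ∈ stdSimplex ℝ α) (a : α) :
    ∑ s : Fin n → α, (∏ i, π (s i)) * (occ s a - n * π a) ^ 2 ≤ n * π a := by
  classical
  have hsum := fun _ : Fin n => hπ.2
  let x : α → ℝ := fun b => (if b = a then 1 else 0) - π a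
  have hx0 : ∑ b, π b * x b = 0 := by
    simp [x, mul_sub, ← Finset.sum_mul, hπ.2]
  have hx2 : ∑ b, π b * (x b * x b) ≤ π a := by
    have : ∀ b, π b * (x b * x b) =
        (if b = a then π b * (1 - 2 * π a) else 0) + π b * (π a * π a) := by
      intro b
      dsimp only [x]
      split_ifs <;> ring
    simp only [this, Finset.sum_add_distrib, ← Finset.sum_mul, hπ.2, Finset.sum_ite_eq',
      Finset.mem_univ, if_true]
    nlinarith [hπ.1 a]
  have e : ∀ s : Fin n → α, (∏ i, π (s i)) * (occ s a - n * π a) ^ 2 =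
      ∑ i, ∑ j, (∏ i, π (s i)) * (x (s i) * x (s j)) := by
    intro s
    have : occ s a - n * π a = ∑ i, x (s i) := by
      simp only [x, Finset.sum_sub_distrib, occ, pmfLaw]
      simp
    rw [this, sq, Finset.sum_mul_sum, Finset.mul_sum]
    simp only [Finset.mul_sum]
  simp only [e]
  rw [Finset.sum_comm]
  have e2 : ∀ i, ∑ s : Fin n → α, ∑ j, (∏ i, π (s i)) * (x (s i) * x (s j)) ≤ π a := by
    intro i
    rw [Finset.sum_comm, Finset.sum_eq_single i]
    · rw [sum_pi_single (q := fun _ => π) hsum i (fun b => x b * x b)]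
      exact hx2
    · intro j _ hj
      rw [sum_pi_pair (q := fun _ => π) hsum hj.symm (fun b c => x b * x c)]
      simp only [mul_left_comm (π _) (x _), ← Finset.mul_sum, hx0, mul_zero, Finset.sum_const_zero]
    · simp
  refine (Finset.sum_le_sum fun i _ => e2 i).trans (le_of_eq ?_)
  simp

open Classical in
/-- Chebyshev's inequality for the letter frequencies. -/
lemma sum_not_typical_le [Fintype α] {π : α → ℝ} (hπ : π ∈ stdSimplex ℝ α) {δ : ℝ} (hδ : 0 < δ)
    (hn : 0 < n) :
    ∑ s : Fin n → α, (∏ i, π (s i)) * (if Typical δ π s then 0 else 1) ≤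
      (∑ a, 1 / (δ ^ 2 * π a)) / n := by
  have hn' : (0 : ℝ) < n := Nat.cast_pos.2 hn
  have h1 : ∀ s : Fin n → α, (∏ i, π (s i)) * (if Typical δ π s then 0 else 1) ≤
      ∑ a, (∏ i, π (s i)) * (occ s a - n * π a) ^ 2 / (n * δ * π a) ^ 2 := by
    intro s
    have hw : 0 ≤ ∏ i, π (s i) := Finset.prod_nonneg fun i _ => hπ.1 _
    have hnn : ∀ a, 0 ≤ (∏ i, π (s i)) * (occ s a - n * π a) ^ 2 / (n * δ * π a) ^ 2 := fun a => by
      positivity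
    split_ifs with ht
    · simpa using Finset.sum_nonneg fun a _ => hnn a
    · by_cases h0 : ∏ i, π (s i) = 0
      · simp [h0]
      · unfold Typical at ht
        push Not at ht
        obtain ⟨a, ha⟩ := ht
        have hπa : 0 < π a := by
          refine lt_of_le_of_ne (hπ.1 a) fun ha0 => ?_
          have : occ s a = 0 := by
            by_contra hne
            obtain ⟨i, hi, -⟩ := exists_of_pmfLaw_ne_zero hne
            exact h0 (Finset.prod_eq_zero (Finset.mem_univ i) (by rw [hi, ← ha0]))
          rw [← ha0, this] at ha
          simp at ha
        refine le_trans ?_ (Finset.single_le_sum (fun a _ => hnn a) (Finset.mem_univ a))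
        rw [mul_div_assoc]
        refine mul_le_mul_of_nonneg_left ?_ hw
        rw [one_le_div (by positivity), ← sq_abs (occ s a - n * π a)]
        exact pow_le_pow_left₀ (by positivity) ha.le 2
  refine (Finset.sum_le_sum fun s _ => h1 s).trans ?_
  rw [Finset.sum_comm, Finset.sum_div]
  refine Finset.sum_le_sum fun a _ => ?_
  rw [← Finset.sum_div]
  refine (div_le_div_of_nonneg_right (sum_prod_mul_sq_occ_le hπ a) (by positivity)).trans
    (le_of_eq ?_)
  by_cases ha : π a = 0
  · simp [ha]
  · field_simp

/-! ### Change of measure on typical sequences -/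

/-- The exponent of a change of measure: the divergence, averaged over `B`, of the conditional law
of `A` given `B` from the kernel `V`. -/
def condDiv [Fintype Ω] (P : Ω → ℝ) (A : Ω → α) (B : Ω → β) (V : β → α → ℝ) : ℝ :=
  entropy P B - entropy P (fun ω => (A ω, B ω)) - meanLog P (fun ω => V (B ω) (A ω))

/-- On sequences that are typical for `(A, B)`, the `n`-fold conditional law of `A` given `B` and
the `n`-fold kernel `V` differ by the factor `2 ^ (n * condDiv)`, up to a factor that is
controlled by `δ`. -/
lemma exists_prod_condLaw_le [Fintype Ω] [Fintype α] [Fintype β] {P : Ω → ℝ}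
    (hP : ∀ ω, 0 ≤ P ω) (A : Ω → α) (B : Ω → β) {V : β → α → ℝ} (hV0 : ∀ b a, 0 ≤ V b a)
    (hV : ∀ ω, P ω ≠ 0 → V (B ω) (A ω) ≠ 0) :
    ∃ C : ℝ, 0 ≤ C ∧ ∀ (δ : ℝ) (n : ℕ) (z : Fin n → α × β),
      Typical δ (pmfLaw P (fun ω => (A ω, B ω))) z →
      (2 : ℝ) ^ (n * (condDiv P A B V - δ * C)) * ∏ i, V (z i).2 (z i).1 ≤
        ∏ i, condLaw P A B (z i).2 (z i).1 ∧
      ∏ i, condLaw P A B (z i).2 (z i).1 ≤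
        (2 : ℝ) ^ (n * (condDiv P A B V + δ * C)) * ∏ i, V (z i).2 (z i).1 := by
  set π := pmfLaw P (fun ω => (A ω, B ω)) with hπ
  let h : α × β → ℝ := fun z => Real.logb 2 (condLaw P A B z.2 z.1 / V z.2 z.1)
  have hcl : ∀ ω, condLaw P A B (B ω) (A ω) = pmfLaw P (fun ω => (A ω, B ω)) (A ω, B ω) /
      pmfLaw P B (B ω) := by
    intro ω
    unfold condLaw
    rw [pmfLaw_congr (A := fun ω => (B ω, A ω)) (B := fun ω => (A ω, B ω)) (by simp; tauto) ω]
  have hpos : ∀ z, π z ≠ 0 → 0 < condLaw P A B z.2 z.1 ∧ 0 < V z.2 z.1 := by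
    intro z hz
    obtain ⟨ω, rfl, hω⟩ := exists_of_pmfLaw_ne_zero hz
    exact ⟨div_pos (pmfLaw_pos hP (fun ω => (B ω, A ω)) hω) (pmfLaw_pos hP B hω),
      lt_of_le_of_ne (hV0 _ _) (hV ω hω).symm⟩
  have hmean : ∑ z, π z * h z = condDiv P A B V := by
    rw [hπ, sum_pmfLaw_mul]
    unfold condDiv entropy meanLog
    rw [sub_neg_eq_add, neg_add_eq_sub, ← Finset.sum_sub_distrib, ← Finset.sum_sub_distrib]
    refine Finset.sum_congr rfl fun ω _ => ?_
    by_cases hω : P ω = 0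
    · simp [hω]
    · have h1 := pmfLaw_pos hP B hω
      have h2 := pmfLaw_pos hP (fun ω => (A ω, B ω)) hω
      dsimp only [h]
      rw [hcl, Real.logb_div (div_pos h2 h1).ne' (hV ω hω), Real.logb_div h2.ne' h1.ne']
      ring
  refine ⟨∑ z, π z * |h z|, Finset.sum_nonneg fun z _ =>
    mul_nonneg (pmfLaw_nonneg hP _ _) (abs_nonneg _), fun δ n z hz => ?_⟩
  have hprod : ∏ i, condLaw P A B (z i).2 (z i).1 =
      (2 : ℝ) ^ (∑ i, h (z i)) * ∏ i, V (z i).2 (z i).1 := by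
    rw [Real.rpow_sum_of_pos two_pos, ← Finset.prod_mul_distrib]
    refine Finset.prod_congr rfl fun i _ => ?_
    obtain ⟨h1, h2⟩ := hpos _ (hz.ne_zero i)
    dsimp only [h]
    rw [Real.rpow_logb two_pos (by norm_num) (div_pos h1 h2), div_mul_cancel₀ _ h2.ne']
  have hVn : 0 ≤ ∏ i, V (z i).2 (z i).1 := Finset.prod_nonneg fun i _ => hV0 _ _
  have habs := abs_le.1 (hz.abs_sum_sub_le h)
  rw [hmean] at habs
  rw [hprod]
  exact ⟨mul_le_mul_of_nonneg_right
      (Real.rpow_le_rpow_of_exponent_le one_le_two (by linarith [habs.1])) hVn,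
    mul_le_mul_of_nonneg_right
      (Real.rpow_le_rpow_of_exponent_le one_le_two (by linarith [habs.2])) hVn⟩

open Classical in
/-- The `V`-probability of being jointly typical with a given sequence `b`. -/
lemma exists_sum_typical_le [Fintype Ω] [Fintype α] [Fintype β] {P : Ω → ℝ}
    (hP : ∀ ω, 0 ≤ P ω) (A : Ω → α) (B : Ω → β) {V : β → α → ℝ} (hV0 : ∀ b a, 0 ≤ V b a)
    (hV : ∀ ω, P ω ≠ 0 → V (B ω) (A ω) ≠ 0) :
    ∃ C : ℝ, 0 ≤ C ∧ ∀ (δ : ℝ) (n : ℕ) (b : Fin n → β),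
      ∑ a : Fin n → α, (∏ i, V (b i) (a i)) *
        (if Typical δ (pmfLaw P (fun ω => (A ω, B ω))) (fun i => (a i, b i)) then 1 else 0) ≤
      (2 : ℝ) ^ (-(n * (condDiv P A B V - δ * C))) := by
  obtain ⟨C, hC, h⟩ := exists_prod_condLaw_le hP A B hV0 hV
  refine ⟨C, hC, fun δ n b => ?_⟩
  have hcl0 : ∀ b a, 0 ≤ condLaw P A B b a := fun b a =>
    div_nonneg (pmfLaw_nonneg hP _ _) (pmfLaw_nonneg hP _ _)
  have h1 : ∀ a : Fin n → α, (∏ i, V (b i) (a i)) *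
      (if Typical δ (pmfLaw P (fun ω => (A ω, B ω))) (fun i => (a i, b i)) then 1 else 0) ≤
      (2 : ℝ) ^ (-(n * (condDiv P A B V - δ * C))) * ∏ i, condLaw P A B (b i) (a i) := by
    intro a
    split_ifs with ht
    · rw [mul_one, Real.rpow_neg two_pos.le, ← div_eq_inv_mul, le_div_iff₀ (by positivity),
        mul_comm]
      exact (h δ n _ ht).1
    · rw [mul_zero]
      exact mul_nonneg (by positivity) (Finset.prod_nonneg fun i _ => hcl0 _ _)
  refine (Finset.sum_le_sum fun a _ => h1 a).trans ?_
  rw [← Finset.mul_sum]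
  refine mul_le_of_le_one_right (by positivity) ?_
  rw [sum_pi_prod (fun i a => condLaw P A B (b i) a)]
  refine Finset.prod_le_one (fun i _ => Finset.sum_nonneg fun a _ => hcl0 _ _) fun i _ => ?_
  unfold condLaw
  rw [← Finset.sum_div, pmfLaw_sum_snd]
  exact div_self_le_one _

end Typical

/-! ### The exponents of the scheme -/

section Exponents

variable {X Y₁ Y₂ U₀ U₁ U₂ : Type*} [Fintype X] [Fintype Y₁] [Fintype Y₂]
  [Fintype U₀] [Fintype U₁] [Fintype U₂] (W : BroadcastChannel X Y₁ Y₂)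
  {c : CodebookLaw U₀ U₁ U₂} {q : (U₀ × U₁ × U₂) × X → ℝ}

lemma meanLog_transmitLaw_fst {U : Type*} [Fintype U] (q : U × X → ℝ) (g : U × X → ℝ) :
    meanLog (transmitLaw W q) (fun ω => g ω.1) = meanLog q g := by
  rw [← meanLog_pmfLaw (transmitLaw W q) (fun ω => ω.1) g, pmfLaw_transmitLaw_fst]

lemma condDiv_privates (hq : q ∈ stdSimplex ℝ ((U₀ × U₁ × U₂) × X)) (hc : FactorsNeZero c q) :
    condDiv (transmitLaw W q) (fun ω => ω.1.1.2) (fun ω => ω.1.1.1)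
      (fun u₀ u => c.p₁ u₀ u.1 * c.p₂ u₀ u.2) =
      realDivPriv₁ c q + realDivPriv₂ c q + infoCross q := by
  unfold condDiv
  rw [entropy_congr (A := fun ω : ((U₀ × U₁ × U₂) × X) × (Y₁ × Y₂) => (ω.1.1.2, ω.1.1.1))
      (B := fun ω => ω.1.1) (by simp [Prod.ext_iff]; tauto),
    entropy_transmitLaw_fst W q (fun z => z.1), entropy_transmitLaw_fst W q (fun z => z.1.1),
    meanLog_transmitLaw_fst W q (fun z => c.p₁ z.1.1 z.1.2.1 * c.p₂ z.1.1 z.1.2.2),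
    meanLog_mul (fun z hz => (hc z hz).2.1) (fun z hz => (hc z hz).2.2), infoCross_eq_entropy hq]
  unfold realDivPriv₁ realDivPriv₂
  ring

lemma condDiv_private₂ (hq : q ∈ stdSimplex ℝ ((U₀ × U₁ × U₂) × X)) :
    condDiv (transmitLaw W q) (fun ω => ω.1.1.2.2) (fun ω => (ω.1.1.1, ω.1.1.2.1))
      (fun u u₂ => c.p₂ u.1 u₂) = realDivPriv₂ c q + infoCross q := by
  unfold condDiv
  rw [entropy_congr
      (A := fun ω : ((U₀ × U₁ × U₂) × X) × (Y₁ × Y₂) => (ω.1.1.2.2, (ω.1.1.1, ω.1.1.2.1)))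
      (B := fun ω => ω.1.1) (by simp [Prod.ext_iff]; tauto),
    entropy_transmitLaw_fst W q (fun z => z.1),
    entropy_transmitLaw_fst W q (fun z => (z.1.1, z.1.2.1)),
    meanLog_transmitLaw_fst W q (fun z => c.p₂ z.1.1 z.1.2.2), infoCross_eq_entropy hq]
  unfold realDivPriv₂
  ring

lemma condDiv_private₁ (hq : q ∈ stdSimplex ℝ ((U₀ × U₁ × U₂) × X)) :
    condDiv (transmitLaw W q) (fun ω => ω.1.1.2.1) (fun ω => (ω.1.1.1, ω.1.1.2.2))
      (fun u u₁ => c.p₁ u.1 u₁) = realDivPriv₁ c q + infoCross q := by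
  unfold condDiv
  rw [entropy_congr
      (A := fun ω : ((U₀ × U₁ × U₂) × X) × (Y₁ × Y₂) => (ω.1.1.2.1, (ω.1.1.1, ω.1.1.2.2)))
      (B := fun ω => ω.1.1) (by simp [Prod.ext_iff]; tauto),
    entropy_transmitLaw_fst W q (fun z => z.1),
    entropy_transmitLaw_fst W q (fun z => (z.1.1, z.1.2.2)),
    meanLog_transmitLaw_fst W q (fun z => c.p₁ z.1.1 z.1.2.1), infoCross_eq_entropy hq]
  unfold realDivPriv₁
  ring

lemma condDiv_triple (hq : q ∈ stdSimplex ℝ ((U₀ × U₁ × U₂) × X)) (hc : FactorsNeZero c q) :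
    condDiv (transmitLaw W q) (fun ω => ω.1.1) (fun _ => ()) (fun _ u => c.joint u) =
      realDivCommon c q + realDivPriv₁ c q + realDivPriv₂ c q + infoCross q := by
  unfold condDiv
  rw [entropy_const (transmitLaw_mem W hq).2,
    entropy_congr (A := fun ω : ((U₀ × U₁ × U₂) × X) × (Y₁ × Y₂) => (ω.1.1, ()))
      (B := fun ω => ω.1.1) (by simp),
    entropy_transmitLaw_fst W q (fun z => z.1),
    meanLog_transmitLaw_fst W q (fun z => c.joint z.1)]
  unfold CodebookLaw.joint
  rw [meanLog_mul (fun z hz => mul_ne_zero (hc z hz).1 (hc z hz).2.1)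
    (fun z hz => (hc z hz).2.2),
    meanLog_mul (fun z hz => (hc z hz).1) (fun z hz => (hc z hz).2.1), infoCross_eq_entropy hq]
  unfold realDivCommon realDivPriv₁ realDivPriv₂
  ring

lemma condDiv_full₁ (hq : q ∈ stdSimplex ℝ ((U₀ × U₁ × U₂) × X)) (hc : FactorsNeZero c q) :
    condDiv (transmitLaw W q) (fun ω => (ω.1.1.1, ω.1.1.2.1)) (fun ω => ω.2.1)
      (fun _ u => c.joint₁ u) = infoFull₁ W q + (realDivCommon c q + realDivPriv₁ c q) := by
  unfold condDiv
  rw [infoFull₁_eq_entropy W hq, meanLog_transmitLaw_fst W q (fun z => c.joint₁ (z.1.1, z.1.2.1)),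
    entropy_congr
      (A := fun ω : ((U₀ × U₁ × U₂) × X) × (Y₁ × Y₂) => ((ω.1.1.1, ω.1.1.2.1), ω.2.1))
      (B := fun ω => (ω.2.1, (ω.1.1.1, ω.1.1.2.1))) (by simp; tauto)]
  unfold CodebookLaw.joint₁
  rw [meanLog_mul (fun z hz => (hc z hz).1) (fun z hz => (hc z hz).2.1)]
  unfold realDivCommon realDivPriv₁
  ring

lemma condDiv_full₂ (hq : q ∈ stdSimplex ℝ ((U₀ × U₁ × U₂) × X)) (hc : FactorsNeZero c q) :
    condDiv (transmitLaw W q) (fun ω => (ω.1.1.1, ω.1.1.2.2)) (fun ω => ω.2.2)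
      (fun _ u => c.joint₂ u) = infoFull₂ W q + (realDivCommon c q + realDivPriv₂ c q) := by
  unfold condDiv
  rw [infoFull₂_eq_entropy W hq, meanLog_transmitLaw_fst W q (fun z => c.joint₂ (z.1.1, z.1.2.2)),
    entropy_congr
      (A := fun ω : ((U₀ × U₁ × U₂) × X) × (Y₁ × Y₂) => ((ω.1.1.1, ω.1.1.2.2), ω.2.2))
      (B := fun ω => (ω.2.2, (ω.1.1.1, ω.1.1.2.2))) (by simp; tauto)]
  unfold CodebookLaw.joint₂
  rw [meanLog_mul (fun z hz => (hc z hz).1) (fun z hz => (hc z hz).2.2)]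
  unfold realDivCommon realDivPriv₂
  ring

lemma condDiv_priv₁ (hq : q ∈ stdSimplex ℝ ((U₀ × U₁ × U₂) × X)) :
    condDiv (transmitLaw W q) (fun ω => ω.1.1.2.1) (fun ω => (ω.2.1, ω.1.1.1))
      (fun u u₁ => c.p₁ u.2 u₁) = infoPriv₁ W q + realDivPriv₁ c q := by
  unfold condDiv
  rw [infoPriv₁_eq_entropy W hq, meanLog_transmitLaw_fst W q (fun z => c.p₁ z.1.1 z.1.2.1),
    entropy_congr
      (A := fun ω : ((U₀ × U₁ × U₂) × X) × (Y₁ × Y₂) => (ω.1.1.2.1, (ω.2.1, ω.1.1.1)))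
      (B := fun ω => (ω.2.1, (ω.1.1.1, ω.1.1.2.1))) (by simp; tauto)]
  unfold realDivPriv₁
  ring

lemma condDiv_priv₂ (hq : q ∈ stdSimplex ℝ ((U₀ × U₁ × U₂) × X)) :
    condDiv (transmitLaw W q) (fun ω => ω.1.1.2.2) (fun ω => (ω.2.2, ω.1.1.1))
      (fun u u₂ => c.p₂ u.2 u₂) = infoPriv₂ W q + realDivPriv₂ c q := by
  unfold condDiv
  rw [infoPriv₂_eq_entropy W hq, meanLog_transmitLaw_fst W q (fun z => c.p₂ z.1.1 z.1.2.2),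
    entropy_congr
      (A := fun ω : ((U₀ × U₁ × U₂) × X) × (Y₁ × Y₂) => (ω.1.1.2.2, (ω.2.2, ω.1.1.1)))
      (B := fun ω => (ω.2.2, (ω.1.1.1, ω.1.1.2.2))) (by simp; tauto)]
  unfold realDivPriv₂
  ring

/-! ### Superposition codebooks of block length `n` -/

/-- The `n`-fold product of a law. -/
def prodLaw {α : Type*} {n : ℕ} (p : α → ℝ) (s : Fin n → α) : ℝ := ∏ i, p (s i)

/-- The `n`-fold product of a kernel. -/
def prodKernel {α β : Type*} {n : ℕ} (V : α → β → ℝ) (s : Fin n → α) (t : Fin n → β) : ℝ :=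
  ∏ i, V (s i) (t i)

lemma prodKernel_mem {α β : Type*} [Fintype β] {n : ℕ} {V : α → β → ℝ}
    (hV : ∀ a, V a ∈ stdSimplex ℝ β) (s : Fin n → α) :
    prodKernel V s ∈ stdSimplex ℝ (Fin n → β) :=
  ⟨fun _ => Finset.prod_nonneg fun _ _ => (hV _).1 _,
    sum_pi_one (q := fun i => V (s i)) fun _ => (hV _).2⟩

lemma prodLaw_mem {α : Type*} [Fintype α] {n : ℕ} {p : α → ℝ} (hp : p ∈ stdSimplex ℝ α) :
    (prodLaw p : (Fin n → α) → ℝ) ∈ stdSimplex ℝ (Fin n → α) :=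
  ⟨fun _ => Finset.prod_nonneg fun _ _ => hp.1 _, sum_pi_one fun _ => hp.2⟩

lemma CodebookLaw.isSuperposition (c : CodebookLaw U₀ U₁ U₂) (n : ℕ) :
    IsSuperposition (A₀ := Fin n → U₀) (prodLaw c.p₀) (prodKernel c.p₁) (prodKernel c.p₂) :=
  ⟨prodLaw_mem c.p₀_mem, prodKernel_mem c.p₁_mem, prodKernel_mem c.p₂_mem⟩

lemma sum_pi_prodType {α β : Type*} [Fintype α] [Fintype β] {n : ℕ} (F : (Fin n → α × β) → ℝ) :
    ∑ s, F s = ∑ a : Fin n → α, ∑ b : Fin n → β, F (fun i => (a i, b i)) := by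
  rw [Fintype.sum_equiv (Equiv.arrowProdEquivProdArrow (Fin n) (fun _ => α) (fun _ => β)) F
    (fun z => F (fun i => (z.1 i, z.2 i))) (fun _ => rfl), Fintype.sum_prod_type]

lemma superProb_eq_sum (c : CodebookLaw U₀ U₁ U₂) {n : ℕ}
    (t : (Fin n → U₀) → (Fin n → U₁) → (Fin n → U₂) → ℝ) :
    superProb (prodLaw c.p₀) (prodKernel c.p₁) (prodKernel c.p₂) t =
      ∑ u : Fin n → U₀ × U₁ × U₂, prodLaw c.joint u *
        t (fun i => (u i).1) (fun i => (u i).2.1) (fun i => (u i).2.2) := by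
  rw [sum_pi_prodType]
  simp only [sum_pi_prodType (α := U₁) (β := U₂), superProb, Finset.mul_sum]
  refine Finset.sum_congr rfl fun u₀ _ => Finset.sum_congr rfl fun u₁ _ =>
    Finset.sum_congr rfl fun u₂ _ => ?_
  simp only [prodLaw, prodKernel, CodebookLaw.joint, Finset.prod_mul_distrib]
  ring

/-- The joint law of auxiliary variables and channel outputs. -/
def auxOutLaw (q : (U₀ × U₁ × U₂) × X → ℝ) : (U₀ × U₁ × U₂) × (Y₁ × Y₂) → ℝ :=
  pmfLaw (transmitLaw W q) (fun ω => (ω.1.1, ω.2))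

lemma typical_of_auxOutLaw {γ : Type*} {δ : ℝ} {n : ℕ} {u : Fin n → U₀ × U₁ × U₂}
    {y : Fin n → Y₁ × Y₂} (h : Typical δ (auxOutLaw W q) (fun i => (u i, y i)))
    (g : (U₀ × U₁ × U₂) × (Y₁ × Y₂) → γ) :
    Typical δ (pmfLaw (transmitLaw W q) (fun ω => g (ω.1.1, ω.2))) (fun i => g (u i, y i)) := by
  have := h.map g
  rwa [auxOutLaw, pmfLaw_comp] at this

open Classical in
/-- The exponents that govern the scheme: for a set of triples `T` of codewords each of which is
jointly typical with some output, the exponents of its probability and of its conditional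
probabilities under the codebook law, and for the sets of pairs that are jointly typical with an
output of a receiver, the exponents of their probabilities. The loss `δ * C` is the same in
all of them. -/
theorem exists_exponents (hq : q ∈ stdSimplex ℝ ((U₀ × U₁ × U₂) × X))
    (hc : FactorsNeZero c q) :
    ∃ C : ℝ, 0 ≤ C ∧ ∀ (δ : ℝ) (n : ℕ), 0 ≤ δ →
      (∀ T : (Fin n → U₀) → (Fin n → U₁) → (Fin n → U₂) → Prop,
        (∀ u₀ u₁ u₂, T u₀ u₁ u₂ → ∃ y : Fin n → Y₁ × Y₂,
          Typical δ (auxOutLaw W q) (fun i => ((u₀ i, u₁ i, u₂ i), y i))) →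
        (superProb (prodLaw c.p₀) (prodKernel c.p₁) (prodKernel c.p₂)
          (fun u₀ u₁ u₂ => if T u₀ u₁ u₂ then 1 else 0) ≤ (2 : ℝ) ^ (-(n * (realDivCommon c q +
            realDivPriv₁ c q + realDivPriv₂ c q + infoCross q - δ * C)))) ∧
        ((2 : ℝ) ^ (-(n * (realDivCommon c q + realDivPriv₁ c q + realDivPriv₂ c q +
            infoCross q + δ * C))) * ∑ u : Fin n → U₀ × U₁ × U₂,
              prodLaw (pmfLaw q (fun z => z.1)) u *
              (if T (fun i => (u i).1) (fun i => (u i).2.1) (fun i => (u i).2.2) then 1 else 0) ≤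
          superProb (prodLaw c.p₀) (prodKernel c.p₁) (prodKernel c.p₂)
            (fun u₀ u₁ u₂ => if T u₀ u₁ u₂ then 1 else 0)) ∧
        (∀ u₀, ∑ u₁, prodKernel c.p₁ u₀ u₁ * ∑ u₂, prodKernel c.p₂ u₀ u₂ *
          (if T u₀ u₁ u₂ then 1 else 0) ≤
          (2 : ℝ) ^ (-(n * (realDivPriv₁ c q + realDivPriv₂ c q + infoCross q - δ * C)))) ∧
        (∀ u₀ u₁, ∑ u₂, prodKernel c.p₂ u₀ u₂ * (if T u₀ u₁ u₂ then 1 else 0) ≤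
          (2 : ℝ) ^ (-(n * (realDivPriv₂ c q + infoCross q - δ * C)))) ∧
        (∀ u₀ u₂, ∑ u₁, prodKernel c.p₁ u₀ u₁ * (if T u₀ u₁ u₂ then 1 else 0) ≤
          (2 : ℝ) ^ (-(n * (realDivPriv₁ c q + infoCross q - δ * C))))) ∧
      (∀ y : Fin n → Y₁, ∑ u₀, prodLaw c.p₀ u₀ * ∑ u₁, prodKernel c.p₁ u₀ u₁ *
        (if Typical δ (pmfLaw (transmitLaw W q) (fun ω => ((ω.1.1.1, ω.1.1.2.1), ω.2.1)))
          (fun i => ((u₀ i, u₁ i), y i)) then 1 else 0) ≤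
        (2 : ℝ) ^ (-(n * (infoFull₁ W q + (realDivCommon c q + realDivPriv₁ c q) - δ * C)))) ∧
      (∀ (u₀ : Fin n → U₀) (y : Fin n → Y₁), ∑ u₁, prodKernel c.p₁ u₀ u₁ *
        (if Typical δ (pmfLaw (transmitLaw W q) (fun ω => ((ω.1.1.1, ω.1.1.2.1), ω.2.1)))
          (fun i => ((u₀ i, u₁ i), y i)) then 1 else 0) ≤
        (2 : ℝ) ^ (-(n * (infoPriv₁ W q + realDivPriv₁ c q - δ * C)))) ∧
      (∀ y : Fin n → Y₂, ∑ u₀, prodLaw c.p₀ u₀ * ∑ u₂, prodKernel c.p₂ u₀ u₂ *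
        (if Typical δ (pmfLaw (transmitLaw W q) (fun ω => ((ω.1.1.1, ω.1.1.2.2), ω.2.2)))
          (fun i => ((u₀ i, u₂ i), y i)) then 1 else 0) ≤
        (2 : ℝ) ^ (-(n * (infoFull₂ W q + (realDivCommon c q + realDivPriv₂ c q) - δ * C)))) ∧
      (∀ (u₀ : Fin n → U₀) (y : Fin n → Y₂), ∑ u₂, prodKernel c.p₂ u₀ u₂ *
        (if Typical δ (pmfLaw (transmitLaw W q) (fun ω => ((ω.1.1.1, ω.1.1.2.2), ω.2.2)))
          (fun i => ((u₀ i, u₂ i), y i)) then 1 else 0) ≤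
        (2 : ℝ) ^ (-(n * (infoPriv₂ W q + realDivPriv₂ c q - δ * C)))) := by
  have hP := (transmitLaw_mem W hq).1
  have hcP := fun ω (hω : transmitLaw W q ω ≠ 0) => hc ω.1 (left_ne_zero_of_mul hω)
  have n₀ := c.p₀_mem.1
  have n₁ := fun u => (c.p₁_mem u).1
  have n₂ := fun u => (c.p₂_mem u).1
  obtain ⟨C₁, hC₁, h₁⟩ := exists_sum_typical_le hP (fun ω => ω.1.1) (fun _ => ())
    (V := fun _ u => c.joint u) (fun _ u => mul_nonneg (mul_nonneg (n₀ _) (n₁ _ _)) (n₂ _ _))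
    (fun ω hω => mul_ne_zero (mul_ne_zero (hcP ω hω).1 (hcP ω hω).2.1) (hcP ω hω).2.2)
  obtain ⟨C₂, hC₂, h₂⟩ := exists_prod_condLaw_le hP (fun ω => ω.1.1) (fun _ => ())
    (V := fun _ u => c.joint u) (fun _ u => mul_nonneg (mul_nonneg (n₀ _) (n₁ _ _)) (n₂ _ _))
    (fun ω hω => mul_ne_zero (mul_ne_zero (hcP ω hω).1 (hcP ω hω).2.1) (hcP ω hω).2.2)
  obtain ⟨C₃, hC₃, h₃⟩ := exists_sum_typical_le hP (fun ω => ω.1.1.2) (fun ω => ω.1.1.1)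
    (V := fun u₀ u => c.p₁ u₀ u.1 * c.p₂ u₀ u.2) (fun _ _ => mul_nonneg (n₁ _ _) (n₂ _ _))
    (fun ω hω => mul_ne_zero (hcP ω hω).2.1 (hcP ω hω).2.2)
  obtain ⟨C₄, hC₄, h₄⟩ := exists_sum_typical_le hP (fun ω => ω.1.1.2.2)
    (fun ω => (ω.1.1.1, ω.1.1.2.1)) (V := fun u u₂ => c.p₂ u.1 u₂) (fun _ _ => n₂ _ _)
    (fun ω hω => (hcP ω hω).2.2)
  obtain ⟨C₅, hC₅, h₅⟩ := exists_sum_typical_le hP (fun ω => ω.1.1.2.1)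
    (fun ω => (ω.1.1.1, ω.1.1.2.2)) (V := fun u u₁ => c.p₁ u.1 u₁) (fun _ _ => n₁ _ _)
    (fun ω hω => (hcP ω hω).2.1)
  obtain ⟨C₆, hC₆, h₆⟩ := exists_sum_typical_le hP (fun ω => (ω.1.1.1, ω.1.1.2.1))
    (fun ω => ω.2.1) (V := fun _ u => c.joint₁ u) (fun _ _ => mul_nonneg (n₀ _) (n₁ _ _))
    (fun ω hω => mul_ne_zero (hcP ω hω).1 (hcP ω hω).2.1)
  obtain ⟨C₇, hC₇, h₇⟩ := exists_sum_typical_le hP (fun ω => ω.1.1.2.1)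
    (fun ω => (ω.2.1, ω.1.1.1)) (V := fun u u₁ => c.p₁ u.2 u₁) (fun _ _ => n₁ _ _)
    (fun ω hω => (hcP ω hω).2.1)
  obtain ⟨C₈, hC₈, h₈⟩ := exists_sum_typical_le hP (fun ω => (ω.1.1.1, ω.1.1.2.2))
    (fun ω => ω.2.2) (V := fun _ u => c.joint₂ u) (fun _ _ => mul_nonneg (n₀ _) (n₂ _ _))
    (fun ω hω => mul_ne_zero (hcP ω hω).1 (hcP ω hω).2.2)
  obtain ⟨C₉, hC₉, h₉⟩ := exists_sum_typical_le hP (fun ω => ω.1.1.2.2)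
    (fun ω => (ω.2.2, ω.1.1.1)) (V := fun u u₂ => c.p₂ u.2 u₂) (fun _ _ => n₂ _ _)
    (fun ω hω => (hcP ω hω).2.2)
  rw [condDiv_triple W hq hc] at h₁ h₂
  rw [condDiv_privates W hq hc] at h₃
  rw [condDiv_private₂ W hq] at h₄
  rw [condDiv_private₁ W hq] at h₅
  rw [condDiv_full₁ W hq hc] at h₆
  rw [condDiv_priv₁ W hq] at h₇
  rw [condDiv_full₂ W hq hc] at h₈
  rw [condDiv_priv₂ W hq] at h₉
  set C := C₁ + C₂ + C₃ + C₄ + C₅ + C₆ + C₇ + C₈ + C₉ with hC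
  have up : ∀ {δ : ℝ} {n : ℕ} {C' : ℝ} (D : ℝ), 0 ≤ δ → C' ≤ C →
      (2 : ℝ) ^ (-(n * (D - δ * C'))) ≤ (2 : ℝ) ^ (-(n * (D - δ * C))) := by
    intro δ n C' D hδ hCC
    refine Real.rpow_le_rpow_of_exponent_le one_le_two (neg_le_neg ?_)
    gcongr
  refine ⟨C, by linarith, fun δ n hδ => ⟨fun T hT => ⟨?_, ?_, fun u₀ => ?_, fun u₀ u₁ => ?_,
    fun u₀ u₂ => ?_⟩, fun y => ?_, fun u₀ y => ?_, fun y => ?_, fun u₀ y => ?_⟩⟩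
  · refine le_trans ?_ ((h₁ δ n (fun _ => ())).trans (up _ hδ (by linarith)))
    rw [superProb_eq_sum]
    refine Finset.sum_le_sum fun u _ => mul_le_mul_of_nonneg_left ?_
      (Finset.prod_nonneg fun i _ => mul_nonneg (mul_nonneg (n₀ _) (n₁ _ _)) (n₂ _ _))
    split_ifs with a b <;> norm_num
    obtain ⟨y, hy⟩ := hT _ _ _ a
    exact b (typical_of_auxOutLaw W hy (fun z => (z.1, ())))
  · rw [superProb_eq_sum, Finset.mul_sum]
    refine Finset.sum_le_sum fun u _ => ?_
    split_ifs with a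
    · obtain ⟨y, hy⟩ := hT _ _ _ a
      have h := (h₂ δ n _ (typical_of_auxOutLaw W hy (fun z => (z.1, ())))).2
      rw [mul_one, mul_one, Real.rpow_neg two_pos.le, ← div_eq_inv_mul,
        div_le_iff₀ (by positivity), mul_comm]
      have e : prodLaw (pmfLaw q (fun z => z.1)) u =
          ∏ i, condLaw (transmitLaw W q) (fun ω => ω.1.1) (fun _ => ()) () (u i) := by
        unfold prodLaw
        refine Finset.prod_congr rfl fun i _ => ?_
        have e1 : pmfLaw (transmitLaw W q) (fun _ => ()) () = 1 := by
          simp [pmfLaw, (transmitLaw_mem W hq).2]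
        have e2 : pmfLaw (transmitLaw W q) (fun ω => ((), ω.1.1)) ((), u i) =
            pmfLaw (transmitLaw W q) (fun ω => ω.1.1) (u i) := by
          simpa using pmfLaw_sum_fst (transmitLaw W q) (fun _ => ()) (fun ω => ω.1.1) (u i)
        rw [condLaw, e1, e2, div_one, ← pmfLaw_comp (transmitLaw W q) (fun ω => ω.1)
          (fun z => z.1), pmfLaw_transmitLaw_fst]
      rw [e]
      refine h.trans (mul_le_mul_of_nonneg_right (Real.rpow_le_rpow_of_exponent_le one_le_two ?_)
        (Finset.prod_nonneg fun i _ => mul_nonneg (mul_nonneg (n₀ _) (n₁ _ _)) (n₂ _ _)))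
      have : C₂ ≤ C := by linarith
      gcongr
    · simp
  · refine le_trans ?_ ((h₃ δ n u₀).trans (up _ hδ (by linarith)))
    rw [sum_pi_prodType]
    simp only [Finset.mul_sum]
    refine Finset.sum_le_sum fun u₁ _ => Finset.sum_le_sum fun u₂ _ => ?_
    rw [← mul_assoc, Finset.prod_mul_distrib]
    refine mul_le_mul_of_nonneg_left ?_ (mul_nonneg (Finset.prod_nonneg fun i _ => n₁ _ _)
      (Finset.prod_nonneg fun i _ => n₂ _ _))
    split_ifs with a b <;> norm_num
    obtain ⟨y, hy⟩ := hT _ _ _ a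
    exact b (typical_of_auxOutLaw W hy (fun z => (z.1.2, z.1.1)))
  · refine le_trans ?_ ((h₄ δ n (fun i => (u₀ i, u₁ i))).trans (up _ hδ (by linarith)))
    refine Finset.sum_le_sum fun u₂ _ => mul_le_mul_of_nonneg_left ?_
      (Finset.prod_nonneg fun i _ => n₂ _ _)
    split_ifs with a b <;> norm_num
    obtain ⟨y, hy⟩ := hT _ _ _ a
    exact b (typical_of_auxOutLaw W hy (fun z => (z.1.2.2, (z.1.1, z.1.2.1))))
  · refine le_trans ?_ ((h₅ δ n (fun i => (u₀ i, u₂ i))).trans (up _ hδ (by linarith)))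
    refine Finset.sum_le_sum fun u₁ _ => mul_le_mul_of_nonneg_left ?_
      (Finset.prod_nonneg fun i _ => n₁ _ _)
    split_ifs with a b <;> norm_num
    obtain ⟨y, hy⟩ := hT _ _ _ a
    exact b (typical_of_auxOutLaw W hy (fun z => (z.1.2.1, (z.1.1, z.1.2.2))))
  · refine le_trans (le_of_eq ?_) ((h₆ δ n y).trans (up _ hδ (by linarith)))
    rw [sum_pi_prodType]
    simp only [Finset.mul_sum, ← mul_assoc, CodebookLaw.joint₁, Finset.prod_mul_distrib]
    rfl
  · refine le_trans ?_ ((h₇ δ n (fun i => (y i, u₀ i))).trans (up _ hδ (by linarith)))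
    refine Finset.sum_le_sum fun u₁ _ => mul_le_mul_of_nonneg_left ?_
      (Finset.prod_nonneg fun i _ => n₁ _ _)
    split_ifs with a b <;> norm_num
    have := a.map (fun z => (z.1.2, (z.2, z.1.1)))
    rw [pmfLaw_comp] at this
    exact b this
  · refine le_trans (le_of_eq ?_) ((h₈ δ n y).trans (up _ hδ (by linarith)))
    rw [sum_pi_prodType]
    simp only [Finset.mul_sum, ← mul_assoc, CodebookLaw.joint₂, Finset.prod_mul_distrib]
    rfl
  · refine le_trans ?_ ((h₉ δ n (fun i => (y i, u₀ i))).trans (up _ hδ (by linarith)))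
    refine Finset.sum_le_sum fun u₁ _ => mul_le_mul_of_nonneg_left ?_
      (Finset.prod_nonneg fun i _ => n₂ _ _)
    split_ifs with a b <;> norm_num
    have := a.map (fun z => (z.1.2, (z.2, z.1.1)))
    rw [pmfLaw_comp] at this
    exact b this

end Exponents

/-! ### The scheme at block length `n` -/

section Block

/-- The binning bounds form a contrapolymatroid: any binning rates that satisfy them dominate
binning rates whose sum is exactly the divergence of the triple. -/
lemma exists_tight_binning {d₀ d₁ d₂ I r₀ r₁ r₂ : ℝ} (hd₀ : 0 ≤ d₀) (hd₁ : 0 ≤ d₁) (hd₂ : 0 ≤ d₂)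
    (hI : 0 ≤ I) (h₁ : 0 ≤ r₁) (h₂ : 0 ≤ r₂) (hall : d₀ + d₁ + d₂ + I ≤ r₀ + r₁ + r₂)
    (hp₁ : d₀ + d₁ ≤ r₀ + r₁) (hp₂ : d₀ + d₂ ≤ r₀ + r₂) (hc : d₀ ≤ r₀) :
    ∃ s₀ s₁ s₂ : ℝ, 0 ≤ s₀ ∧ 0 ≤ s₁ ∧ 0 ≤ s₂ ∧ s₀ ≤ r₀ ∧ s₁ ≤ r₁ ∧ s₂ ≤ r₂ ∧
      s₀ + s₁ + s₂ = d₀ + d₁ + d₂ + I ∧ d₀ + d₁ ≤ s₀ + s₁ ∧ d₀ + d₂ ≤ s₀ + s₂ ∧ d₀ ≤ s₀ := by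
  -- Decrease `r₀` until a bound becomes tight, and then `r₁`, `r₂` if it is another one.
  by_cases ha : r₁ + r₂ ≤ d₁ + d₂ + I
  · by_cases hb : r₂ ≤ d₂ + I
    · by_cases hb' : r₁ ≤ d₁ + I
      · exact ⟨d₀ + d₁ + d₂ + I - r₁ - r₂, r₁, r₂, by linarith, h₁, h₂, by linarith, le_rfl, le_rfl,
          by ring, by linarith, by linarith, by linarith⟩
      · exact ⟨d₀ + d₂ - r₂, d₁ + I, r₂, by linarith, by linarith, h₂, by linarith, by linarith,
          le_rfl, by ring, by linarith, by linarith, by linarith⟩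
    · exact ⟨d₀ + d₁ - r₁, r₁, d₂ + I, by linarith, h₁, by linarith, by linarith, le_rfl,
        by linarith, by ring, by linarith, by linarith, by linarith⟩
  · by_cases h1 : r₁ ≤ d₁
    · exact ⟨d₀ + d₁ - r₁, r₁, d₂ + I, by linarith, h₁, by linarith, by linarith, le_rfl,
        by linarith, by ring, by linarith, by linarith, by linarith⟩
    · by_cases h2 : r₂ ≤ d₂
      · exact ⟨d₀ + d₂ - r₂, d₁ + I, r₂, by linarith, by linarith, h₂, by linarith, by linarith,
          le_rfl, by ring, by linarith, by linarith, by linarith⟩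
      · by_cases h3 : r₂ ≤ d₂ + I
        · exact ⟨d₀, d₁ + d₂ + I - r₂, r₂, hd₀, by linarith, h₂, hc, by linarith, le_rfl,
            by ring, by linarith, by linarith, le_rfl⟩
        · exact ⟨d₀, d₁, d₂ + I, hd₀, hd₁, by linarith, hc, by linarith, by linarith, by ring,
            le_rfl, by linarith, le_rfl⟩

lemma sum_mul_average_le {κ ι : Type*} [Fintype κ] [Fintype ι] (b : κ → ℝ) (x : κ → ι → ℝ)
    {N B : ℝ} (hN : N = Fintype.card ι) (hN0 : 0 < N) (h : ∀ w, ∑ K, b K * x K w ≤ B) :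
    ∑ K, b K * ((∑ w, x K w) / N) ≤ B := by
  simp only [mul_div_assoc', ← Finset.sum_div, Finset.mul_sum]
  rw [Finset.sum_comm, div_le_iff₀ hN0]
  refine (Finset.sum_le_sum fun w _ => h w).trans (le_of_eq ?_)
  simp [hN, mul_comm]

variable {X Y₁ Y₂ U₀ U₁ U₂ : Type*} [Fintype X] [Fintype Y₁] [Fintype Y₂]
  [Fintype U₀] [Fintype U₁] [Fintype U₂] (W : BroadcastChannel X Y₁ Y₂)

lemma auxOutLaw_functionalInput (p : U₀ × U₁ × U₂ → ℝ) (f : U₀ × U₁ × U₂ → X) :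
    auxOutLaw W (functionalInput p f) = fun z => p z.1 * W.prob (f z.1) z.2 := by
  rw [auxOutLaw, functionalInput_eq_pmfLaw, transmitLaw_pmfLaw, pmfLaw_comp]
  exact pmfLaw_id _

lemma pmfLaw_functionalInput_fst {U : Type*} [Fintype U] (p : U → ℝ) (f : U → X) :
    pmfLaw (functionalInput p f) (fun z => z.1) = p := by
  rw [functionalInput_eq_pmfLaw, pmfLaw_comp]
  exact pmfLaw_id _

open Classical in
lemma exists_prob_not_typical_le {p : U₀ × U₁ × U₂ → ℝ} (hp : p ∈ stdSimplex ℝ (U₀ × U₁ × U₂))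
    (f : U₀ × U₁ × U₂ → X) {δ η : ℝ} (hδ : 0 < δ) (hη : 0 < η) :
    ∃ n₀ : ℕ, ∀ n : ℕ, n₀ ≤ n → ∑ u : Fin n → U₀ × U₁ × U₂, prodLaw p u *
      ∑ y, prodKernel (fun u => W.prob (f u)) u y *
        (if Typical δ (auxOutLaw W (functionalInput p f)) (fun i => (u i, y i)) then 0 else 1) ≤
      η := by
  have hπ : auxOutLaw W (functionalInput p f) ∈ stdSimplex ℝ ((U₀ × U₁ × U₂) × (Y₁ × Y₂)) :=
    pmfLaw_mem_stdSimplex (transmitLaw_mem W (functionalInput_mem hp f)) _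
  obtain ⟨n₀, hn₀⟩ := exists_nat_ge
    ((∑ a, 1 / (δ ^ 2 * auxOutLaw W (functionalInput p f) a)) / η)
  refine ⟨n₀ + 1, fun n hn => ?_⟩
  have hn' : (0 : ℝ) < n := Nat.cast_pos.2 (by omega)
  have h := sum_not_typical_le hπ hδ (n := n) (by omega)
  rw [sum_pi_prodType] at h
  refine le_trans (le_of_eq ?_) (h.trans ?_)
  · refine Finset.sum_congr rfl fun u _ => ?_
    rw [Finset.mul_sum]
    refine Finset.sum_congr rfl fun y _ => ?_
    rw [← mul_assoc, auxOutLaw_functionalInput]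
    simp only [prodLaw, prodKernel, Finset.prod_mul_distrib]
  · rw [div_le_iff₀ hn', ← div_le_iff₀' hη]
    exact hn₀.trans (Nat.cast_le.2 (by omega))

/-- The bound on the probability that no triple of bin indices yields a codeword triple in the
target set. -/
def coverError (B : SizeTriple) (P m₀ m₁ m₂ : ℝ) : ℝ :=
  m₀ / (B.common * P) + m₁ / (B.common * B.priv₁ * P) + m₂ / (B.common * B.priv₂ * P) +
    1 / (B.common * B.priv₁ * B.priv₂ * P)

/-- The union bound on the probability of a coincidence at some receiver. -/
def packError (M B : SizeTriple) (P F₁ P₁ F₂ P₂ : ℝ) : ℝ :=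
  B.common * B.priv₁ * B.priv₂ * P *
    ((((M.common : ℝ) * M.priv₁ - 1) * (B.common * B.priv₁) * F₁ +
      ((M.priv₁ : ℝ) - 1) * B.priv₁ * P₁) +
    (((M.common : ℝ) * M.priv₂ - 1) * (B.common * B.priv₂) * F₂ +
      ((M.priv₂ : ℝ) - 1) * B.priv₂ * P₂))

open Classical in
/-- The scheme at a fixed block length. The encoder aims at triples of codewords that are jointly
typical with the output with conditional probability at least `1 - η`; the receivers
decode by joint typicality. -/
theorem exists_binningRules {c : CodebookLaw U₀ U₁ U₂} {p : U₀ × U₁ × U₂ → ℝ}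
    (hp : p ∈ stdSimplex ℝ (U₀ × U₁ × U₂)) (f : U₀ × U₁ × U₂ → X)
    (hc : FactorsNeZero c (functionalInput p f)) :
    ∃ C : ℝ, 0 ≤ C ∧ ∀ δ η : ℝ, 0 < δ → 0 < η → η < 1 → ∃ n₀ : ℕ, ∀ n : ℕ, n₀ ≤ n →
      ∃ P : ℝ, (2 : ℝ) ^ (-(n * (realDivCommon c (functionalInput p f) +
          realDivPriv₁ c (functionalInput p f) + realDivPriv₂ c (functionalInput p f) +
          infoCross (functionalInput p f) + δ * C))) / 2 ≤ P ∧
        P ≤ (2 : ℝ) ^ (-(n * (realDivCommon c (functionalInput p f) +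
          realDivPriv₁ c (functionalInput p f) + realDivPriv₂ c (functionalInput p f) +
          infoCross (functionalInput p f) - δ * C))) ∧
        ∀ M B : SizeTriple, 0 < M.common → 0 < M.priv₁ → 0 < M.priv₂ → 0 < B.common →
          0 < B.priv₁ → 0 < B.priv₂ → ∃ S : BinningRules U₀ U₁ U₂ Y₁ Y₂ n M B,
          S.atypicalProb c p δ ≤ coverError B P
            ((2 : ℝ) ^ (-(n * (realDivPriv₁ c (functionalInput p f) +
              realDivPriv₂ c (functionalInput p f) + infoCross (functionalInput p f) - δ * C))))
            ((2 : ℝ) ^ (-(n * (realDivPriv₂ c (functionalInput p f) +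
              infoCross (functionalInput p f) - δ * C))))
            ((2 : ℝ) ^ (-(n * (realDivPriv₁ c (functionalInput p f) +
              infoCross (functionalInput p f) - δ * C)))) ∧
          S.meanError W c f ≤ coverError B P
            ((2 : ℝ) ^ (-(n * (realDivPriv₁ c (functionalInput p f) +
              realDivPriv₂ c (functionalInput p f) + infoCross (functionalInput p f) - δ * C))))
            ((2 : ℝ) ^ (-(n * (realDivPriv₂ c (functionalInput p f) +
              infoCross (functionalInput p f) - δ * C))))
            ((2 : ℝ) ^ (-(n * (realDivPriv₁ c (functionalInput p f) +
              infoCross (functionalInput p f) - δ * C)))) + η +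
            packError M B P
              ((2 : ℝ) ^ (-(n * (infoFull₁ W (functionalInput p f) +
                (realDivCommon c (functionalInput p f) + realDivPriv₁ c (functionalInput p f)) -
                  δ * C))))
              ((2 : ℝ) ^ (-(n * (infoPriv₁ W (functionalInput p f) +
                realDivPriv₁ c (functionalInput p f) - δ * C))))
              ((2 : ℝ) ^ (-(n * (infoFull₂ W (functionalInput p f) +
                (realDivCommon c (functionalInput p f) + realDivPriv₂ c (functionalInput p f)) -
                  δ * C))))
              ((2 : ℝ) ^ (-(n * (infoPriv₂ W (functionalInput p f) +
                realDivPriv₂ c (functionalInput p f) - δ * C)))) := by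
  have hq := functionalInput_mem hp f
  set q := functionalInput p f with hqdef
  obtain ⟨C, hC, hexp⟩ := exists_exponents W hq hc
  refine ⟨C, hC, fun δ η hδ hη hη1 => ?_⟩
  obtain ⟨n₀, hlln⟩ := exists_prob_not_typical_le W hp f hδ (half_pos hη)
  refine ⟨n₀ + 1, fun n hn => ?_⟩
  have hlln := hlln n (by omega)
  have hn0 : (0 : ℝ) < n := Nat.cast_pos.2 (by omega)
  obtain ⟨hT, hF₁, hP₁, hF₂, hP₂⟩ := hexp δ n hδ.le
  have hker := fun u : Fin n → U₀ × U₁ × U₂ =>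
    prodKernel_mem (V := fun u => W.prob (f u)) (fun u => W.prob_mem (f u)) u
  let bad : (Fin n → U₀ × U₁ × U₂) → ℝ := fun u => ∑ y, prodKernel (fun u => W.prob (f u)) u y *
    (if Typical δ (auxOutLaw W q) (fun i => (u i, y i)) then 0 else 1)
  have hbad0 : ∀ u, 0 ≤ bad u := fun u => Finset.sum_nonneg fun y _ =>
    mul_nonneg ((hker u).1 y) (by split_ifs <;> simp)
  let T : (Fin n → U₀) → (Fin n → U₁) → (Fin n → U₂) → Prop := fun u₀ u₁ u₂ =>
    bad (fun i => (u₀ i, u₁ i, u₂ i)) ≤ η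
  have hTy : ∀ u₀ u₁ u₂, T u₀ u₁ u₂ → ∃ y : Fin n → Y₁ × Y₂,
      Typical δ (auxOutLaw W q) (fun i => ((u₀ i, u₁ i, u₂ i), y i)) := by
    intro u₀ u₁ u₂ h
    by_contra! hcon
    have : bad (fun i => (u₀ i, u₁ i, u₂ i)) = 1 := by
      simp only [bad, hcon, if_false, mul_one, (hker _).2]
    simp only [T, this] at h
    linarith
  obtain ⟨hup, hlow, hm₀, hm₁, hm₂⟩ := hT T hTy
  set P := superProb (prodLaw c.p₀) (prodKernel c.p₁) (prodKernel c.p₂)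
    (fun u₀ u₁ u₂ => if T u₀ u₁ u₂ then 1 else 0) with hP
  have hgood : 1 / 2 ≤ ∑ u : Fin n → U₀ × U₁ × U₂, prodLaw (pmfLaw q (fun z => z.1)) u *
      (if T (fun i => (u i).1) (fun i => (u i).2.1) (fun i => (u i).2.2) then 1 else 0) := by
    rw [hqdef, pmfLaw_functionalInput_fst]
    have hpn := prodLaw_mem (n := n) hp
    have h1 : ∀ u : Fin n → U₀ × U₁ × U₂, prodLaw p u - prodLaw p u * bad u / η ≤ prodLaw p u *
        (if T (fun i => (u i).1) (fun i => (u i).2.1) (fun i => (u i).2.2) then 1 else 0) := by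
      intro u
      have hu := hpn.1 u
      split_ifs with ht
      · have := div_nonneg (mul_nonneg hu (hbad0 u)) hη.le
        linarith
      · have : η < bad u := not_le.1 ht
        rw [mul_zero, sub_nonpos, le_div_iff₀ hη]
        exact mul_le_mul_of_nonneg_left this.le hu
    refine le_trans ?_ (Finset.sum_le_sum fun u _ => h1 u)
    rw [Finset.sum_sub_distrib, hpn.2, ← Finset.sum_div]
    have : (∑ u : Fin n → U₀ × U₁ × U₂, prodLaw p u * bad u) / η ≤ 1 / 2 := by
      rw [div_le_iff₀ hη]
      linarith
    linarith
  have hPlow : (2 : ℝ) ^ (-(n * (realDivCommon c q + realDivPriv₁ c q + realDivPriv₂ c q +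
      infoCross q + δ * C))) / 2 ≤ P := by
    refine le_trans ?_ hlow
    rw [div_eq_mul_one_div]
    exact mul_le_mul_of_nonneg_left hgood (by positivity)
  have hPpos : 0 < P := lt_of_lt_of_le (by positivity) hPlow
  refine ⟨P, hPlow, hup, fun M B hM₀ hM₁ hM₂ hB₀ hB₁ hB₂ => ?_⟩
  have := Fin.pos_iff_nonempty.1 hM₀
  have := Fin.pos_iff_nonempty.1 hM₁
  have := Fin.pos_iff_nonempty.1 hM₂
  have := Fin.pos_iff_nonempty.1 hB₀
  have := Fin.pos_iff_nonempty.1 hB₁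
  have := Fin.pos_iff_nonempty.1 hB₂
  have hcb : CoveringBounds (prodLaw c.p₀) (prodKernel c.p₁) (prodKernel c.p₂)
      (fun u₀ u₁ u₂ => if T u₀ u₁ u₂ then 1 else 0) P _ _ _ :=
    ⟨fun _ _ _ => by split_ifs <;> simp, rfl, hPpos, hm₀, hm₁, hm₂⟩
  have hη' : ∀ u₀ u₁ u₂, T u₀ u₁ u₂ →
      ∑ y : Fin n → Y₁ × Y₂, prodKernel (fun u => W.prob (f u)) (fun i => (u₀ i, u₁ i, u₂ i)) y *
      (if Typical δ (pmfLaw (transmitLaw W q) (fun ω => ((ω.1.1.1, ω.1.1.2.1), ω.2.1)))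
          (fun i => ((u₀ i, u₁ i), (y i).1)) ∧
        Typical δ (pmfLaw (transmitLaw W q) (fun ω => ((ω.1.1.1, ω.1.1.2.2), ω.2.2)))
          (fun i => ((u₀ i, u₂ i), (y i).2)) then 0 else 1) ≤ η := by
    intro u₀ u₁ u₂ h
    refine le_trans (Finset.sum_le_sum fun y _ =>
      mul_le_mul_of_nonneg_left ?_ ((hker _).1 y)) h
    split_ifs with a b b <;> norm_num
    exact a ⟨typical_of_auxOutLaw W b (fun z => ((z.1.1, z.1.2.1), z.2.1)),
      typical_of_auxOutLaw W b (fun z => ((z.1.1, z.1.2.2), z.2.2))⟩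
  obtain ⟨bins, dec₁, dec₂, hS⟩ := exists_scheme (μ₀ := Fin M.common) (μ₁ := Fin M.priv₁)
    (μ₂ := Fin M.priv₂) (β₀ := Fin B.common) (β₁ := Fin B.priv₁) (β₂ := Fin B.priv₂)
    (c.isSuperposition n) hcb (by positivity) (by positivity) (by positivity)
    (w := fun u₀ u₁ u₂ y => prodKernel (fun u => W.prob (f u)) (fun i => (u₀ i, u₁ i, u₂ i)) y)
    (fun _ _ _ => hker _) (fun y i => (y i).1) (fun y i => (y i).2)
    (G₁ := fun u₀ u₁ y => Typical δ
      (pmfLaw (transmitLaw W q) (fun ω => ((ω.1.1.1, ω.1.1.2.1), ω.2.1)))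
        (fun i => ((u₀ i, u₁ i), y i)))
    (G₂ := fun u₀ u₂ y => Typical δ
      (pmfLaw (transmitLaw W q) (fun ω => ((ω.1.1.1, ω.1.1.2.2), ω.2.2)))
        (fun i => ((u₀ i, u₂ i), y i)))
    hη.le (by positivity) (by positivity) hη' hF₁ hP₁ hF₂ hP₂
  simp only [Fintype.card_fin] at hS
  have hN : (M.common : ℝ) * M.priv₁ * M.priv₂ =
      Fintype.card (Fin M.common × Fin M.priv₁ × Fin M.priv₂) := by
    simp [mul_assoc]
  have hN0 : (0 : ℝ) < (M.common : ℝ) * M.priv₁ * M.priv₂ := by positivity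
  refine ⟨⟨bins, dec₁, dec₂⟩, ?_, ?_⟩
  · refine sum_mul_average_le (fun K => c.bookProb K) _ hN hN0 fun v => ?_
    refine le_trans (Finset.sum_le_sum fun K _ => ?_) (hS v).1
    refine mul_le_mul_of_nonneg_left ?_ ((c.isSuperposition n).bookWeight_nonneg K)
    split_ifs with a b b <;> norm_num
    refine a fun u => ?_
    obtain ⟨y, hy⟩ := hTy _ _ _ b
    have h1 := typical_of_auxOutLaw W hy (fun z => z.1) u
    rw [← pmfLaw_comp (transmitLaw W q) (fun ω => ω.1) (fun z => z.1), pmfLaw_transmitLaw_fst,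
      hqdef, pmfLaw_functionalInput_fst] at h1
    have h2 : ∀ s : Fin n → U₀ × U₁ × U₂, occ s u =
        ((Finset.univ.filter fun i => s i = u).card : ℝ) := by
      intro s
      simp [occ, pmfLaw]
    have hpu : p u ≤ 1 := by
      rw [← hp.2]
      exact Finset.single_le_sum (fun u _ => hp.1 u) (Finset.mem_univ u)
    rw [h2] at h1
    rw [div_sub' hn0.ne', abs_div, abs_of_pos hn0, div_le_iff₀ hn0]
    refine h1.trans ?_
    rw [mul_comm (n : ℝ)]
    exact mul_le_of_le_one_right (by positivity) hpu
  · refine sum_mul_average_le (fun K => c.bookProb K) _ hN hN0 fun v => ?_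
    refine le_trans (Finset.sum_le_sum fun K _ => ?_) (hS v).2
    refine mul_le_mul_of_nonneg_left ?_ ((c.isSuperposition n).bookWeight_nonneg K)
    refine Finset.sum_le_sum fun y _ => le_of_eq ?_
    split_ifs
    · simp
    · rw [mul_one]
      rfl

end Block

/-! ### Exponential estimates -/

section Numeric

lemma exists_le_two_rpow_mul (A : ℝ) {κ : ℝ} (hκ : 0 < κ) :
    ∃ n₀ : ℕ, ∀ n : ℕ, n₀ ≤ n → A ≤ (2 : ℝ) ^ (n * κ) := by
  have h : Filter.Tendsto (fun n : ℕ => (2 : ℝ) ^ (n * κ)) Filter.atTop Filter.atTop :=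
    (tendsto_rpow_atTop_of_base_gt_one 2 (by norm_num)).comp
      (tendsto_natCast_atTop_atTop.atTop_mul_const hκ)
  exact Filter.eventually_atTop.1 (h.eventually_ge_atTop A)

lemma ceil_two_rpow_pos (a : ℝ) : 0 < ⌈(2 : ℝ) ^ a⌉₊ := Nat.ceil_pos.2 (by positivity)

lemma ceil_two_rpow_sub_one_le (a : ℝ) : (⌈(2 : ℝ) ^ a⌉₊ : ℝ) - 1 ≤ (2 : ℝ) ^ a :=
  sub_le_iff_le_add.2 (Nat.ceil_lt_add_one (by positivity)).le

lemma ceil_two_rpow_le {a : ℝ} (ha : 0 ≤ a) : (⌈(2 : ℝ) ^ a⌉₊ : ℝ) ≤ 2 * (2 : ℝ) ^ a := by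
  have h1 := ceil_two_rpow_sub_one_le a
  have h2 := Real.one_le_rpow (x := 2) (by norm_num) ha
  linarith

lemma mul_le_mul_two_rpow {x y a b c d : ℝ} (hy : 0 ≤ y) (hc : 0 ≤ c)
    (hxc : x ≤ c * (2 : ℝ) ^ a) (hyd : y ≤ d * (2 : ℝ) ^ b) :
    x * y ≤ c * d * (2 : ℝ) ^ (a + b) := by
  rw [Real.rpow_add (by norm_num)]
  calc x * y ≤ (c * (2 : ℝ) ^ a) * (d * (2 : ℝ) ^ b) := mul_le_mul hxc hyd hy (by positivity)
    _ = _ := by ring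

lemma mul_two_rpow_mono {c a b : ℝ} (hc : 0 ≤ c) (hab : a ≤ b) :
    c * (2 : ℝ) ^ a ≤ c * (2 : ℝ) ^ b :=
  mul_le_mul_of_nonneg_left (Real.rpow_le_rpow_of_exponent_le (by norm_num) hab) hc

lemma two_rpow_div_le {B P α β γ τ : ℝ} (hB : (2 : ℝ) ^ β ≤ B) (hP : (2 : ℝ) ^ γ / 2 ≤ P)
    (h : α - β - γ ≤ τ) : (2 : ℝ) ^ α / (B * P) ≤ 2 * (2 : ℝ) ^ τ := by
  have hβ : (0 : ℝ) < 2 ^ β := by positivity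
  have hγ : (0 : ℝ) < 2 ^ γ := by positivity
  refine (div_le_div_of_nonneg_left (by positivity) (by positivity)
    (mul_le_mul hB hP (by positivity) (hβ.le.trans hB))).trans ?_
  refine le_trans (le_of_eq ?_) (mul_two_rpow_mono (by norm_num) h)
  rw [Real.rpow_sub (by norm_num), Real.rpow_sub (by norm_num)]
  field_simp

lemma mul_sub_one_le {M₀ M₁ x₀ x₁ : ℝ} (h₀ : M₀ - 1 ≤ x₀) (h₁ : M₁ - 1 ≤ x₁) (hM₁ : 1 ≤ M₁)
    (hx₀ : 0 ≤ x₀) : M₀ * M₁ - 1 ≤ x₀ * x₁ + x₀ + x₁ := by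
  nlinarith [mul_le_mul h₀ h₁ (by linarith) hx₀]

/-- A product of two numbers of messages, in excess of one, has the sum of the rates. -/
lemma mul_sub_one_le_two_rpow {M₀ M₁ n R₀ R₁ ε : ℝ} (hn : 0 ≤ n) (hR₀ : 0 ≤ R₀) (hR₁ : 0 ≤ R₁)
    (hε : 0 ≤ ε) (hM₁ : 1 ≤ M₁) (h₀ : M₀ - 1 ≤ (2 : ℝ) ^ (n * (R₀ - ε)))
    (h₁ : M₁ - 1 ≤ (2 : ℝ) ^ (n * (R₁ - ε))) :
    M₀ * M₁ - 1 ≤ 3 * (2 : ℝ) ^ (n * (R₀ + R₁ - ε)) := by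
  have h := mul_sub_one_le h₀ h₁ hM₁ (by positivity)
  rw [← Real.rpow_add (by norm_num)] at h
  have e (a : ℝ) (ha : a ≤ n * (R₀ + R₁ - ε)) : (2 : ℝ) ^ a ≤ 2 ^ (n * (R₀ + R₁ - ε)) :=
    Real.rpow_le_rpow_of_exponent_le (by norm_num) ha
  have k1 := e (n * (R₀ - ε) + n * (R₁ - ε)) (by nlinarith)
  have k2 := e (n * (R₀ - ε)) (by nlinarith)
  have k3 := e (n * (R₁ - ε)) (by nlinarith)
  linarith

variable {n d₀ d₁ d₂ I s₀ s₁ s₂ κ t P : ℝ} {B : SizeTriple}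

/-- Covering succeeds when each binning bound is exceeded by a margin `κ`. -/
lemma coverError_le (hn : 0 ≤ n) (hκ : 0 ≤ κ) (ht : 2 * t ≤ κ / 2)
    (hs : s₀ + s₁ + s₂ = d₀ + d₁ + d₂ + I)
    (hs₁ : d₀ + d₁ ≤ s₀ + s₁) (hs₂ : d₀ + d₂ ≤ s₀ + s₂) (hs₀ : d₀ ≤ s₀)
    (hP : (2 : ℝ) ^ (-(n * (d₀ + d₁ + d₂ + I + t))) / 2 ≤ P)
    (hB₀ : (2 : ℝ) ^ (n * (s₀ + κ)) ≤ B.common) (hB₁ : (2 : ℝ) ^ (n * (s₁ + κ)) ≤ B.priv₁)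
    (hB₂ : (2 : ℝ) ^ (n * (s₂ + κ)) ≤ B.priv₂) :
    coverError B P ((2 : ℝ) ^ (-(n * (d₁ + d₂ + I - t)))) ((2 : ℝ) ^ (-(n * (d₂ + I - t))))
      ((2 : ℝ) ^ (-(n * (d₁ + I - t)))) ≤ 8 * (2 : ℝ) ^ (-(n * (κ / 2))) := by
  have hB₀₁ : (2 : ℝ) ^ (n * (s₀ + κ) + n * (s₁ + κ)) ≤ B.common * B.priv₁ := by
    rw [Real.rpow_add (by norm_num)]
    exact mul_le_mul hB₀ hB₁ (by positivity) (by positivity)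
  have hB₀₂ : (2 : ℝ) ^ (n * (s₀ + κ) + n * (s₂ + κ)) ≤ B.common * B.priv₂ := by
    rw [Real.rpow_add (by norm_num)]
    exact mul_le_mul hB₀ hB₂ (by positivity) (by positivity)
  have hB : (2 : ℝ) ^ (n * (s₀ + κ) + n * (s₁ + κ) + n * (s₂ + κ)) ≤
      B.common * B.priv₁ * B.priv₂ := by
    rw [Real.rpow_add (by norm_num)]
    exact mul_le_mul hB₀₁ hB₂ (by positivity) (by positivity)
  have k0 := two_rpow_div_le (α := -(n * (d₁ + d₂ + I - t))) (τ := -(n * (κ / 2))) hB₀ hP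
    (by nlinarith)
  have k1 := two_rpow_div_le (α := -(n * (d₂ + I - t))) (τ := -(n * (κ / 2))) hB₀₁ hP
    (by nlinarith)
  have k2 := two_rpow_div_le (α := -(n * (d₁ + I - t))) (τ := -(n * (κ / 2))) hB₀₂ hP
    (by nlinarith)
  have k3 := two_rpow_div_le (α := 0) (τ := -(n * (κ / 2))) hB hP (by nlinarith)
  rw [Real.rpow_zero] at k3
  unfold coverError
  linarith

/-- Packing succeeds when each decoding bound holds with a margin `10 * κ` in the message rates,
because the expected number of bin triples that hit the target set is `2 ^ (n * (3 * κ + t))`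
at most. -/
lemma packError_le {M : SizeTriple} {R r : RateTriple} {F₁ P₁ F₂ P₂ : ℝ} (hn : 0 ≤ n)
    (hκ : 0 ≤ κ) (ht : 2 * t ≤ κ / 2) (hR : R.Nonneg)
    (hs : s₀ + s₁ + s₂ = d₀ + d₁ + d₂ + I)
    (hr₀ : s₀ ≤ r.common) (hr₁ : s₁ ≤ r.priv₁) (hr₂ : s₂ ≤ r.priv₂)
    (hF₁ : R.common + r.common + (R.priv₁ + r.priv₁) ≤ F₁ + (d₀ + d₁))
    (hP₁ : R.priv₁ + r.priv₁ ≤ P₁ + d₁)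
    (hF₂ : R.common + r.common + (R.priv₂ + r.priv₂) ≤ F₂ + (d₀ + d₂))
    (hP₂ : R.priv₂ + r.priv₂ ≤ P₂ + d₂)
    (hPpos : 0 ≤ P) (hP : P ≤ (2 : ℝ) ^ (-(n * (d₀ + d₁ + d₂ + I - t))))
    (hB₀ : (B.common : ℝ) ≤ 2 * (2 : ℝ) ^ (n * (s₀ + κ)))
    (hB₁ : (B.priv₁ : ℝ) ≤ 2 * (2 : ℝ) ^ (n * (s₁ + κ)))
    (hB₂ : (B.priv₂ : ℝ) ≤ 2 * (2 : ℝ) ^ (n * (s₂ + κ)))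
    (hM₁pos : 0 < M.priv₁) (hM₂pos : 0 < M.priv₂)
    (hM₀ : (M.common : ℝ) - 1 ≤ (2 : ℝ) ^ (n * (R.common - 10 * κ)))
    (hM₁ : (M.priv₁ : ℝ) - 1 ≤ (2 : ℝ) ^ (n * (R.priv₁ - 10 * κ)))
    (hM₂ : (M.priv₂ : ℝ) - 1 ≤ (2 : ℝ) ^ (n * (R.priv₂ - 10 * κ))) :
    packError M B P ((2 : ℝ) ^ (-(n * (F₁ + (d₀ + d₁) - t)))) ((2 : ℝ) ^ (-(n * (P₁ + d₁ - t))))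
      ((2 : ℝ) ^ (-(n * (F₂ + (d₀ + d₂) - t)))) ((2 : ℝ) ^ (-(n * (P₂ + d₂ - t)))) ≤
      224 * (2 : ℝ) ^ (-(n * (κ / 2))) := by
  obtain ⟨hR₀, hR₁, hR₂⟩ := hR
  -- The exponents are compared after multiplication of the bounds on the rates by `n`.
  have hs := congrArg (n * ·) hs
  have hr₀ := mul_le_mul_of_nonneg_left hr₀ hn
  have hr₁ := mul_le_mul_of_nonneg_left hr₁ hn
  have hr₂ := mul_le_mul_of_nonneg_left hr₂ hn
  have hF₁ := mul_le_mul_of_nonneg_left hF₁ hn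
  have hP₁ := mul_le_mul_of_nonneg_left hP₁ hn
  have hF₂ := mul_le_mul_of_nonneg_left hF₂ hn
  have hP₂ := mul_le_mul_of_nonneg_left hP₂ hn
  have ht := mul_le_mul_of_nonneg_left ht hn
  have hnκ := mul_nonneg hn hκ
  have hone (a : ℝ) : (2 : ℝ) ^ a ≤ 1 * (2 : ℝ) ^ a := (one_mul _).ge
  have hB₀₁ := mul_le_mul_two_rpow (Nat.cast_nonneg _) (by norm_num) hB₀ hB₁
  have hB₀₂ := mul_le_mul_two_rpow (Nat.cast_nonneg _) (by norm_num) hB₀ hB₂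
  have hBP := mul_le_mul_two_rpow hPpos (by norm_num)
    (mul_le_mul_two_rpow (Nat.cast_nonneg _) (by norm_num) hB₀₁ hB₂) (hP.trans (hone _))
  have hM₀₁ := mul_sub_one_le_two_rpow hn hR₀ hR₁ (by linarith) (Nat.one_le_cast.2 hM₁pos) hM₀ hM₁
  have hM₀₂ := mul_sub_one_le_two_rpow hn hR₀ hR₂ (by linarith) (Nat.one_le_cast.2 hM₂pos) hM₀ hM₂
  have full₁ := (mul_le_mul_two_rpow (by positivity) (by norm_num)
    (mul_le_mul_two_rpow (by positivity) (by norm_num) hM₀₁ hB₀₁)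
    (hone (-(n * (F₁ + (d₀ + d₁) - t))))).trans
    (mul_two_rpow_mono (b := n * (2 * κ + t - 10 * κ)) (by norm_num) (by linarith))
  have full₂ := (mul_le_mul_two_rpow (by positivity) (by norm_num)
    (mul_le_mul_two_rpow (by positivity) (by norm_num) hM₀₂ hB₀₂)
    (hone (-(n * (F₂ + (d₀ + d₂) - t))))).trans
    (mul_two_rpow_mono (b := n * (2 * κ + t - 10 * κ)) (by norm_num) (by linarith))
  have priv₁ := (mul_le_mul_two_rpow (by positivity) (by norm_num)
    (mul_le_mul_two_rpow (by positivity) (by norm_num) (hM₁.trans (hone _)) hB₁)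
    (hone (-(n * (P₁ + d₁ - t))))).trans
    (mul_two_rpow_mono (b := n * (2 * κ + t - 10 * κ)) (by norm_num) (by linarith))
  have priv₂ := (mul_le_mul_two_rpow (by positivity) (by norm_num)
    (mul_le_mul_two_rpow (by positivity) (by norm_num) (hM₂.trans (hone _)) hB₂)
    (hone (-(n * (P₂ + d₂ - t))))).trans
    (mul_two_rpow_mono (b := n * (2 * κ + t - 10 * κ)) (by norm_num) (by linarith))
  have hX : (0 : ℝ) ≤ B.common * B.priv₁ * B.priv₂ * P := by positivity
  unfold packError
  refine (mul_le_mul_of_nonneg_left (c := 28 * (2 : ℝ) ^ (n * (2 * κ + t - 10 * κ)))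
    (by linarith) hX).trans ?_
  refine (mul_le_mul_two_rpow (by positivity) (by norm_num) hBP le_rfl).trans ?_
  norm_num only
  exact mul_two_rpow_mono (by norm_num) (by linarith)

end Numeric

/-! ### Achievability -/

section Achievability

variable {X Y₁ Y₂ U₀ U₁ U₂ : Type*} [Fintype U₀] [Fintype U₁] [Fintype U₂]

lemma BinningRules.atypicalProb_anti {n : ℕ} {M B : SizeTriple}
    (S : BinningRules U₀ U₁ U₂ Y₁ Y₂ n M B) (c : CodebookLaw U₀ U₁ U₂) (p : U₀ × U₁ × U₂ → ℝ)
    {δ ε : ℝ} (h : δ ≤ ε) : S.atypicalProb c p ε ≤ S.atypicalProb c p δ := by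
  unfold BinningRules.atypicalProb
  refine Finset.sum_le_sum fun K _ => mul_le_mul_of_nonneg_left ?_
    ((c.isSuperposition n).bookWeight_nonneg K)
  refine div_le_div_of_nonneg_right (Finset.sum_le_sum fun w _ => ?_) (by positivity)
  split_ifs with a b b <;> norm_num
  exact a fun u => (b u).trans h

variable [Fintype Y₁] [Fintype Y₂] (W : BroadcastChannel X Y₁ Y₂)

/-- Splitting of a common index into a part for receiver 1 and a part for receiver 2, each
of which is joined to the private index of that receiver. -/
def splitIndex (a b k₁ k₂ : ℕ) :
    Fin (a * b) × Fin k₁ × Fin k₂ ≃ Fin (a * k₁) × Fin (b * k₂) :=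
  (finProdFinEquiv.symm.prodCongr (Equiv.refl _)).trans
    ((Equiv.prodProdProdComm _ _ _ _).trans (finProdFinEquiv.prodCongr finProdFinEquiv))

/-- Some codebook does as well as the average one, and decoding the common message in
addition cannot decrease the error probability. -/
lemma BinningRules.exists_code_errorProb_le {n a b k₁ k₂ : ℕ} {B : SizeTriple}
    (S : BinningRules U₀ U₁ U₂ Y₁ Y₂ n ⟨a * b, k₁, k₂⟩ B) (c : CodebookLaw U₀ U₁ U₂)
    (f : U₀ × U₁ × U₂ → X) {ε : ℝ} (hS : S.meanError W c f ≤ ε) :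
    ∃ C : BroadcastCode X Y₁ Y₂ n (a * k₁) (b * k₂), C.errorProb W ≤ ε := by
  classical
  obtain ⟨K, hK⟩ : ∃ K : Codebook U₀ U₁ U₂ n ⟨a * b, k₁, k₂⟩ B,
      (∑ w : Fin (a * b) × Fin k₁ × Fin k₂, ∑ y : Fin n → Y₁ × Y₂,
        if S.dec₁ K (fun i => (y i).1) = (w.1, w.2.1) ∧ S.dec₂ K (fun i => (y i).2) = (w.1, w.2.2)
        then 0 else ∏ i, W.prob (f (S.words K w i)) (y i)) /
          (((a * b : ℕ) : ℝ) * k₁ * k₂) ≤ ε := by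
    by_contra! hcon
    have hw : ∑ K : Codebook U₀ U₁ U₂ n ⟨a * b, k₁, k₂⟩ B, c.bookProb K = 1 :=
      (c.isSuperposition n).sum_bookWeight
    have hw0 : ∀ K : Codebook U₀ U₁ U₂ n ⟨a * b, k₁, k₂⟩ B, 0 ≤ c.bookProb K :=
      (c.isSuperposition n).bookWeight_nonneg
    obtain ⟨K, hK⟩ : ∃ K : Codebook U₀ U₁ U₂ n ⟨a * b, k₁, k₂⟩ B, 0 < c.bookProb K := by
      by_contra! h
      have := Finset.sum_nonpos fun K (_ : K ∈ Finset.univ) => h K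
      linarith
    have hlt : ∑ K : Codebook U₀ U₁ U₂ n ⟨a * b, k₁, k₂⟩ B, c.bookProb K * ε < S.meanError W c f :=
      Finset.sum_lt_sum (fun K _ => mul_le_mul_of_nonneg_left (hcon K).le (hw0 K))
        ⟨K, Finset.mem_univ _, mul_lt_mul_of_pos_left (hcon K) hK⟩
    rw [← Finset.sum_mul, hw, one_mul] at hlt
    linarith
  let E := splitIndex a b k₁ k₂
  refine ⟨⟨fun m₁ m₂ i => f (S.words K (E.symm (m₁, m₂)) i),
    fun y => finProdFinEquiv ((finProdFinEquiv.symm (S.dec₁ K y).1).1, (S.dec₁ K y).2),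
    fun y => finProdFinEquiv ((finProdFinEquiv.symm (S.dec₂ K y).1).2, (S.dec₂ K y).2)⟩, ?_⟩
  refine le_trans ?_ hK
  unfold BroadcastCode.errorProb
  have hden : ((a * k₁ : ℕ) : ℝ) * ((b * k₂ : ℕ) : ℝ) = ((a * b : ℕ) : ℝ) * k₁ * k₂ := by
    push_cast; ring
  rw [hden]
  refine div_le_div_of_nonneg_right ?_ (by positivity)
  rw [← Fintype.sum_prod_type', ← E.sum_comp]
  refine Finset.sum_le_sum fun w _ => Finset.sum_le_sum fun y _ => ?_
  have hnn : 0 ≤ ∏ i, W.prob (f (S.words K w i)) (y i) :=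
    Finset.prod_nonneg fun i _ => (W.prob_mem _).1 _
  simp only [Prod.mk.eta, Equiv.symm_apply_apply]
  split_ifs with h1 h2 h2
  · exact le_rfl
  · exact hnn
  · refine absurd ⟨?_, ?_⟩ h1
    · rw [h2.1]; rfl
    · rw [h2.2]; rfl
  · exact le_rfl

variable [Fintype X]

/-- The scheme works for all large `n` and for every choice of the numbers of messages that
respects the message rates. -/
theorem exists_binningRules_of_schemeBounds {c : CodebookLaw U₀ U₁ U₂}
    {p : U₀ × U₁ × U₂ → ℝ} (hp : p ∈ stdSimplex ℝ (U₀ × U₁ × U₂)) (f : U₀ × U₁ × U₂ → X)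
    {R r : RateTriple} (hb : SchemeBounds W c (functionalInput p f) R r) {ε : ℝ} (hε : 0 < ε) :
    ∃ n₀ : ℕ, ∀ n : ℕ, n₀ ≤ n → ∀ M : SizeTriple, 0 < M.common → 0 < M.priv₁ → 0 < M.priv₂ →
      (M.common : ℝ) - 1 ≤ (2 : ℝ) ^ ((n : ℝ) * (R.common - ε)) →
      (M.priv₁ : ℝ) - 1 ≤ (2 : ℝ) ^ ((n : ℝ) * (R.priv₁ - ε)) →
      (M.priv₂ : ℝ) - 1 ≤ (2 : ℝ) ^ ((n : ℝ) * (R.priv₂ - ε)) →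
      ∃ (B : SizeTriple) (S : BinningRules U₀ U₁ U₂ Y₁ Y₂ n M B),
        (B.common : ℝ) ≤ (2 : ℝ) ^ ((n : ℝ) * (r.common + ε)) ∧
        (B.priv₁ : ℝ) ≤ (2 : ℝ) ^ ((n : ℝ) * (r.priv₁ + ε)) ∧
        (B.priv₂ : ℝ) ≤ (2 : ℝ) ^ ((n : ℝ) * (r.priv₂ + ε)) ∧
        S.atypicalProb c p ε ≤ ε ∧ S.meanError W c f ≤ ε := by
  have hq := functionalInput_mem hp f
  -- The bound on the sum of the binning rates is finite, which forces absolute continuity.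
  have hc : FactorsNeZero c (functionalInput p f) := factorsNeZero_of_ac hq.1
    (ac_of_divAll_ne_top (ne_top_of_le_ne_top (EReal.coe_ne_top _) hb.bin_all))
  obtain ⟨hR, ⟨hr₀, hr₁, hr₂⟩, hall, hp₁, hp₂, hcm, hF₁, hP₁, hF₂, hP₂⟩ :=
    (schemeBounds_iff_real W hq hc R r).1 hb
  obtain ⟨s₀, s₁, s₂, hs₀0, hs₁0, hs₂0, hs₀, hs₁, hs₂, hsum, hsp₁, hsp₂, hsc⟩ :=
    exists_tight_binning (realDivCommon_nonneg hq hc) (realDivPriv₁_nonneg hq.1 hc)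
      (realDivPriv₂_nonneg hq.1 hc) (infoCross_nonneg hq.1) hr₁ hr₂ hall hp₁ hp₂ hcm
  obtain ⟨C, hC, hmain⟩ := exists_binningRules W hp f hc
  obtain ⟨κ, rfl⟩ : ∃ κ, ε = 10 * κ := ⟨ε / 10, by ring⟩
  have hκ : 0 < κ := by linarith
  -- Binning at margin `κ` costs `3 * κ` in packing, and the pairs of bins cost `2 * κ`; the loss
  -- `δ * C` due to typicality is kept so small that both covering and packing gain `κ / 2`.
  obtain ⟨δ, hδ, hδε, hδC⟩ : ∃ δ, 0 < δ ∧ δ ≤ 10 * κ ∧ 2 * (δ * C) ≤ κ / 2 := by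
    refine ⟨min (10 * κ) (κ / (4 * (C + 1))), by positivity, min_le_left _ _, ?_⟩
    have h := min_le_right (10 * κ) (κ / (4 * (C + 1)))
    rw [le_div_iff₀ (by positivity)] at h
    have : 0 < min (10 * κ) (κ / (4 * (C + 1))) := by positivity
    nlinarith
  obtain ⟨η, hη, hηε, hη1⟩ : ∃ η : ℝ, 0 < η ∧ η ≤ 5 * κ ∧ η < 1 :=
    ⟨min (5 * κ) (1 / 2), by positivity, min_le_left _ _,
      (min_le_right _ _).trans_lt (by norm_num)⟩
  obtain ⟨n₀, hmain⟩ := hmain δ η hδ hη hη1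
  obtain ⟨n₁, hn₁⟩ := exists_le_two_rpow_mul 2 (κ := 9 * κ) (by positivity)
  obtain ⟨n₂, hn₂⟩ := exists_le_two_rpow_mul (232 / (5 * κ)) (half_pos hκ)
  refine ⟨max n₀ (max n₁ n₂), fun n hn M hM₀ hM₁ hM₂ hM₀' hM₁' hM₂' => ?_⟩
  obtain ⟨P, hPlow, hPup, hSch⟩ := hmain n (le_trans (le_max_left _ _) hn)
  have hn₁ := hn₁ n (le_trans (le_trans (le_max_left _ _) (le_max_right _ _)) hn)
  have hn₂ := hn₂ n (le_trans (le_trans (le_max_right _ _) (le_max_right _ _)) hn)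
  have hn0 : (0 : ℝ) ≤ n := Nat.cast_nonneg n
  have hsmall : 232 * (2 : ℝ) ^ (-(n * (κ / 2))) ≤ 5 * κ := by
    rw [Real.rpow_neg (by norm_num), ← div_eq_mul_inv, div_le_iff₀ (by positivity)]
    rwa [div_le_iff₀' (by positivity)] at hn₂
  have hbins (s r : ℝ) (hs : 0 ≤ s) (hsr : s ≤ r) :
      (⌈(2 : ℝ) ^ (n * (s + κ))⌉₊ : ℝ) ≤ (2 : ℝ) ^ ((n : ℝ) * (r + 10 * κ)) := by
    refine (ceil_two_rpow_le (by positivity)).trans ?_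
    refine (mul_le_mul_of_nonneg_right hn₁ (by positivity)).trans ?_
    rw [← Real.rpow_add (by norm_num)]
    exact Real.rpow_le_rpow_of_exponent_le (by norm_num) (by nlinarith)
  have hPpos : 0 ≤ P := le_trans (by positivity) hPlow
  let B : SizeTriple := ⟨⌈(2 : ℝ) ^ (n * (s₀ + κ))⌉₊, ⌈(2 : ℝ) ^ (n * (s₁ + κ))⌉₊,
    ⌈(2 : ℝ) ^ (n * (s₂ + κ))⌉₊⟩
  obtain ⟨S, hS₁, hS₂⟩ := hSch M B hM₀ hM₁ hM₂ (ceil_two_rpow_pos _) (ceil_two_rpow_pos _)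
    (ceil_two_rpow_pos _)
  have hcov := coverError_le (B := B) hn0 hκ.le hδC hsum hsp₁ hsp₂ hsc hPlow (Nat.le_ceil _)
    (Nat.le_ceil _) (Nat.le_ceil _)
  have hpack := packError_le (B := B) hn0 hκ.le hδC hR hsum hs₀ hs₁ hs₂ hF₁ hP₁ hF₂ hP₂ hPpos hPup
    (ceil_two_rpow_le (by positivity)) (ceil_two_rpow_le (by positivity))
    (ceil_two_rpow_le (by positivity)) hM₁ hM₂ hM₀' hM₁' hM₂'
  have hpos : (0 : ℝ) < 2 ^ (-(n * (κ / 2))) := by positivity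
  exact ⟨B, S, hbins _ _ hs₀0 hs₀, hbins _ _ hs₁0 hs₁, hbins _ _ hs₂0 hs₂,
    (S.atypicalProb_anti c p hδε).trans (by linarith), by linarith⟩

theorem schemeAchieves_of_schemeBounds {c : CodebookLaw U₀ U₁ U₂}
    {p : U₀ × U₁ × U₂ → ℝ} (hp : p ∈ stdSimplex ℝ (U₀ × U₁ × U₂)) (f : U₀ × U₁ × U₂ → X)
    {R r : RateTriple} (hb : SchemeBounds W c (functionalInput p f) R r) :
    SchemeAchieves W c p f R r := by
  intro ε hε
  obtain ⟨n₀, h⟩ := exists_binningRules_of_schemeBounds W hp f hb hε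
  refine ⟨n₀, fun n hn => ?_⟩
  obtain ⟨B, S, hS⟩ := h n hn ⟨⌈(2 : ℝ) ^ (n * (R.common - ε))⌉₊, ⌈(2 : ℝ) ^ (n * (R.priv₁ - ε))⌉₊,
    ⌈(2 : ℝ) ^ (n * (R.priv₂ - ε))⌉₊⟩ (ceil_two_rpow_pos _) (ceil_two_rpow_pos _)
    (ceil_two_rpow_pos _) (ceil_two_rpow_sub_one_le _) (ceil_two_rpow_sub_one_le _)
    (ceil_two_rpow_sub_one_le _)
  exact ⟨_, B, S, Nat.le_ceil _, Nat.le_ceil _, Nat.le_ceil _, hS⟩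

theorem schemeRegion_subset_capacityRegion : schemeRegion W ⊆ capacityRegion W := by
  rintro ⟨R₁, R₂⟩ ⟨k₀, k₁, k₂, c, p, f, hp, R, r, α, ⟨hα0, hα1⟩, hb, rfl, rfl⟩
  obtain ⟨hR₀, hR₁, hR₂⟩ := hb.rates_nonneg
  have hαR : 0 ≤ α * R.common := mul_nonneg hα0 hR₀
  have hαR' : 0 ≤ (1 - α) * R.common := mul_nonneg (sub_nonneg.2 hα1) hR₀
  refine ⟨by simp only; linarith, by simp only; linarith, fun ε hε => ?_⟩
  obtain ⟨n₀, h⟩ := exists_binningRules_of_schemeBounds W hp f hb (ε := ε / 4) (by positivity)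
  obtain ⟨n₁, hn₁⟩ := exists_le_two_rpow_mul 3 (κ := ε / 4) (by positivity)
  refine ⟨max n₀ n₁, fun n hn => ?_⟩
  have hn₁ := hn₁ n (le_trans (le_max_right _ _) hn)
  have hn0 : (0 : ℝ) ≤ n := Nat.cast_nonneg n
  set a := ⌈(2 : ℝ) ^ (n * (α * R.common - ε / 2))⌉₊ with ha
  set b := ⌈(2 : ℝ) ^ (n * ((1 - α) * R.common - ε / 2))⌉₊ with hb'
  set m₁ := ⌈(2 : ℝ) ^ (n * (R.priv₁ - ε / 4))⌉₊ with hm₁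
  set m₂ := ⌈(2 : ℝ) ^ (n * (R.priv₂ - ε / 4))⌉₊ with hm₂
  -- The rounded numbers of the two parts of the common index may waste a factor of three, for
  -- which the difference between the margins `ε / 2` and `ε / 4` makes up.
  have hab : ((a * b : ℕ) : ℝ) - 1 ≤ (2 : ℝ) ^ (n * (R.common - ε / 4)) := by
    have := mul_sub_one_le_two_rpow hn0 hαR hαR' (ε := ε / 2) (by positivity)
      (Nat.one_le_cast.2 (ceil_two_rpow_pos _)) (ceil_two_rpow_sub_one_le _)
      (ceil_two_rpow_sub_one_le _)
    rw [Nat.cast_mul]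
    refine this.trans ((mul_le_mul_of_nonneg_right hn₁ (by positivity)).trans ?_)
    rw [← Real.rpow_add (by norm_num)]
    exact Real.rpow_le_rpow_of_exponent_le (by norm_num) (le_of_eq (by ring))
  have hcount (x y z : ℝ) (hz : z ≤ x + y) : (2 : ℝ) ^ (n * (z - ε)) ≤
      ((⌈(2 : ℝ) ^ (n * (x - ε / 2))⌉₊ * ⌈(2 : ℝ) ^ (n * (y - ε / 4))⌉₊ : ℕ) : ℝ) := by
    rw [Nat.cast_mul]
    refine le_trans ?_ (mul_le_mul (Nat.le_ceil _) (Nat.le_ceil _) (by positivity)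
      (Nat.cast_nonneg _))
    rw [← Real.rpow_add (by norm_num)]
    exact Real.rpow_le_rpow_of_exponent_le (by norm_num) (by nlinarith)
  obtain ⟨B, S, -, -, -, -, hS⟩ := h n (le_trans (le_max_left _ _) hn) ⟨a * b, m₁, m₂⟩
    (Nat.mul_pos (ceil_two_rpow_pos _) (ceil_two_rpow_pos _)) (ceil_two_rpow_pos _)
    (ceil_two_rpow_pos _) hab (ceil_two_rpow_sub_one_le _) (ceil_two_rpow_sub_one_le _)
  obtain ⟨C, hC⟩ := S.exists_code_errorProb_le W c f (hS.trans (by linarith : ε / 4 ≤ ε))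
  exact ⟨a * m₁, b * m₂, C, hcount _ _ _ (by simp only; linarith),
    hcount _ _ _ (by simp only; linarith), hC⟩

end Achievability

end

theorem mainTheorem4 {X Y₁ Y₂ : Type*} [Fintype X] [Fintype Y₁] [Fintype Y₂]
    (W : BroadcastChannel X Y₁ Y₂) :
    (∀ (U₀ U₁ U₂ : Type) [Fintype U₀] [Fintype U₁] [Fintype U₂] (c : CodebookLaw U₀ U₁ U₂)
      (p : U₀ × U₁ × U₂ → ℝ) (f : U₀ × U₁ × U₂ → X) (R r : RateTriple),
      p ∈ stdSimplex ℝ (U₀ × U₁ × U₂) → SchemeBounds W c (functionalInput p f) R r →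
      SchemeAchieves W c p f R r) ∧
    schemeRegion W ⊆ capacityRegion W ∧
    (∀ (U₀ U₁ U₂ : Type) [Fintype U₀] [Fintype U₁] [Fintype U₂]
      (c : CodebookLaw U₀ U₁ U₂) (q : (U₀ × U₁ × U₂) × X → ℝ),
      q ∈ stdSimplex ℝ ((U₀ × U₁ × U₂) × X) →
      (∀ u, c.joint u = 0 → pmfLaw q (fun z => z.1) u = 0) →
      (∀ R : RateTriple, (∃ r : RateTriple, SchemeBounds W c q R r) ↔ EliminatedBounds W c q R) ∧
      schemePairs W c q = martonPairs W q) ∧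
    schemeRegion W = martonRegion W := by
  refine ⟨fun U₀ U₁ U₂ _ _ _ c p f R r hp hb => schemeAchieves_of_schemeBounds W hp f hb,
    schemeRegion_subset_capacityRegion W, fun U₀ U₁ U₂ _ _ _ c q hq hac => ?_,
    schemeRegion_eq_martonRegion W⟩
  have hc := factorsNeZero_of_ac hq.1 hac
  exact ⟨exists_schemeBounds_iff W hq hc, schemePairs_eq_martonPairs W hq hc⟩
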